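/- Let $n\ge 3$ and $V_0>0$. There is a constant $C>0$, depending only on $n$ and $V_0$, with the following property. Let $a\in C(\mathbb R^n)$ be real valued with $a(x)\ge V_0$ for all $x\in\mathbb R^n$ ($a$ may be unbounded), and let the real valued initial data satisfy $u_0\in H^2(\mathbb R^n)\cap L^1(\mathbb R^n)$, $u_1\in H^1(\mathbb R^n)\cap L^1(\mathbb R^n)$ and $a\,u_0\in L^1(\mathbb R^n)\cap L^2(\mathbb R^n)$. Consider the Cauchy problem $$u_{tt}-\Delta u+a(x)u_t=0\ \text{ in }(0,\infty)\times\mathbb R^n,\qquad u(0,\cdot)=u_0,\quad u_t(0,\cdot)=u_1,$$ and call $u$ a weak solution of it if $$\int_0^\infty\!\!\int_{\mathbb R^n}u\,(\phi_{tt}-\Delta\phi-a\,\phi_t)\,dx\,dt=\int_{\mathbb R^n}u_1\,\phi(0,x)\,dx-\int_{\mathbb R^n}u_0\,\phi_t(0,x)\,dx+\int_{\mathbb R^n}a\,u_0\,\phi(0,x)\,dx$$ for all $\phi\in C_0^\infty([0,\infty)\times\mathbb R^n)$. Then in the class $L^\infty(0,\infty;H^1(\mathbb R^n))\cap W^{1,\infty}(0,\infty;L^2(\mathbb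 R^n))$ there is exactly one weak solution $u$ (up to equality for almost every $t$). Taking for $u$ the representative that is continuous from $[0,\infty)$ to $L^2(\mathbb R^n)$, one has $$\|u(t,\cdot)\|_{L^2}^2\le C\,I_{00}^2\,(1+t)^{-1}\quad\text{for every }t\ge0,$$ $$E_u(t):=\tfrac12\bigl(\|u_t(t,\cdot)\|_{L^2}^2+\|\nabla u(t,\cdot)\|_{L^2}^2\bigr)\le C\,I_{00}^2\,(1+t)^{-2}\quad\text{for almost every }t>0,$$ where $$I_{00}:=\bigl(\|u_0\|_{L^2}^2+\|\nabla u_0\|_{L^2}^2+\|a u_0\|_{L^1}^2+\|a u_0\|_{L^2}^2+\|u_1\|_{L^2}^2+\|u_1\|_{L^1}^2\bigr)^{1/2}.$$ -/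

import Mathlib

open MeasureTheory Set
open scoped ContDiff ENNReal InnerProductSpace

noncomputable section

namespace DampedWave

/-- Euclidean space `ℝⁿ`. -/
abbrev Euc (n : ℕ) : Type := EuclideanSpace ℝ (Fin n)

/-- Real valued `L²(ℝⁿ)`. -/
abbrev L2 (n : ℕ) : Type := Lp ℝ 2 (volume : Measure (Euc n))

/-- `L²` vector fields on `ℝⁿ`; the norm is `(∫ |G|²)^{1/2}` with `|·|` the Euclidean length. -/
abbrev L2Vec (n : ℕ) : Type := Lp (Euc n) 2 (volume : Measure (Euc n))

/-- The classical partial derivative `∂φ/∂xᵢ`. -/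
def partialDeriv {n : ℕ} (i : Fin n) (φ : Euc n → ℝ) (x : Euc n) : ℝ :=
  fderiv ℝ φ x (EuclideanSpace.single i 1)

/-- `G` is the weak (distributional) gradient of `f` on `ℝⁿ`. -/
def IsWeakGradient {n : ℕ} (f : L2 n) (G : L2Vec n) : Prop :=
  ∀ φ : Euc n → ℝ, ContDiff ℝ ∞ φ → HasCompactSupport φ → ∀ i : Fin n,
    ∫ x, f x * partialDeriv i φ x = - ∫ x, (G x) i * φ x

theorem memLp_partialDeriv {n : ℕ} {φ : Euc n → ℝ} (h : ContDiff ℝ ∞ φ)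
    (hc : HasCompactSupport φ) (i : Fin n) : MemLp (partialDeriv i φ) 2 volume := by
  have h1 : Continuous (partialDeriv i φ) :=
    (h.continuous_fderiv (by simp)).clm_apply continuous_const
  exact h1.memLp_of_hasCompactSupport (hc.fderiv_apply (𝕜 := ℝ) _)

theorem memLp_component {n : ℕ} (G : L2Vec n) (i : Fin n) :
    MemLp (fun x => (G x) i) 2 volume :=
  (EuclideanSpace.proj (𝕜 := ℝ) i : Euc n →L[ℝ] ℝ).comp_memLp' (Lp.memLp G)

/-- The graph of the weak gradient: pairs of an `L²` function and its weak gradient in `L²`. -/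
def h1Graph (n : ℕ) : Submodule ℝ (WithLp 2 (L2 n × L2Vec n)) where
  carrier := {p | IsWeakGradient p.fst p.snd}
  zero_mem' := by
    intro φ _ _ i
    have e1 : ∫ x, (0 : L2 n) x * partialDeriv i φ x = 0 := by
      refine integral_eq_zero_of_ae ?_
      filter_upwards [Lp.coeFn_zero ℝ 2 (volume : Measure (Euc n))] with x hx
      rw [hx, Pi.zero_apply, zero_mul]
    have e2 : ∫ x, ((0 : L2Vec n) x) i * φ x = 0 := by
      refine integral_eq_zero_of_ae ?_
      filter_upwards [Lp.coeFn_zero (Euc n) 2 (volume : Measure (Euc n))] with x hx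
      rw [hx, Pi.zero_apply, PiLp.zero_apply, zero_mul]; rfl
    change ∫ x, (0 : L2 n) x * partialDeriv i φ x = - ∫ x, ((0 : L2Vec n) x) i * φ x
    rw [e1, e2, neg_zero]
  add_mem' := by
    intro p q hp hq φ h hc i
    have hφ : MemLp φ 2 (volume : Measure (Euc n)) :=
      h.continuous.memLp_of_hasCompactSupport hc
    have hd := memLp_partialDeriv h hc i
    have e1 : ∫ x, (p.fst + q.fst : L2 n) x * partialDeriv i φ x
        = (∫ x, p.fst x * partialDeriv i φ x) + ∫ x, q.fst x * partialDeriv i φ x := by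
      rw [← integral_add (f := fun x => p.fst x * partialDeriv i φ x)
        (g := fun x => q.fst x * partialDeriv i φ x)
        ((Lp.memLp p.fst).integrable_mul hd) ((Lp.memLp q.fst).integrable_mul hd)]
      refine integral_congr_ae ?_
      filter_upwards [Lp.coeFn_add p.fst q.fst] with x hx
      rw [hx, Pi.add_apply, add_mul]
    have e2 : ∫ x, ((p.snd + q.snd : L2Vec n) x) i * φ x
        = (∫ x, (p.snd x) i * φ x) + ∫ x, (q.snd x) i * φ x := by
      rw [← integral_add (f := fun x => (p.snd x) i * φ x) (g := fun x => (q.snd x) i * φ x)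
        ((memLp_component p.snd i).integrable_mul hφ) ((memLp_component q.snd i).integrable_mul hφ)]
      refine integral_congr_ae ?_
      filter_upwards [Lp.coeFn_add p.snd q.snd] with x hx
      rw [hx, Pi.add_apply, PiLp.add_apply, add_mul]
    change ∫ x, (p.fst + q.fst : L2 n) x * partialDeriv i φ x
      = - ∫ x, ((p.snd + q.snd : L2Vec n) x) i * φ x
    rw [e1, e2, hp φ h hc i, hq φ h hc i, neg_add]
  smul_mem' := by
    intro c p hp φ h hc i
    have e1 : ∫ x, (c • p.fst : L2 n) x * partialDeriv i φ x
        = c * ∫ x, p.fst x * partialDeriv i φ x := by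
      rw [← integral_const_mul]
      refine integral_congr_ae ?_
      filter_upwards [Lp.coeFn_smul c p.fst] with x hx
      rw [hx, Pi.smul_apply, smul_eq_mul, mul_assoc]
    have e2 : ∫ x, ((c • p.snd : L2Vec n) x) i * φ x = c * ∫ x, (p.snd x) i * φ x := by
      rw [← integral_const_mul]
      refine integral_congr_ae ?_
      filter_upwards [Lp.coeFn_smul c p.snd] with x hx
      rw [hx, Pi.smul_apply, PiLp.smul_apply, smul_eq_mul, mul_assoc]
    change ∫ x, (c • p.fst : L2 n) x * partialDeriv i φ x
      = - ∫ x, ((c • p.snd : L2Vec n) x) i * φ x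
    rw [e1, e2, hp φ h hc i, mul_neg]

/-- The Sobolev space `H¹(ℝⁿ)`: `L²` functions together with their (unique) weak gradient in `L²`.
The inherited norm is the `H¹` norm `(‖f‖² + ‖∇f‖²)^{1/2}`. -/
abbrev H1 (n : ℕ) : Type := h1Graph n

/-- The underlying `L²` function of an element of `H¹(ℝⁿ)`. -/
def H1.toL2 {n : ℕ} (f : H1 n) : L2 n := (f : WithLp 2 (L2 n × L2Vec n)).fst

/-- The weak gradient of an element of `H¹(ℝⁿ)`. -/
def H1.grad {n : ℕ} (f : H1 n) : L2Vec n := (f : WithLp 2 (L2 n × L2Vec n)).snd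

/-- `f ∈ H²(ℝⁿ)`: every weak partial derivative of `f` belongs to `H¹(ℝⁿ)`. -/
def IsH2 {n : ℕ} (f : H1 n) : Prop :=
  ∀ i : Fin n, ∃ g : H1 n, (g.toL2 : Euc n → ℝ) =ᵐ[volume] fun x => (f.grad x) i

/-- Lebesgue measure on the time interval `(0, ∞)`. -/
abbrev timeMeasure : Measure ℝ := (volume : Measure ℝ).restrict (Ioi 0)

/-- `v` is the weak time derivative on `(0, ∞)` of the `L²(ℝⁿ)`-valued function `u`. -/
def IsWeakTimeDeriv {n : ℕ} (u v : ℝ → L2 n) : Prop :=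
  ∀ η : ℝ → ℝ, ContDiff ℝ ∞ η → HasCompactSupport η → tsupport η ⊆ Ioi 0 →
    ∫ t in Ioi (0 : ℝ), deriv η t • u t = - ∫ t in Ioi (0 : ℝ), η t • v t

/-- `u ∈ L^∞(0,∞; H¹(ℝⁿ)) ∩ W^{1,∞}(0,∞; L²(ℝⁿ))`, with weak time derivative `ut`. -/
structure InSolutionClass {n : ℕ} (u : ℝ → H1 n) (ut : ℝ → L2 n) : Prop where
  memLp_H1 : MemLp u ∞ timeMeasure
  memLp_L2 : MemLp (fun t => (u t).toL2) ∞ timeMeasure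
  memLp_deriv : MemLp ut ∞ timeMeasure
  weakDeriv : IsWeakTimeDeriv (fun t => (u t).toL2) ut

/-- Weak solutions of `u_tt - Δu + a(x) u_t = 0` in `(0,∞) × ℝⁿ`, `u(0) = u₀`, `u_t(0) = u₁`.
The test functions, smooth with compact support in `[0,∞) × ℝⁿ`, are the restrictions
of smooth compactly supported functions on `ℝ × ℝⁿ`. -/
def IsWeakSolution {n : ℕ} (a u₀ u₁ : Euc n → ℝ) (u : ℝ → Euc n → ℝ) : Prop :=
  ∀ φ : ℝ → Euc n → ℝ,
    ContDiff ℝ ∞ (Function.uncurry φ) → HasCompactSupport (Function.uncurry φ) →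
    ∫ t in Ioi (0 : ℝ), ∫ x, u t x *
        (iteratedDeriv 2 (fun s => φ s x) t - Laplacian.laplacian (φ t) x
          - a x * deriv (fun s => φ s x) t)
      = (∫ x, u₁ x * φ 0 x) - (∫ x, u₀ x * deriv (fun s => φ s x) 0)
          + ∫ x, a x * u₀ x * φ 0 x

/-- `½ (‖u_t‖² + ‖∇u‖²)`, for `f = u(t,·)` and `ft = u_t(t,·)`. -/
def energy {n : ℕ} (f : H1 n) (ft : L2 n) : ℝ := (‖ft‖ ^ 2 + ‖f.grad‖ ^ 2) / 2

/-- `(‖u₀‖² + ‖∇u₀‖² + ‖a u₀‖₁² + ‖a u₀‖² + ‖u₁‖² + ‖u₁‖₁²)^{1/2}`. -/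
def dataNorm {n : ℕ} (a : Euc n → ℝ) (u₀ u₁ : H1 n) : ℝ :=
  Real.sqrt (‖u₀.toL2‖ ^ 2 + ‖u₀.grad‖ ^ 2
    + lpNorm (fun x => a x * u₀.toL2 x) 1 volume ^ 2
    + lpNorm (fun x => a x * u₀.toL2 x) 2 volume ^ 2
    + ‖u₁.toL2‖ ^ 2 + lpNorm u₁.toL2 1 volume ^ 2)

end DampedWave

end

noncomputable section

namespace DampedWave

open Filter Topology
open scoped Gradient Convolution NNReal

/-! ### Decay for the damped wave equation with bounded operators -/

section BoundedModel

variable {X Y : Type*} [NormedAddCommGroup X] [InnerProductSpace ℝ X] [CompleteSpace X]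
  [NormedAddCommGroup Y] [InnerProductSpace ℝ Y] [CompleteSpace Y]

/-! The decay comes from integrating the equation once in time. The primitive `v = ∫₀ᵗ u` solves
`v_tt - Δv + a v_t = f` with `f = u₁ + a u₀` and `v(0) = 0`. Its energy `½(‖u‖² + ‖∇v‖²) - ⟨f, v⟩`
has derivative `-⟨a u, u⟩`. For `n ≥ 3` the space `L¹ ∩ L²` lies in `L^{2n/(n+2)}`, which is dual to
the Sobolev space `L^{2n/(n-2)}`, so `|⟨f, v⟩| ≤ K ‖∇v‖` with `K` controlled by the data
(`exists_inner_le_norm_grad`). Hence this energy is at least `-K²/2`, and the time integral of `⟨a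
u, u⟩` is bounded by the data. Adding it to the ordinary energy with weight `(1+t)²` and to the
multiplier identity for `u` with weight `1+t` gives a nonincreasing function, from which both decay
rates are read off (`bounded_damped_wave_decay`). The damping enters the constants only through its
lower bound `V₀`; beyond that only `a u₀` matters.

Since `a` may be unbounded, the estimate is proved for bounded operators and applied to Galerkin
projections onto finite dimensional subspaces of `{f ∈ H¹ : a f ∈ L²}`; the projections keep both
`V₀` and `K`. Weak limits along one ultrafilter give, at every time, limits of `u`, `u_t`, `∇u` and
`v` (`exists_abstract_solution`). Differentiation is carried through the limit as quadratic Taylor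
bounds, and the equation in its integrated form `u_t - Δv + a u = f`. Testing this with `φ_t` and
integrating in time yields the weak formulation (`integral_inner_waveCurve`).

For uniqueness, the difference of two solutions is integrated three times in time. This gives a
curve `X` in `H¹` with `X'` and `X''` in `H¹` and `X'' - ΔX + a X' = 0` weakly
(`eq_zero_of_weak_second_order`). The energy identity for `X`, localized by a cutoff so that only
bounded values of `a` occur, has an error of order `1/N` (`eq_zero_of_integrated_equation`). Hence
`X' = 0`, and the difference vanishes almost everywhere by Lebesgue differentiation. -/

theorem exists_hasDerivAt_linear {Z : Type*} [NormedAddCommGroup Z] [NormedSpace ℝ Z]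
    [CompleteSpace Z] (A : Z →L[ℝ] Z) (z₀ : Z) :
    ∃ z : ℝ → Z, z 0 = z₀ ∧ ∀ t, HasDerivAt z (A (z t)) t := by
  refine ⟨fun t => NormedSpace.exp (t • A) z₀, by simp [NormedSpace.exp_zero], fun t => ?_⟩
  have h := hasDerivAt_exp_smul_const' (𝕂 := ℝ) A t
  have h2 := h.clm_apply (hasDerivAt_const t z₀)
  simpa using h2

/-- Solvability of `u'' + D†D u + B u' = 0` for bounded operators, with the primitive `v` of `u`. -/
theorem exists_bounded_damped_wave (D : X →L[ℝ] Y) (B : X →L[ℝ] X) (x₀ x₁ : X) :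
    ∃ v u p : ℝ → X, v 0 = 0 ∧ u 0 = x₀ ∧ p 0 = x₁ ∧ (∀ t, HasDerivAt v (u t) t) ∧
      (∀ t, HasDerivAt u (p t) t) ∧
      ∀ t, HasDerivAt p (-(D.adjoint (D (u t))) - B (p t)) t := by
  let fstL := ContinuousLinearMap.fst ℝ X (X × X)
  let sndL := (ContinuousLinearMap.fst ℝ X X).comp (ContinuousLinearMap.snd ℝ X (X × X))
  let trdL := (ContinuousLinearMap.snd ℝ X X).comp (ContinuousLinearMap.snd ℝ X (X × X))
  let A : X × X × X →L[ℝ] X × X × X :=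
    sndL.prod (trdL.prod (-((D.adjoint.comp D).comp sndL) - B.comp trdL))
  obtain ⟨z, hz0, hz⟩ := exists_hasDerivAt_linear A (0, x₀, x₁)
  refine ⟨fun t => fstL (z t), fun t => sndL (z t), fun t => trdL (z t), ?_, ?_, ?_, ?_, ?_, ?_⟩
  · simp [hz0, fstL]
  · simp [hz0, sndL]
  · simp [hz0, trdL]
  · intro t
    exact fstL.hasFDerivAt.comp_hasDerivAt t (hz t)
  · intro t
    exact sndL.hasFDerivAt.comp_hasDerivAt t (hz t)
  · intro t
    exact trdL.hasFDerivAt.comp_hasDerivAt t (hz t)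

/-- The constant in the decay estimates. -/
def decayConst (V₀ : ℝ) : ℝ := 10 * (1 + 1 / V₀) ^ 2 * (1 + 6 / V₀)

set_option maxHeartbeats 1000000 in
/-- Decay for `u'' + D†D u + B u' = 0` when `B u₀ + u₁` is controlled by `D`. -/
theorem bounded_damped_wave_decay {V₀ : ℝ} (hV₀ : 0 < V₀) (D : X →L[ℝ] Y) (B : X →L[ℝ] X)
    (hsymm : ∀ x y, ⟪B x, y⟫_ℝ = ⟪x, B y⟫_ℝ) (hpos : ∀ x, V₀ * ‖x‖ ^ 2 ≤ ⟪B x, x⟫_ℝ)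
    {v u p : ℝ → X} (hv0 : v 0 = 0)
    (hv : ∀ t, HasDerivAt v (u t) t) (hu : ∀ t, HasDerivAt u (p t) t)
    (hp : ∀ t, HasDerivAt p (-(D.adjoint (D (u t))) - B (p t)) t)
    {K : ℝ} (hK : ∀ w, ⟪p 0 + B (u 0), w⟫_ℝ ≤ K * ‖D w‖) {t : ℝ} (ht : 0 ≤ t) :
    (1 + t) ^ 2 * ((‖p t‖ ^ 2 + ‖D (u t)‖ ^ 2) / 2) + (1 + t) * (V₀ / 2 * ‖u t‖ ^ 2) ≤
      decayConst V₀ * (‖u 0‖ ^ 2 + ‖D (u 0)‖ ^ 2 + ⟪B (u 0), u 0⟫_ℝ + ‖p 0‖ ^ 2 + K ^ 2) := by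
  -- The equation integrated once in time; its right side `f` is what `K` controls.
  have hpol : ∀ s, p s + D.adjoint (D (v s)) + B (u s) = p 0 + B (u 0) := by
    have hd : ∀ s, HasDerivAt (fun s => p s + D.adjoint (D (v s)) + B (u s)) 0 s := by
      intro s
      have h1 := ((D.adjoint.comp D).hasFDerivAt.comp_hasDerivAt s (hv s))
      have h2 := (B.hasFDerivAt.comp_hasDerivAt s (hu s))
      have h3 := ((hp s).add h1).add h2
      refine HasDerivAt.congr_deriv h3 ?_
      simp only [ContinuousLinearMap.comp_apply]
      abel
    intro s
    have := is_const_of_deriv_eq_zero (fun s => (hd s).differentiableAt) (fun s => (hd s).deriv) s 0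
    simpa [hv0] using this
  set f := p 0 + B (u 0) with hf
  -- The weights are chosen for the derivative of `Φ`: `κ = μ/2` cancels `‖D u‖²` between the terms
  -- without a factor `1 + s`, `μ` absorbs `3 (1+s) ‖p‖²`, `σ` absorbs `(1+μ) ‖p‖²`, and `ν` absorbs
  -- `‖u‖² + ⟪B u, u⟫`. The size of `μ` also leaves room for the mixed term `⟪p, u⟫` in the lower
  -- bound of `Φ`.
  set μ : ℝ := 6 / V₀ with hμ
  set κ : ℝ := μ / 2 with hκ
  set σ : ℝ := (1 + μ) / V₀ with hσ
  set ν : ℝ := 1 + 1 / V₀ with hν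
  have hμ0 : 0 < μ := by positivity
  -- `e` is the energy, `q` comes from pairing the equation with `u`, and `E` is the energy of the
  -- integrated equation for `v`.
  let e : ℝ → ℝ := fun s => (⟪p s, p s⟫_ℝ + ⟪D (u s), D (u s)⟫_ℝ) / 2
  let q : ℝ → ℝ := fun s => ⟪p s, u s⟫_ℝ + ⟪B (u s), u s⟫_ℝ / 2
  let E : ℝ → ℝ := fun s => (⟪u s, u s⟫_ℝ + ⟪D (v s), D (v s)⟫_ℝ) / 2 - ⟪f, v s⟫_ℝ
  have hDu : ∀ s, HasDerivAt (fun s => D (u s)) (D (p s)) s := fun s =>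
    D.hasFDerivAt.comp_hasDerivAt s (hu s)
  have hDv : ∀ s, HasDerivAt (fun s => D (v s)) (D (u s)) s := fun s =>
    D.hasFDerivAt.comp_hasDerivAt s (hv s)
  have hBu : ∀ s, HasDerivAt (fun s => B (u s)) (B (p s)) s := fun s =>
    B.hasFDerivAt.comp_hasDerivAt s (hu s)
  have he : ∀ s, HasDerivAt e (-⟪B (p s), p s⟫_ℝ) s := by
    intro s
    have h := (((hp s).inner ℝ (hp s)).add ((hDu s).inner ℝ (hDu s))).div_const 2
    refine HasDerivAt.congr_deriv h ?_
    simp only [inner_sub_left, inner_sub_right, inner_neg_left, inner_neg_right,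
      ContinuousLinearMap.adjoint_inner_left, ContinuousLinearMap.adjoint_inner_right]
    rw [real_inner_comm (p s) (B (p s)), real_inner_comm (D (u s)) (D (p s))]
    ring
  have hq : ∀ s, HasDerivAt q (‖p s‖ ^ 2 - ‖D (u s)‖ ^ 2) s := by
    intro s
    have h := ((hp s).inner ℝ (hu s)).add (((hBu s).inner ℝ (hu s)).div_const 2)
    refine HasDerivAt.congr_deriv h ?_
    simp only [inner_sub_left, inner_neg_left, ContinuousLinearMap.adjoint_inner_left,
      real_inner_self_eq_norm_sq]
    rw [hsymm (u s), real_inner_comm (B (p s)) (u s)]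
    ring
  have hE : ∀ s, HasDerivAt E (-⟪B (u s), u s⟫_ℝ) s := by
    intro s
    have h := (((((hu s).inner ℝ (hu s)).add ((hDv s).inner ℝ (hDv s))).div_const 2).sub
      ((hasDerivAt_const s f).inner ℝ (hv s)))
    refine HasDerivAt.congr_deriv h ?_
    -- Pairing the integrated equation with `u = v'` leaves only the dissipation in the derivative
    -- of `E`.
    have h3 : ⟪f, u s⟫_ℝ = ⟪p s, u s⟫_ℝ + ⟪D (v s), D (u s)⟫_ℝ + ⟪B (u s), u s⟫_ℝ := by
      rw [← hpol s]
      simp only [inner_add_left, ContinuousLinearMap.adjoint_inner_left]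
    simp only [inner_zero_left, h3]
    rw [real_inner_comm (u s) (p s), real_inner_comm (D (u s)) (D (v s))]
    ring
  let Φ : ℝ → ℝ := fun s =>
    (1 + s) ^ 2 * e s + (2 * (1 + s) + κ) * q s + (μ * (1 + s) + σ) * e s + ν * E s
  have hΦ : ∀ s, HasDerivAt Φ (2 * (1 + s) * e s + (1 + s) ^ 2 * (-⟪B (p s), p s⟫_ℝ)
      + (2 * q s + (2 * (1 + s) + κ) * (‖p s‖ ^ 2 - ‖D (u s)‖ ^ 2))
      + (μ * e s + (μ * (1 + s) + σ) * (-⟪B (p s), p s⟫_ℝ))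
      + ν * (-⟪B (u s), u s⟫_ℝ)) s := by
    intro s
    have h1 : HasDerivAt (fun s : ℝ => 1 + s) 1 s := (hasDerivAt_id s).const_add 1
    have h2 := (((h1.pow 2).mul (he s)).add ((((h1.const_mul 2).add_const κ)).mul (hq s))).add
      (((h1.const_mul μ).add_const σ).mul (he s)) |>.add ((hE s).const_mul ν)
    refine HasDerivAt.congr_deriv h2 ?_
    simp
  have hVμ : V₀ * μ = 6 := by rw [hμ]; field_simp
  have hVσ : V₀ * σ = 1 + μ := by rw [hσ]; field_simp
  have hVν : V₀ * ν = V₀ + 1 := by rw [hν]; field_simp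
  have hσ0 : 0 < σ := by positivity
  have hν1 : 1 ≤ ν := by rw [hν]; have : 0 < 1 / V₀ := by positivity
                         linarith
  have hdecr : AntitoneOn Φ (Ici 0) := by
    refine antitoneOn_of_deriv_nonpos (convex_Ici 0)
      (fun s _ => (hΦ s).continuousAt.continuousWithinAt)
      (fun s _ => (hΦ s).differentiableAt.differentiableWithinAt) ?_
    intro s hs
    rw [interior_Ici, mem_Ioi] at hs
    rw [(hΦ s).deriv]
    simp only [e, q, real_inner_self_eq_norm_sq]
    have hc := hpos (p s)
    have hb := hpos (u s)
    have hpu : 2 * ⟪p s, u s⟫_ℝ ≤ ‖p s‖ ^ 2 + ‖u s‖ ^ 2 := by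
      have := real_inner_le_norm (p s) (u s)
      linarith [two_mul_le_add_sq ‖p s‖ ‖u s‖]
    set P := ‖p s‖ ^ 2
    set U := ‖u s‖ ^ 2
    set G := ‖D (u s)‖ ^ 2
    set c := ⟪B (p s), p s⟫_ℝ
    set b := ⟪B (u s), u s⟫_ℝ
    have hP : 0 ≤ P := by positivity
    have hU : 0 ≤ U := by positivity
    have hG : 0 ≤ G := by positivity
    have hc0 : 0 ≤ c := le_trans (by positivity) hc
    have hb0 : 0 ≤ b := le_trans (by positivity) hb
    have k1 : 6 * P ≤ μ * c := by
      have := mul_le_mul_of_nonneg_left hc hμ0.le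
      nlinarith
    have k2 : (1 + μ) * P ≤ σ * c := by
      have := mul_le_mul_of_nonneg_left hc hσ0.le
      nlinarith
    have k3 : U + b ≤ ν * b := by
      have : U ≤ 1 / V₀ * b := by
        rw [one_div, inv_mul_eq_div, le_div_iff₀ hV₀]; linarith
      rw [hν]; linarith
    have k4 : (1 + s) * (6 * P) ≤ (1 + s) * (μ * c) := mul_le_mul_of_nonneg_left k1 (by linarith)
    have k5 : 0 ≤ (1 + s) ^ 2 * c := by positivity
    have k6 : 0 ≤ (1 + s) * G := by positivity
    have k7 : 0 ≤ (1 + s) * P := by positivity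
    have k8 : κ * (P - G) = μ / 2 * (P - G) := by rw [hκ]
    linarith
  have hle := hdecr (mem_Ici.2 le_rfl) (mem_Ici.2 ht) ht
  have hlow : (1 + t) ^ 2 * ((‖p t‖ ^ 2 + ‖D (u t)‖ ^ 2) / 2) + (1 + t) * (V₀ / 2 * ‖u t‖ ^ 2)
      - ν * (K ^ 2 / 2) ≤ Φ t := by
    simp only [Φ, e, q, E, real_inner_self_eq_norm_sq]
    have hb := hpos (u t)
    have hpu : -⟪p t, u t⟫_ℝ ≤ ‖p t‖ * ‖u t‖ := by
      have := abs_real_inner_le_norm (p t) (u t)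
      exact (neg_le_abs _).trans this
    have hfv := hK (v t)
    -- The source is absorbed by `‖D v‖²/2`, so `E` is bounded below although `v` itself has no
    -- bound uniform in time.
    have h1 : ⟪f, v t⟫_ℝ ≤ K ^ 2 / 2 + ‖D (v t)‖ ^ 2 / 2 := by
      nlinarith [sq_nonneg (K - ‖D (v t)‖)]
    -- Young's inequality spending half of `⟪B u, u⟫/2 ≥ (V₀/2) ‖u‖²`; the other half survives in
    -- `q` and gives the decay of `u`.
    have h2 : ‖p t‖ * ‖u t‖ ≤ μ / 6 * ‖p t‖ ^ 2 + V₀ / 4 * ‖u t‖ ^ 2 := by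
      have h : μ / 6 = V₀⁻¹ := by rw [hμ]; field_simp
      rw [h]
      have h3 : V₀⁻¹ * ‖p t‖ ^ 2 + V₀ / 4 * ‖u t‖ ^ 2 - ‖p t‖ * ‖u t‖
          = V₀⁻¹ * (‖p t‖ - V₀ / 2 * ‖u t‖) ^ 2 := by field_simp; ring
      have : 0 ≤ V₀⁻¹ * (‖p t‖ - V₀ / 2 * ‖u t‖) ^ 2 := by positivity
      linarith
    have hq1 : V₀ / 4 * ‖u t‖ ^ 2 - μ / 6 * ‖p t‖ ^ 2 ≤
        ⟪p t, u t⟫_ℝ + ⟪B (u t), u t⟫_ℝ / 2 := by linarith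
    have hc1 : 0 ≤ 2 * (1 + t) + κ := by positivity
    have hq2 := mul_le_mul_of_nonneg_left hq1 hc1
    have hσκ : κ * (μ / 6) ≤ σ / 2 := by
      have : κ * (μ / 6) = μ / V₀ / 2 := by rw [hκ, hμ]; field_simp
      rw [this, hσ]
      gcongr
      linarith
    have hσκ' := mul_le_mul_of_nonneg_right hσκ (sq_nonneg ‖p t‖)
    have hνE : ν * ((‖u t‖ ^ 2 + ‖D (v t)‖ ^ 2) / 2 - ⟪f, v t⟫_ℝ) ≥ - (ν * (K ^ 2 / 2)) := by
      have : -(K ^ 2 / 2) ≤ (‖u t‖ ^ 2 + ‖D (v t)‖ ^ 2) / 2 - ⟪f, v t⟫_ℝ := by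
        nlinarith [sq_nonneg ‖u t‖]
      have := mul_le_mul_of_nonneg_left this (by linarith : 0 ≤ ν)
      linarith
    have hκu : 0 ≤ κ * (V₀ / 4 * ‖u t‖ ^ 2) := by positivity
    have hGd : 0 ≤ (μ * (1 + t) + σ) * ‖D (u t)‖ ^ 2 := by positivity
    have htp : 0 ≤ μ * (1 + t) * ‖p t‖ ^ 2 := by positivity
    linarith
  have hup : Φ 0 + ν * (K ^ 2 / 2) ≤
      decayConst V₀ * (‖u 0‖ ^ 2 + ‖D (u 0)‖ ^ 2 + ⟪B (u 0), u 0⟫_ℝ + ‖p 0‖ ^ 2 + K ^ 2) := by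
    simp only [Φ, e, q, E, real_inner_self_eq_norm_sq, hv0, map_zero, norm_zero, inner_zero_right]
    have hb0 : 0 ≤ ⟪B (u 0), u 0⟫_ℝ := le_trans (by positivity) (hpos (u 0))
    have hpu : ⟪p 0, u 0⟫_ℝ ≤ ‖p 0‖ ^ 2 / 2 + ‖u 0‖ ^ 2 / 2 := by
      have := real_inner_le_norm (p 0) (u 0)
      nlinarith [sq_nonneg (‖p 0‖ - ‖u 0‖)]
    have hM : decayConst V₀ = 10 * ν ^ 2 * (1 + μ) := rfl
    have hσν : σ ≤ ν * (1 + μ) := by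
      have : σ = (1 / V₀) * (1 + μ) := by rw [hσ]; ring
      rw [this]; gcongr; rw [hν]; linarith
    have hkey : (1 + μ) * ν ≤ (1 + μ) * ν ^ 2 := by
      gcongr; nlinarith
    have hkey1 : 1 + μ ≤ (1 + μ) * ν := le_mul_of_one_le_right (by linarith) hν1
    have hkey2 : ν ≤ (1 + μ) * ν := le_mul_of_one_le_left (by linarith) (by linarith)
    rw [hM]
    set T := (1 + μ) * ν ^ 2 with hT
    have hT' : 10 * ν ^ 2 * (1 + μ) = 10 * T := by rw [hT]; ring
    rw [hT']
    have hpu' := mul_le_mul_of_nonneg_left hpu (by positivity : (0:ℝ) ≤ 2 * (1 + 0) + κ)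
    have a1 : (2 + κ) ≤ 2 * T := by rw [hκ]; linarith
    have a2 : 1 + μ + σ ≤ 2 * T := by linarith
    have a3 : ν ≤ T := by linarith
    have c1 := mul_le_mul_of_nonneg_right a1 (by positivity : 0 ≤ ‖p 0‖ ^ 2 / 2 + ‖u 0‖ ^ 2 / 2 + ⟪B (u 0), u 0⟫_ℝ / 2)
    have c2 := mul_le_mul_of_nonneg_right a2 (by positivity : 0 ≤ ‖p 0‖ ^ 2 / 2 + ‖D (u 0)‖ ^ 2 / 2)
    have c3 := mul_le_mul_of_nonneg_right a3 (by positivity : 0 ≤ ‖u 0‖ ^ 2 / 2 + K ^ 2 / 2)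
    have hT0 : 0 ≤ T := by linarith
    have d1 : 0 ≤ T * ‖p 0‖ ^ 2 := by positivity
    have d2 : 0 ≤ T * ‖u 0‖ ^ 2 := by positivity
    have d3 : 0 ≤ T * ‖D (u 0)‖ ^ 2 := by positivity
    have d4 : 0 ≤ T * ⟪B (u 0), u 0⟫_ℝ := by positivity
    have d5 : 0 ≤ T * K ^ 2 := by positivity
    linarith
  linarith

end BoundedModel

/-! ### Weak compactness and Taylor bounds in time -/

section WeakLimits

variable {H : Type*} [NormedAddCommGroup H] [InnerProductSpace ℝ H]

/-- Testing against the limit itself gives `‖y‖² ≤ C ‖y‖`. -/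
theorem norm_le_of_weak_tendsto {ι : Type*} {l : Filter ι} [l.NeBot] {x : ι → H} {y : H} {C : ℝ}
    (hx : ∀ h, Tendsto (fun s => ⟪x s, h⟫_ℝ) l (𝓝 ⟪y, h⟫_ℝ)) (hC : ∀ᶠ s in l, ‖x s‖ ≤ C) :
    ‖y‖ ≤ C := by
  have h1 : ⟪y, y⟫_ℝ ≤ C * ‖y‖ := by
    refine le_of_tendsto (hx y) ?_
    filter_upwards [hC] with s hs
    exact (real_inner_le_norm _ _).trans (mul_le_mul_of_nonneg_right hs (norm_nonneg _))
  rw [real_inner_self_eq_norm_sq] at h1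
  obtain ⟨s, hs⟩ := hC.exists
  have hC0 : 0 ≤ C := (norm_nonneg _).trans hs
  by_contra! hlt
  nlinarith

/-- Banach–Alaoglu through the Riesz isomorphism. With an ultrafilter in place of subsequences, one
choice of `U` serves all times at once. -/
theorem exists_weak_limit [CompleteSpace H] {ι : Type*} (U : Ultrafilter ι) {x : ι → H} {C : ℝ}
    (hC : ∀ᶠ s in (U : Filter ι), ‖x s‖ ≤ C) :
    ∃ y : H, ∀ h, Tendsto (fun s => ⟪x s, h⟫_ℝ) U (𝓝 ⟪y, h⟫_ℝ) := by
  let Λ : ι → WeakDual ℝ H := fun s =>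
    StrongDual.toWeakDual (InnerProductSpace.toDual ℝ H (x s))
  have hcomp := WeakDual.isCompact_closedBall (𝕜 := ℝ) (E := H) 0 C
  have hmem : ∀ᶠ s in (U : Filter ι), Λ s ∈
      (WeakDual.toStrongDual ⁻¹' Metric.closedBall (0 : StrongDual ℝ H) C) := by
    filter_upwards [hC] with s hs
    simpa [Λ] using hs
  obtain ⟨y, -, hy⟩ := hcomp.ultrafilter_le_nhds' (U.map Λ) hmem
  refine ⟨(InnerProductSpace.toDual ℝ H).symm (WeakDual.toStrongDual y), fun h => ?_⟩
  have h1 : Tendsto Λ U (𝓝 y) := hy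
  have h2 := ((WeakDual.eval_continuous h).tendsto y).comp h1
  rw [InnerProductSpace.toDual_symm_apply]
  exact h2

end WeakLimits

/-- The mean value inequality for `r ↦ f r - r • g t`, whose derivative is at most `C |s - t|`
between `t` and `s`. A norm bound of this kind survives weak limits, which the statement that `g` is
the derivative of `f` would not. -/
theorem norm_image_sub_sub_smul_le {F : Type*} [NormedAddCommGroup F] [NormedSpace ℝ F]
    {f g : ℝ → F} {C : ℝ} (hf : ∀ t, HasDerivAt f (g t) t)
    (hg : ∀ s, 0 ≤ s → ∀ t, 0 ≤ t → ‖g s - g t‖ ≤ C * |s - t|) {s t : ℝ} (hs : 0 ≤ s)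
    (ht : 0 ≤ t) : ‖f s - f t - (s - t) • g t‖ ≤ C * |s - t| ^ 2 := by
  have hC : 0 ≤ C := by
    have := hg 1 zero_le_one 0 le_rfl
    simp at this
    exact (norm_nonneg _).trans this
  have hd : ∀ r ∈ uIcc t s, HasDerivWithinAt (fun r => f r - r • g t) (g r - g t) (uIcc t s) r := by
    intro r _
    have h := (hf r).sub ((hasDerivAt_id r).smul_const (g t))
    rw [one_smul] at h
    exact h.hasDerivWithinAt
  have hb : ∀ r ∈ uIcc t s, ‖g r - g t‖ ≤ C * |s - t| := by
    intro r hr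
    have h0 : 0 ≤ r := (le_min ht hs).trans hr.1
    exact (hg r h0 t ht).trans (mul_le_mul_of_nonneg_left (abs_sub_left_of_mem_uIcc hr) hC)
  have := Convex.norm_image_sub_le_of_norm_hasDerivWithin_le hd hb (convex_uIcc t s)
    left_mem_uIcc right_mem_uIcc
  rw [Real.norm_eq_abs] at this
  calc ‖f s - f t - (s - t) • g t‖ = ‖f s - s • g t - (f t - t • g t)‖ := by
        congr 1; rw [sub_smul]; abel
    _ ≤ C * |s - t| * |s - t| := this
    _ = _ := by ring

theorem norm_image_sub_le_of_hasDerivAt {F : Type*} [NormedAddCommGroup F] [NormedSpace ℝ F]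
    {f g : ℝ → F} {C : ℝ} (hf : ∀ t, HasDerivAt f (g t) t)
    (hg : ∀ s, 0 ≤ s → ‖g s‖ ≤ C) {s t : ℝ} (hs : 0 ≤ s)
    (ht : 0 ≤ t) : ‖f s - f t‖ ≤ C * |s - t| :=
  Convex.norm_image_sub_le_of_norm_hasDerivWithin_le (fun r _ => (hf r).hasDerivWithinAt)
    (fun r hr => hg r hr) (convex_Ici 0) ht hs

/-! ### Galerkin approximation and its weak limit -/

section Galerkin

variable {H H' : Type*} [NormedAddCommGroup H] [InnerProductSpace ℝ H] [CompleteSpace H]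
  [NormedAddCommGroup H'] [InnerProductSpace ℝ H'] [CompleteSpace H']

/-- Solution of the damped wave equation projected to an isometrically embedded space `X`. -/
theorem exists_projected_solution {X : Type*} [NormedAddCommGroup X] [InnerProductSpace ℝ X]
    [CompleteSpace X] (j M : X →L[ℝ] H) (D : X →L[ℝ] H') (hj : ∀ x, ‖j x‖ = ‖x‖) {V₀ : ℝ}
    (hV₀ : 0 < V₀) (hsymm : ∀ x y, ⟪M x, j y⟫_ℝ = ⟪j x, M y⟫_ℝ)
    (hpos : ∀ x, V₀ * ‖x‖ ^ 2 ≤ ⟪M x, j x⟫_ℝ) (x₀ : X) (x₁ : H) {K : ℝ}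
    (hK : ∀ w, ⟪x₁ + M x₀, j w⟫_ℝ ≤ K * ‖D w‖) :
    ∃ v u p : ℝ → X, v 0 = 0 ∧ u 0 = x₀ ∧
      (∀ t, HasDerivAt (fun t => j (v t)) (j (u t)) t) ∧
      (∀ t, HasDerivAt (fun t => j (u t)) (j (p t)) t) ∧
      (∀ w t, ⟪j (p t), j w⟫_ℝ + ⟪D (v t), D w⟫_ℝ + ⟪j (u t), M w⟫_ℝ = ⟪x₁ + M x₀, j w⟫_ℝ) ∧
      (∀ w t, HasDerivAt (fun t => ⟪j (p t), j w⟫_ℝ)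
        (-⟪D (u t), D w⟫_ℝ - ⟪j (p t), M w⟫_ℝ) t) ∧
      ∀ t, 0 ≤ t →
        (1 + t) ^ 2 * ((‖p t‖ ^ 2 + ‖D (u t)‖ ^ 2) / 2) + (1 + t) * (V₀ / 2 * ‖u t‖ ^ 2) ≤
          decayConst V₀ * (‖x₀‖ ^ 2 + ‖D x₀‖ ^ 2 + ⟪M x₀, j x₀⟫_ℝ + ‖x₁‖ ^ 2 + K ^ 2) := by
  -- The compression keeps symmetry and the lower bound `V₀`. The projection of `x₁ + M x₀` pairs
  -- with `w` as the original vector does with `j w`, so `K` is unchanged as well.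
  let B : X →L[ℝ] X := j.adjoint.comp M
  have hj' : ∀ x y : X, ⟪j x, j y⟫_ℝ = ⟪x, y⟫_ℝ :=
    fun x y => LinearIsometry.inner_map_map (⟨j.toLinearMap, hj⟩ : X →ₗᵢ[ℝ] H) x y
  have hjadj : ∀ (h : H) (y : X), ⟪j.adjoint h, y⟫_ℝ = ⟪h, j y⟫_ℝ := fun h y =>
    ContinuousLinearMap.adjoint_inner_left j y h
  have hB : ∀ x y : X, ⟪B x, y⟫_ℝ = ⟪M x, j y⟫_ℝ := fun x y => hjadj (M x) y
  obtain ⟨v, u, p, hv0, hu0, hp0, hv, hu, hp⟩ :=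
    exists_bounded_damped_wave D B x₀ (j.adjoint x₁)
  have hpW : ∀ w t, HasDerivAt (fun t => ⟪p t, w⟫_ℝ)
        (-⟪D (u t), D w⟫_ℝ - ⟪j (p t), M w⟫_ℝ) t := by
    intro w t
    refine HasDerivAt.congr_deriv ((hp t).inner ℝ (hasDerivAt_const t w)) ?_
    rw [inner_zero_right, zero_add, inner_sub_left, inner_neg_left,
      ContinuousLinearMap.adjoint_inner_left, hB, hsymm]
  refine ⟨v, u, p, hv0, hu0, fun t => j.hasFDerivAt.comp_hasDerivAt t (hv t),
    fun t => j.hasFDerivAt.comp_hasDerivAt t (hu t), ?_, ?_, ?_⟩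
  · intro w
    have hd : ∀ t, HasDerivAt (fun t => ⟪p t, w⟫_ℝ + ⟪D (v t), D w⟫_ℝ + ⟪j (u t), M w⟫_ℝ) 0 t := by
      intro t
      have h1 := (D.hasFDerivAt.comp_hasDerivAt t (hv t)).inner ℝ (hasDerivAt_const t (D w))
      have h2 := (j.hasFDerivAt.comp_hasDerivAt t (hu t)).inner ℝ (hasDerivAt_const t (M w))
      refine HasDerivAt.congr_deriv (((hpW w t).add h1).add h2) ?_
      simp only [inner_zero_right, zero_add]
      ring
    intro t
    have := is_const_of_deriv_eq_zero (fun s => (hd s).differentiableAt) (fun s => (hd s).deriv) t 0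
    rw [hj']
    refine this.trans ?_
    rw [hv0, hp0, hu0, hjadj, map_zero, inner_zero_left, add_zero, inner_add_left, hsymm]
  · intro w t
    simpa only [hj'] using hpW w t
  · intro t ht
    have h := bounded_damped_wave_decay hV₀ D B
      (fun x y => by rw [hB, real_inner_comm (B y) x, hB, hsymm, real_inner_comm])
      (fun x => by rw [hB]; exact hpos x) hv0 hv hu hp (K := K) (fun w => by
        rw [hp0, hu0, inner_add_left, hB, hjadj, ← inner_add_left]
        exact hK w) ht
    refine h.trans ?_
    have hc : 0 ≤ decayConst V₀ := by unfold decayConst; positivity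
    rw [hp0, hu0, hB]
    have h1 : ‖j.adjoint x₁‖ ≤ ‖x₁‖ := by
      have h2 : ‖j.adjoint x₁‖ ^ 2 ≤ ‖x₁‖ * ‖j.adjoint x₁‖ := by
        rw [← real_inner_self_eq_norm_sq, hjadj, ← hj (j.adjoint x₁)]
        exact real_inner_le_norm _ _
      by_contra! hlt
      nlinarith [norm_nonneg x₁]
    gcongr

/-- Solution of the damped wave equation projected to a finite dimensional space `V`. -/
theorem exists_galerkin_solution {W : Submodule ℝ H} (D : W →ₗ[ℝ] H') (M : W →ₗ[ℝ] H) {V₀ : ℝ}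
    (hV₀ : 0 < V₀) (hsymm : ∀ x y : W, ⟪M x, (y : H)⟫_ℝ = ⟪(x : H), M y⟫_ℝ)
    (hpos : ∀ x : W, V₀ * ‖x‖ ^ 2 ≤ ⟪M x, (x : H)⟫_ℝ) (x₀ : W) (x₁ : H) {K : ℝ}
    (hK : ∀ w : W, ⟪x₁ + M x₀, (w : H)⟫_ℝ ≤ K * ‖D w‖)
    (V : Submodule ℝ W) [FiniteDimensional ℝ V] (hx₀ : x₀ ∈ V) :
    ∃ v u p : ℝ → W, v 0 = 0 ∧ u 0 = x₀ ∧
      (∀ t, HasDerivAt (fun t => (v t : H)) (u t) t) ∧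
      (∀ t, HasDerivAt (fun t => (u t : H)) (p t) t) ∧
      (∀ w ∈ V, ∀ t,
        ⟪(p t : H), (w : H)⟫_ℝ + ⟪D (v t), D w⟫_ℝ + ⟪(u t : H), M w⟫_ℝ
          = ⟪x₁ + M x₀, (w : H)⟫_ℝ) ∧
      (∀ w ∈ V, ∀ t, HasDerivAt (fun t => ⟪(p t : H), (w : H)⟫_ℝ)
        (-⟪D (u t), D w⟫_ℝ - ⟪(p t : H), M w⟫_ℝ) t) ∧
      ∀ t, 0 ≤ t →
        (1 + t) ^ 2 * ((‖p t‖ ^ 2 + ‖D (u t)‖ ^ 2) / 2) + (1 + t) * (V₀ / 2 * ‖u t‖ ^ 2) ≤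
          decayConst V₀ * (‖x₀‖ ^ 2 + ‖D x₀‖ ^ 2 + ⟪M x₀, (x₀ : H)⟫_ℝ + ‖x₁‖ ^ 2 + K ^ 2) := by
  have : CompleteSpace V := FiniteDimensional.complete ℝ V
  let j : V →L[ℝ] H := W.subtypeL.comp V.subtypeL
  -- `D` and `M` may be unbounded on `W`; on a finite dimensional subspace they are continuous.
  let DV : V →L[ℝ] H' := LinearMap.toContinuousLinearMap (D.comp V.subtype)
  let MV : V →L[ℝ] H := LinearMap.toContinuousLinearMap (M.comp V.subtype)
  obtain ⟨v, u, p, hv0, hu0, hv, hu, heq, hp, hb⟩ := exists_projected_solution (X := V)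
    j MV DV (fun x => rfl) hV₀
    (fun x y => hsymm x y) (fun x => hpos x) (⟨x₀, hx₀⟩ : V) x₁ (fun w => hK w)
  exact ⟨fun t => v t, fun t => u t, fun t => p t, by simp [hv0], by simp [hu0], hv, hu,
    fun w hw => heq ⟨w, hw⟩, fun w hw => hp ⟨w, hw⟩, hb⟩

/-- Weak solutions of the abstract damped wave equation, with a possibly unbounded damping `M`. -/
theorem exists_abstract_solution {W : Submodule ℝ H} (D : W →ₗ[ℝ] H') (M : W →ₗ[ℝ] H) {V₀ : ℝ}
    (hV₀ : 0 < V₀) (hsymm : ∀ x y : W, ⟪M x, (y : H)⟫_ℝ = ⟪(x : H), M y⟫_ℝ)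
    (hpos : ∀ x : W, V₀ * ‖x‖ ^ 2 ≤ ⟪M x, (x : H)⟫_ℝ) (x₀ : W) (x₁ : H) {K : ℝ}
    (hK : ∀ w : W, ⟪x₁ + M x₀, (w : H)⟫_ℝ ≤ K * ‖D w‖) {R : ℝ}
    (hR : decayConst V₀ * (‖x₀‖ ^ 2 + ‖D x₀‖ ^ 2 + ⟪M x₀, (x₀ : H)⟫_ℝ + ‖x₁‖ ^ 2 + K ^ 2) ≤ R) :
    ∃ (v u p : ℝ → H) (g : ℝ → H') (C : ℝ), v 0 = 0 ∧ u 0 = x₀ ∧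
      (∀ t, 0 ≤ t → ‖u t‖ ^ 2 ≤ 2 / V₀ * R * (1 + t)⁻¹ ∧
        ‖p t‖ ^ 2 ≤ 2 * R * ((1 + t) ^ 2)⁻¹ ∧ ‖g t‖ ^ 2 ≤ 2 * R * ((1 + t) ^ 2)⁻¹) ∧
      (∀ s, 0 ≤ s → ∀ t, 0 ≤ t → ‖u s - u t‖ ≤ C * |s - t|) ∧
      (∀ s, 0 ≤ s → ∀ t, 0 ≤ t → ‖v s - v t - (s - t) • u t‖ ≤ C * |s - t| ^ 2) ∧
      (∀ w : W, ∃ C' : ℝ, ∀ s, 0 ≤ s → ∀ t, 0 ≤ t →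
        ‖⟪u s - u t - (s - t) • p t, (w : H)⟫_ℝ‖ ≤ C' * |s - t| ^ 2) ∧
      (∀ (ξ : H') (η : H), (∀ w : W, ⟪D w, ξ⟫_ℝ = ⟪(w : H), η⟫_ℝ) →
        ∀ t, 0 ≤ t → ⟪g t, ξ⟫_ℝ = ⟪u t, η⟫_ℝ) ∧
      (∀ (w : W) (η : H), (∀ x : W, ⟪D x, D w⟫_ℝ = ⟪(x : H), η⟫_ℝ) →
        ∀ t, 0 ≤ t → ⟪p t, (w : H)⟫_ℝ + ⟪v t, η⟫_ℝ + ⟪u t, M w⟫_ℝ = ⟪x₁ + M x₀, (w : H)⟫_ℝ) := by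
  classical
  -- The approximations are indexed by finite sets ordered by inclusion, so no basis is needed.
  -- Including `x₀` makes the initial value exact.
  let V : Finset W → Submodule ℝ W := fun s => Submodule.span ℝ ↑(insert x₀ s)
  have hfin : ∀ s, FiniteDimensional ℝ (V s) := fun s =>
    FiniteDimensional.span_finset ℝ (insert x₀ s)
  have hV0 : ∀ s, x₀ ∈ V s := fun s => Submodule.subset_span (by simp)
  choose v u p hv0 hu0 hv hu heq hp hbound using fun s =>
    exists_galerkin_solution D M hV₀ hsymm hpos x₀ x₁ hK (V s) (hV0 s)
  replace hbound := fun s t ht => (hbound s t ht).trans hR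
  have hR0 : 0 ≤ R := by
    refine le_trans ?_ (hbound ∅ 0 le_rfl)
    positivity
  have hub : ∀ s t, 0 ≤ t → ‖u s t‖ ^ 2 ≤ 2 / V₀ * R * (1 + t)⁻¹ := by
    intro s t ht
    have h1 : (1 + t) * (V₀ / 2 * ‖u s t‖ ^ 2) ≤ R :=
      le_trans (le_add_of_nonneg_left (by positivity)) (hbound s t ht)
    have h2 : 2 / V₀ * ((1 + t) * (V₀ / 2 * ‖u s t‖ ^ 2)) * (1 + t)⁻¹ ≤ 2 / V₀ * R * (1 + t)⁻¹ := by
      gcongr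
    refine le_trans (le_of_eq ?_) h2
    have : 1 + t ≠ 0 := by positivity
    field_simp
  have hpgb : ∀ s t, 0 ≤ t → ‖p s t‖ ^ 2 + ‖D (u s t)‖ ^ 2 ≤ 2 * R * ((1 + t) ^ 2)⁻¹ := by
    intro s t ht
    have h1 : (1 + t) ^ 2 * ((‖p s t‖ ^ 2 + ‖D (u s t)‖ ^ 2) / 2) ≤ R :=
      le_trans (le_add_of_nonneg_right (by positivity)) (hbound s t ht)
    rw [← div_eq_mul_inv, le_div_iff₀ (by positivity)]
    linarith
  have hpb : ∀ s t, 0 ≤ t → ‖p s t‖ ^ 2 ≤ 2 * R * ((1 + t) ^ 2)⁻¹ := fun s t ht =>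
    le_trans (le_add_of_nonneg_right (by positivity)) (hpgb s t ht)
  have hgb : ∀ s t, 0 ≤ t → ‖D (u s t)‖ ^ 2 ≤ 2 * R * ((1 + t) ^ 2)⁻¹ := fun s t ht =>
    le_trans (le_add_of_nonneg_left (by positivity)) (hpgb s t ht)
  set C : ℝ := Real.sqrt (2 / V₀ * R) + Real.sqrt (2 * R) with hC
  have hC0 : 0 ≤ C := by positivity
  have huC : ∀ s t, 0 ≤ t → ‖(u s t : H)‖ ≤ C := by
    intro s t ht
    have h1 : ‖u s t‖ ^ 2 ≤ 2 / V₀ * R := (hub s t ht).trans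
      (mul_le_of_le_one_right (by positivity) (inv_le_one_of_one_le₀ (by linarith)))
    exact (Real.le_sqrt_of_sq_le h1).trans (le_add_of_nonneg_right (by positivity))
  have hinv : ∀ t : ℝ, 0 ≤ t → ((1 + t) ^ 2)⁻¹ ≤ 1 := fun t ht =>
    inv_le_one_of_one_le₀ (one_le_pow₀ (by linarith))
  have hpC : ∀ s t, 0 ≤ t → ‖(p s t : H)‖ ≤ C := by
    intro s t ht
    have h1 : ‖p s t‖ ^ 2 ≤ 2 * R := (hpb s t ht).trans
      (mul_le_of_le_one_right (by positivity) (hinv t ht))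
    exact (Real.le_sqrt_of_sq_le h1).trans (le_add_of_nonneg_left (by positivity))
  have hgC : ∀ s t, 0 ≤ t → ‖D (u s t)‖ ≤ C := by
    intro s t ht
    have h1 : ‖D (u s t)‖ ^ 2 ≤ 2 * R := (hgb s t ht).trans
      (mul_le_of_le_one_right (by positivity) (hinv t ht))
    exact (Real.le_sqrt_of_sq_le h1).trans (le_add_of_nonneg_left (by positivity))
  have huLip : ∀ r s, 0 ≤ s → ∀ t, 0 ≤ t → ‖(u r s : H) - u r t‖ ≤ C * |s - t| :=
    fun r s hs t ht => norm_image_sub_le_of_hasDerivAt (hu r) (hpC r) hs ht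
  have hvT : ∀ r s, 0 ≤ s → ∀ t, 0 ≤ t →
      ‖(v r s : H) - v r t - (s - t) • (u r t : H)‖ ≤ C * |s - t| ^ 2 :=
    fun r s hs t ht => norm_image_sub_sub_smul_le (hv r) (huLip r) hs ht
  have hvC : ∀ s t, 0 ≤ t → ‖(v s t : H)‖ ≤ C * |t| := by
    intro s t ht
    have := norm_image_sub_le_of_hasDerivAt (hv s) (huC s) ht le_rfl
    simpa [hv0] using this
  -- The derivative of `p` has no uniform norm bound, since `M` is unbounded. Tested with a fixed `w
  -- ∈ V r`, both operators move onto `w` and the bound becomes independent of `r`.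
  have huT : ∀ (w : W) r, w ∈ V r → ∀ s, 0 ≤ s → ∀ t, 0 ≤ t →
      ‖⟪(u r s : H) - u r t - (s - t) • (p r t : H), (w : H)⟫_ℝ‖
        ≤ (C * ‖D w‖ + C * ‖M w‖) * |s - t| ^ 2 := by
    intro w r hw s hs t ht
    have hd : ∀ t, HasDerivAt (fun t => ⟪(u r t : H), (w : H)⟫_ℝ) ⟪(p r t : H), (w : H)⟫_ℝ t := by
      intro t
      have := (hu r t).inner ℝ (hasDerivAt_const t (w : H))
      simpa using this
    have := norm_image_sub_sub_smul_le hd (C := C * ‖D w‖ + C * ‖M w‖) (fun s hs t ht =>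
      norm_image_sub_le_of_hasDerivAt (hp r w hw) (fun s hs => by
        refine (norm_sub_le _ _).trans ?_
        rw [norm_neg]
        gcongr
        · exact (norm_inner_le_norm _ _).trans (by gcongr; exact hgC r s hs)
        · exact (norm_inner_le_norm _ _).trans (by gcongr; exact hpC r s hs)) hs ht) hs ht
    simpa only [inner_sub_left, real_inner_smul_left, smul_eq_mul] using this
  -- Being finer than `atTop`, this ultrafilter eventually puts every fixed `w` into the Galerkin
  -- spaces.
  let U : Ultrafilter (Finset W) := Ultrafilter.of atTop
  have hUV : ∀ w : W, ∀ᶠ s in (U : Filter (Finset W)), w ∈ V s := by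
    intro w
    have h1 : ∀ᶠ s in (atTop : Filter (Finset W)), w ∈ V s := by
      filter_upwards [eventually_ge_atTop {w}] with s hs
      refine Submodule.subset_span ?_
      have : w ∈ s := hs (by simp)
      simp [this]
    exact Ultrafilter.of_le atTop h1
  have lim : ∀ (x : Finset W → ℝ → H) (c : ℝ → ℝ), (∀ s t, 0 ≤ t → ‖x s t‖ ≤ c t) →
      ∃ y : ℝ → H, ∀ t, 0 ≤ t → ∀ h, Tendsto (fun s => ⟪x s t, h⟫_ℝ) U (𝓝 ⟪y t, h⟫_ℝ) := by
    intro x c hx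
    have : ∀ t, ∃ y : H, 0 ≤ t → ∀ h, Tendsto (fun s => ⟪x s t, h⟫_ℝ) U (𝓝 ⟪y, h⟫_ℝ) := by
      intro t
      by_cases ht : 0 ≤ t
      · obtain ⟨y, hy⟩ := exists_weak_limit U (x := fun s => x s t)
          (Eventually.of_forall fun s => hx s t ht)
        exact ⟨y, fun _ => hy⟩
      · exact ⟨0, fun h => absurd h ht⟩
    choose y hy using this
    exact ⟨y, hy⟩
  obtain ⟨v', hv'⟩ := lim (fun s t => (v s t : H)) _ hvC
  obtain ⟨u', hu'⟩ := lim (fun s t => (u s t : H)) _ huC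
  obtain ⟨p', hp'⟩ := lim (fun s t => (p s t : H)) _ hpC
  have limg : ∀ t, ∃ y : H', 0 ≤ t → ∀ h, Tendsto (fun s => ⟪D (u s t), h⟫_ℝ) U (𝓝 ⟪y, h⟫_ℝ) := by
    intro t
    by_cases ht : 0 ≤ t
    · obtain ⟨y, hy⟩ := exists_weak_limit U (x := fun s => D (u s t))
        (Eventually.of_forall fun s => hgC s t ht)
      exact ⟨y, fun _ => hy⟩
    · exact ⟨0, fun h => absurd h ht⟩
  choose g' hg' using limg
  refine ⟨v', u', p', g', C, ?_, ?_, ?_, ?_, ?_, ?_, ?_, ?_⟩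
  · refine ext_inner_right ℝ fun h => tendsto_nhds_unique (hv' 0 le_rfl h) ?_
    simp only [hv0]
    exact tendsto_const_nhds
  · refine ext_inner_right ℝ fun h => tendsto_nhds_unique (hu' 0 le_rfl h) ?_
    simp only [hu0]
    exact tendsto_const_nhds
  · intro t ht
    refine ⟨?_, ?_, ?_⟩
    · have := norm_le_of_weak_tendsto (hu' t ht)
        (Eventually.of_forall fun s => Real.le_sqrt_of_sq_le (hub s t ht))
      exact (Real.le_sqrt (norm_nonneg _) (by positivity)).1 this
    · have := norm_le_of_weak_tendsto (hp' t ht)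
        (Eventually.of_forall fun s => Real.le_sqrt_of_sq_le (hpb s t ht))
      exact (Real.le_sqrt (norm_nonneg _) (by positivity)).1 this
    · have := norm_le_of_weak_tendsto (hg' t ht)
        (Eventually.of_forall fun s => Real.le_sqrt_of_sq_le (hgb s t ht))
      exact (Real.le_sqrt (norm_nonneg _) (by positivity)).1 this
  · intro s hs t ht
    refine norm_le_of_weak_tendsto (l := (U : Filter (Finset W)))
      (x := fun r => (u r s : H) - u r t) (fun h => ?_)
      (Eventually.of_forall fun r => huLip r s hs t ht)
    simp only [inner_sub_left]
    exact (hu' s hs h).sub (hu' t ht h)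
  · intro s hs t ht
    refine norm_le_of_weak_tendsto (l := (U : Filter (Finset W)))
      (x := fun r => (v r s : H) - v r t - (s - t) • (u r t : H)) (fun h => ?_)
      (Eventually.of_forall fun r => hvT r s hs t ht)
    simp only [inner_sub_left, real_inner_smul_left]
    exact ((hv' s hs h).sub (hv' t ht h)).sub ((hu' t ht h).const_mul _)
  · intro w
    refine ⟨C * ‖D w‖ + C * ‖M w‖, fun s hs t ht => ?_⟩
    have h1 : Tendsto (fun r => ⟪(u r s : H) - u r t - (s - t) • (p r t : H), (w : H)⟫_ℝ) U
        (𝓝 ⟪u' s - u' t - (s - t) • p' t, (w : H)⟫_ℝ) := by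
      simp only [inner_sub_left, real_inner_smul_left]
      exact ((hu' s hs _).sub (hu' t ht _)).sub ((hp' t ht _).const_mul _)
    refine le_of_tendsto h1.norm ?_
    filter_upwards [hUV w] with r hr
    exact huT w r hr s hs t ht
  · intro ξ η hξ t ht
    refine tendsto_nhds_unique (hg' t ht ξ) ?_
    simp only [hξ]
    exact hu' t ht η
  · intro w η hη t ht
    have h1 := ((hp' t ht w).add (hv' t ht η)).add (hu' t ht (M w))
    refine tendsto_nhds_unique h1 (tendsto_const_nhds.congr' ?_)
    filter_upwards [hUV w] with r hr
    rw [← heq r w hr t, hη]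

end Galerkin

/-! ### Test functions and the Hilbert space `H¹(ℝⁿ)` -/

/-- Smooth compactly supported functions on `ℝⁿ`. -/
structure IsTest {n : ℕ} (φ : Euc n → ℝ) : Prop where
  smooth : ContDiff ℝ ∞ φ
  compact : HasCompactSupport φ

variable {n : ℕ}

instance : Fact ((2 : ℝ≥0∞) ≠ ⊤) := ⟨by simp⟩

namespace IsTest

variable {φ ψ : Euc n → ℝ}

theorem continuous (h : IsTest φ) : Continuous φ := h.smooth.continuous

theorem differentiable (h : IsTest φ) : Differentiable ℝ φ := h.smooth.differentiable (by simp)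

theorem memLp (h : IsTest φ) (p : ℝ≥0∞) : MemLp φ p volume :=
  h.continuous.memLp_of_hasCompactSupport h.compact

theorem add (h : IsTest φ) (h' : IsTest ψ) : IsTest (fun x => φ x + ψ x) :=
  ⟨h.smooth.add h'.smooth, h.compact.add h'.compact⟩

theorem zero : IsTest (fun _ : Euc n => (0 : ℝ)) := ⟨contDiff_const, HasCompactSupport.zero⟩

theorem const_mul (h : IsTest φ) (c : ℝ) : IsTest (fun x => c * φ x) :=
  ⟨contDiff_const.mul h.smooth, h.compact.mul_left⟩

theorem mul (h : IsTest φ) (h' : IsTest ψ) : IsTest (fun x => φ x * ψ x) :=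
  ⟨h.smooth.mul h'.smooth, h'.compact.mul_left⟩

theorem sum {ι : Type*} (s : Finset ι) {φ : ι → Euc n → ℝ} (h : ∀ i, IsTest (φ i)) :
    IsTest (fun x => ∑ i ∈ s, φ i x) := by
  classical
  induction s using Finset.induction_on with
  | empty => simpa using zero
  | insert i s hi ih =>
    simp only [Finset.sum_insert hi]
    exact (h i).add ih

theorem partialDeriv (h : IsTest φ) (i : Fin n) : IsTest (partialDeriv i φ) :=
  ⟨(h.smooth.fderiv_right (m := ∞) (by simp)).clm_apply contDiff_const,
    h.compact.fderiv_apply (𝕜 := ℝ) _⟩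

end IsTest

theorem gradient_apply (φ : Euc n → ℝ) (x : Euc n) (i : Fin n) :
    (∇ φ x) i = partialDeriv i φ x := by
  unfold partialDeriv
  rw [← toDual_gradient, InnerProductSpace.toDual_apply_apply, EuclideanSpace.inner_single_right]
  simp

theorem norm_gradient (φ : Euc n → ℝ) (x : Euc n) : ‖∇ φ x‖ = ‖fderiv ℝ φ x‖ := by
  rw [← toDual_gradient, LinearIsometryEquiv.norm_map]

theorem partialDeriv_mul {φ ψ : Euc n → ℝ} (hφ : Differentiable ℝ φ) (hψ : Differentiable ℝ ψ)
    (i : Fin n) (x : Euc n) : partialDeriv i (fun x => φ x * ψ x) x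
      = φ x * partialDeriv i ψ x + ψ x * partialDeriv i φ x := by
  unfold partialDeriv
  rw [fderiv_fun_mul (hφ x) (hψ x)]
  simp

theorem IsTest.continuous_gradient {φ : Euc n → ℝ} (h : IsTest φ) : Continuous (∇ φ) :=
  (InnerProductSpace.toDual ℝ (Euc n)).symm.continuous.comp (h.smooth.continuous_fderiv (by simp))

theorem IsTest.hasCompactSupport_gradient {φ : Euc n → ℝ} (h : IsTest φ) :
    HasCompactSupport (∇ φ) :=
  (h.compact.fderiv (𝕜 := ℝ)).comp_left (map_zero _)

theorem IsTest.memLp_gradient {φ : Euc n → ℝ} (h : IsTest φ) (p : ℝ≥0∞) : MemLp (∇ φ) p volume :=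
  h.continuous_gradient.memLp_of_hasCompactSupport h.hasCompactSupport_gradient

theorem IsTest.integral_mul_partialDeriv {φ ψ : Euc n → ℝ} (hφ : IsTest φ) (hψ : IsTest ψ)
    (i : Fin n) : ∫ x, φ x * DampedWave.partialDeriv i ψ x
      = -∫ x, DampedWave.partialDeriv i φ x * ψ x :=
  integral_mul_fderiv_eq_neg_fderiv_mul_of_integrable
    (((hφ.partialDeriv i).memLp 2).integrable_mul (hψ.memLp 2))
    ((hφ.memLp 2).integrable_mul ((hψ.partialDeriv i).memLp 2))
    ((hφ.memLp 2).integrable_mul (hψ.memLp 2))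
    (fun x _ => hφ.differentiable x) (fun x _ => hψ.differentiable x)

theorem inner_L2 (f g : L2 n) : ⟪f, g⟫_ℝ = ∫ x, f x * g x := by
  rw [L2.inner_def]
  simp [mul_comm]

theorem inner_L2Vec (f g : L2Vec n) : ⟪f, g⟫_ℝ = ∫ x, ⟪f x, g x⟫_ℝ := L2.inner_def f g

theorem inner_toLp {φ : Euc n → ℝ} (f : L2 n) (hφ : MemLp φ 2 volume) :
    ⟪f, hφ.toLp φ⟫_ℝ = ∫ x, f x * φ x := by
  rw [inner_L2]
  refine integral_congr_ae ?_
  filter_upwards [hφ.coeFn_toLp] with x hx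
  rw [hx]

theorem inner_toLp_vec {φ : Euc n → Euc n} (f : L2Vec n) (hφ : MemLp φ 2 volume) :
    ⟪f, hφ.toLp φ⟫_ℝ = ∫ x, ⟪f x, φ x⟫_ℝ := by
  rw [inner_L2Vec]
  refine integral_congr_ae ?_
  filter_upwards [hφ.coeFn_toLp] with x hx
  rw [hx]

/-- The `L²` class of a test function. -/
def IsTest.toL2 {φ : Euc n → ℝ} (h : IsTest φ) : L2 n := (h.memLp 2).toLp φ

theorem IsTest.coeFn_toL2 {φ : Euc n → ℝ} (h : IsTest φ) : h.toL2 =ᵐ[volume] φ :=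
  (h.memLp 2).coeFn_toLp

theorem IsTest.inner_toL2 {φ : Euc n → ℝ} (h : IsTest φ) (f : L2 n) :
    ⟪f, h.toL2⟫_ℝ = ∫ x, f x * φ x := inner_toLp f (h.memLp 2)

theorem IsTest.memLp_smul_single {φ : Euc n → ℝ} (h : IsTest φ) (i : Fin n) :
    MemLp (fun x => φ x • EuclideanSpace.single i (1 : ℝ)) 2 (volume : Measure (Euc n)) :=
  (h.continuous.smul continuous_const).memLp_of_hasCompactSupport h.compact.smul_right

/-- The `L²` class of the vector field `φ eᵢ`. -/
def IsTest.toL2Vec {φ : Euc n → ℝ} (h : IsTest φ) (i : Fin n) : L2Vec n :=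
  (h.memLp_smul_single i).toLp _

theorem IsTest.inner_toL2Vec {φ : Euc n → ℝ} (h : IsTest φ) (i : Fin n) (G : L2Vec n) :
    ⟪G, h.toL2Vec i⟫_ℝ = ∫ x, (G x) i * φ x := by
  refine (inner_toLp_vec G (h.memLp_smul_single i)).trans ?_
  simp [inner_smul_right, EuclideanSpace.inner_single_right, mul_comm]

/-- In this form the condition consists of equations between inner products with fixed vectors, so
closedness of the graph and stability under weak limits are immediate. -/
theorem isWeakGradient_iff {f : L2 n} {G : L2Vec n} : IsWeakGradient f G ↔
    ∀ (φ : Euc n → ℝ) (h : IsTest φ) (i : Fin n),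
      ⟪f, (h.partialDeriv i).toL2⟫_ℝ = -⟪G, h.toL2Vec i⟫_ℝ := by
  constructor
  · intro H φ h i
    rw [IsTest.inner_toL2, IsTest.inner_toL2Vec]
    exact H φ h.smooth h.compact i
  · intro H φ h1 h2 i
    have := H φ ⟨h1, h2⟩ i
    rwa [IsTest.inner_toL2, IsTest.inner_toL2Vec] at this

theorem isClosed_h1Graph : IsClosed (h1Graph n : Set (WithLp 2 (L2 n × L2Vec n))) := by
  have : (h1Graph n : Set (WithLp 2 (L2 n × L2Vec n))) =
      ⋂ (φ : Euc n → ℝ) (h : IsTest φ) (i : Fin n),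
        {p | ⟪p.fst, (h.partialDeriv i).toL2⟫_ℝ = -⟪p.snd, h.toL2Vec i⟫_ℝ} := by
    ext p
    simp only [mem_iInter, mem_ofPred_eq]
    exact isWeakGradient_iff
  rw [this]
  refine isClosed_iInter fun φ => isClosed_iInter fun h => isClosed_iInter fun i => ?_
  have e : Continuous (WithLp.ofLp : WithLp 2 (L2 n × L2Vec n) → L2 n × L2Vec n) :=
    WithLp.prod_continuous_ofLp 2 _ _
  exact isClosed_eq ((continuous_fst.comp e).inner continuous_const)
    ((continuous_snd.comp e).inner continuous_const).neg

instance : CompleteSpace (H1 n) := isClosed_h1Graph.completeSpace_coe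

instance : SecondCountableTopology (WithLp 2 (L2 n × L2Vec n)) := by
  have h1 : SecondCountableTopology (L2 n) := inferInstance
  have h2 : SecondCountableTopology (L2Vec n) := inferInstance
  have h3 : SecondCountableTopology (L2 n × L2Vec n) :=
    TopologicalSpace.instSecondCountableTopologyProd
  exact (WithLp.homeomorphProd 2 (L2 n) (L2Vec n)).secondCountableTopology

instance : SecondCountableTopology (H1 n) :=
  TopologicalSpace.Subtype.secondCountableTopology _

theorem inner_H1 (f g : H1 n) : ⟪f, g⟫_ℝ = ⟪f.toL2, g.toL2⟫_ℝ + ⟪f.grad, g.grad⟫_ℝ := rfl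

theorem norm_sq_H1 (f : H1 n) : ‖f‖ ^ 2 = ‖f.toL2‖ ^ 2 + ‖f.grad‖ ^ 2 := by
  simp only [← real_inner_self_eq_norm_sq, inner_H1]

theorem H1.isWeakGradient (f : H1 n) : IsWeakGradient f.toL2 f.grad := f.2

/-- The element of `H¹` with given function and weak gradient. -/
def H1.mk (f : L2 n) (G : L2Vec n) (h : IsWeakGradient f G) : H1 n := ⟨WithLp.toLp 2 (f, G), h⟩

/-- `H¹ → L²` as a continuous linear map. -/
def toL2L (n : ℕ) : H1 n →L[ℝ] L2 n :=
  ((ContinuousLinearMap.fst ℝ (L2 n) (L2Vec n)).comp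
    (WithLp.prodContinuousLinearEquiv 2 ℝ (L2 n) (L2Vec n)).toContinuousLinearMap).comp
    (h1Graph n).subtypeL

/-- The weak gradient as a continuous linear map on `H¹`. -/
def gradL (n : ℕ) : H1 n →L[ℝ] L2Vec n :=
  ((ContinuousLinearMap.snd ℝ (L2 n) (L2Vec n)).comp
    (WithLp.prodContinuousLinearEquiv 2 ℝ (L2 n) (L2Vec n)).toContinuousLinearMap).comp
    (h1Graph n).subtypeL

@[simp] theorem toL2L_apply (f : H1 n) : toL2L n f = f.toL2 := rfl

@[simp] theorem gradL_apply (f : H1 n) : gradL n f = f.grad := rfl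

theorem IsWeakGradient.unique_zero {f : L2 n} {G : L2Vec n} (h : IsWeakGradient f G) (hf : f = 0) :
    G = 0 := by
  have hi : ∀ i : Fin n, ∀ᵐ x, (G x) i = 0 := by
    intro i
    refine ae_eq_zero_of_integral_contDiff_smul_eq_zero
      ((memLp_component G i).locallyIntegrable (by norm_num)) fun φ h1 h2 => ?_
    have h3 := (isWeakGradient_iff.1 h) φ ⟨h1, h2⟩ i
    rw [hf, inner_zero_left, IsTest.inner_toL2Vec] at h3
    simp only [smul_eq_mul, mul_comm (φ _)]
    linarith
  rw [Lp.eq_zero_iff_ae_eq_zero]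
  filter_upwards [ae_all_iff.2 hi] with x hx
  ext i
  simpa using hx i

/-- The weak gradient is determined by the function. This also makes `H¹ → L²` a measurable
embedding later on. -/
theorem toL2_injective : Function.Injective (H1.toL2 : H1 n → L2 n) := by
  refine (injective_iff_map_eq_zero (toL2L n)).2 fun f hf => ?_
  have hg : f.grad = 0 := f.isWeakGradient.unique_zero hf
  have : ‖f‖ ^ 2 = 0 := by
    rw [norm_sq_H1, hg]
    rw [toL2L_apply] at hf
    simp [hf]
  simpa using this

theorem IsTest.isWeakGradient {φ : Euc n → ℝ} (h : IsTest φ) :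
    IsWeakGradient h.toL2 ((h.memLp_gradient 2).toLp (∇ φ)) := by
  intro ψ h1 h2 i
  have e1 : ∫ x, h.toL2 x * DampedWave.partialDeriv i ψ x
      = ∫ x, φ x * DampedWave.partialDeriv i ψ x := by
    refine integral_congr_ae ?_
    filter_upwards [h.coeFn_toL2] with x hx
    rw [hx]
  have e2 : ∫ x, ((h.memLp_gradient 2).toLp (∇ φ) x) i * ψ x
      = ∫ x, DampedWave.partialDeriv i φ x * ψ x := by
    refine integral_congr_ae ?_
    filter_upwards [(h.memLp_gradient 2).coeFn_toLp] with x hx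
    rw [hx, gradient_apply]
  rw [e1, e2]
  exact h.integral_mul_partialDeriv ⟨h1, h2⟩ i

/-- A test function as an element of `H¹`. -/
def IsTest.toH1 {φ : Euc n → ℝ} (h : IsTest φ) : H1 n := H1.mk _ _ h.isWeakGradient

@[simp] theorem IsTest.toL2_toH1 {φ : Euc n → ℝ} (h : IsTest φ) : h.toH1.toL2 = h.toL2 := rfl

theorem laplacian_eq_sum {φ : Euc n → ℝ} (h : IsTest φ) (x : Euc n) :
    Laplacian.laplacian φ x = ∑ i, partialDeriv i (partialDeriv i φ) x := by
  rw [InnerProductSpace.laplacian_eq_iteratedFDeriv_orthonormalBasis φ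
    (EuclideanSpace.basisFun (Fin n) ℝ)]
  refine Finset.sum_congr rfl fun i _ => ?_
  rw [iteratedFDeriv_two_apply]
  simp only [EuclideanSpace.basisFun_apply, Matrix.cons_val_zero, Matrix.cons_val_one]
  unfold partialDeriv
  rw [fderiv_clm_apply ((h.smooth.fderiv_right (m := ∞) (by simp)).differentiable (by simp) x)
    (differentiableAt_const _)]
  simp

theorem IsTest.laplacian {φ : Euc n → ℝ} (h : IsTest φ) : IsTest (Laplacian.laplacian φ) := by
  have : Laplacian.laplacian φ = fun x => ∑ i, DampedWave.partialDeriv i (DampedWave.partialDeriv i φ) x :=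
    funext (laplacian_eq_sum h)
  rw [this]
  exact IsTest.sum _ fun i => (h.partialDeriv i).partialDeriv i

/-- The definition of the weak gradient, applied to each `∂ᵢφ` and summed. It moves all derivatives
onto the test function. -/
theorem IsTest.inner_grad {φ : Euc n → ℝ} (h : IsTest φ) {f : L2 n} {G : L2Vec n}
    (hf : IsWeakGradient f G) : ⟪G, h.toH1.grad⟫_ℝ = -⟪f, h.laplacian.toL2⟫_ℝ := by
  have e1 : ⟪G, h.toH1.grad⟫_ℝ = ∑ i, ∫ x, (G x) i * DampedWave.partialDeriv i φ x := by
    refine (inner_toLp_vec G (h.memLp_gradient 2)).trans ?_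
    rw [← integral_finsetSum]
    · refine integral_congr_ae (Eventually.of_forall fun x => ?_)
      simp only [PiLp.inner_apply, gradient_apply]
      simp [mul_comm]
    · intro i _
      exact (memLp_component G i).integrable_mul ((h.partialDeriv i).memLp 2)
  have e2 : ⟪f, h.laplacian.toL2⟫_ℝ
      = ∑ i, ∫ x, f x * DampedWave.partialDeriv i (DampedWave.partialDeriv i φ) x := by
    rw [IsTest.inner_toL2, ← integral_finsetSum]
    · simp only [laplacian_eq_sum h, Finset.mul_sum]
    · intro i _
      exact (Lp.memLp f).integrable_mul (((h.partialDeriv i).partialDeriv i).memLp 2)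
  rw [e1, e2, ← Finset.sum_neg_distrib]
  refine Finset.sum_congr rfl fun i _ => ?_
  rw [hf _ (h.partialDeriv i).smooth (h.partialDeriv i).compact i, neg_neg]

variable {n : ℕ}

/-! ### Multiplication operators and cutoffs -/

section MulOp

variable {E F G : Type*} [NormedAddCommGroup E] [NormedSpace ℝ E] [NormedAddCommGroup F]
  [NormedSpace ℝ F] [NormedAddCommGroup G] [NormedSpace ℝ G]

theorem memLp_bilin (B : E →L[ℝ] F →L[ℝ] G) {χ : Euc n → E} (hχ : Continuous χ)
    (hc : HasCompactSupport χ) {f : Euc n → F} (hf : MemLp f 2 volume) :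
    MemLp (fun x => B (χ x) (f x)) 2 volume := by
  obtain ⟨c, hb⟩ := hc.exists_bound_of_continuous hχ
  refine hf.of_le_mul (c := ‖B‖ * c)
    (B.aestronglyMeasurable_comp₂ hχ.aestronglyMeasurable hf.1) (Eventually.of_forall fun x => ?_)
  refine (B.le_opNorm₂ _ _).trans ?_
  gcongr
  exact hb x

/-- Pointwise product with a fixed continuous compactly supported function, as an operator. -/
def mulOp (B : E →L[ℝ] F →L[ℝ] G) {χ : Euc n → E} (hχ : Continuous χ)
    (hc : HasCompactSupport χ) :
    Lp F 2 (volume : Measure (Euc n)) →L[ℝ] Lp G 2 (volume : Measure (Euc n)) :=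
  LinearMap.mkContinuous
    { toFun := fun f => (memLp_bilin B hχ hc (Lp.memLp f)).toLp _
      map_add' := fun f g => by
        refine Lp.ext ?_
        filter_upwards [(memLp_bilin B hχ hc (Lp.memLp (f + g))).coeFn_toLp,
          (memLp_bilin B hχ hc (Lp.memLp f)).coeFn_toLp,
          (memLp_bilin B hχ hc (Lp.memLp g)).coeFn_toLp, Lp.coeFn_add f g,
          Lp.coeFn_add ((memLp_bilin B hχ hc (Lp.memLp f)).toLp _)
            ((memLp_bilin B hχ hc (Lp.memLp g)).toLp _)] with x h1 h2 h3 h4 h5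
        rw [h1, h5, Pi.add_apply, h2, h3, h4, Pi.add_apply, map_add]
      map_smul' := fun c f => by
        refine Lp.ext ?_
        filter_upwards [(memLp_bilin B hχ hc (Lp.memLp (c • f))).coeFn_toLp,
          (memLp_bilin B hχ hc (Lp.memLp f)).coeFn_toLp, Lp.coeFn_smul c f,
          Lp.coeFn_smul c ((memLp_bilin B hχ hc (Lp.memLp f)).toLp _)] with x h1 h2 h3 h4
        rw [RingHom.id_apply, h1, h4, Pi.smul_apply, h2, h3, Pi.smul_apply, map_smul] }
    (‖B‖ * (hc.exists_bound_of_continuous hχ).choose) (fun f => by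
      refine Lp.norm_le_mul_norm_of_ae_le_mul ?_
      filter_upwards [(memLp_bilin B hχ hc (Lp.memLp f)).coeFn_toLp] with x h1
      refine (congrArg norm h1).trans_le ((B.le_opNorm₂ _ _).trans ?_)
      gcongr
      exact (hc.exists_bound_of_continuous hχ).choose_spec x)

theorem coeFn_mulOp (B : E →L[ℝ] F →L[ℝ] G) {χ : Euc n → E} (hχ : Continuous χ)
    (hc : HasCompactSupport χ) (f : Lp F 2 (volume : Measure (Euc n))) :
    mulOp B hχ hc f =ᵐ[volume] fun x => B (χ x) (f x) :=
  (memLp_bilin B hχ hc (Lp.memLp f)).coeFn_toLp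

end MulOp

namespace IsTest

variable {χ : Euc n → ℝ}

/-- Multiplication of `L²` functions by a test function. -/
def mulL (h : IsTest χ) : L2 n →L[ℝ] L2 n :=
  mulOp (ContinuousLinearMap.mul ℝ ℝ) h.continuous h.compact

/-- Multiplication of `L²` vector fields by a test function. -/
def mulV (h : IsTest χ) : L2Vec n →L[ℝ] L2Vec n :=
  mulOp (ContinuousLinearMap.lsmul ℝ ℝ) h.continuous h.compact

/-- The map `f ↦ f ∇χ`. -/
def mulGrad (h : IsTest χ) : L2 n →L[ℝ] L2Vec n :=
  mulOp (ContinuousLinearMap.lsmul ℝ ℝ).flip h.continuous_gradient h.hasCompactSupport_gradient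

theorem coeFn_mulL (h : IsTest χ) (f : L2 n) : h.mulL f =ᵐ[volume] fun x => χ x * f x :=
  coeFn_mulOp _ _ _ f

theorem coeFn_mulV (h : IsTest χ) (G : L2Vec n) : h.mulV G =ᵐ[volume] fun x => χ x • G x :=
  coeFn_mulOp _ _ _ G

theorem coeFn_mulGrad (h : IsTest χ) (f : L2 n) :
    h.mulGrad f =ᵐ[volume] fun x => f x • ∇ χ x :=
  coeFn_mulOp _ _ _ f

theorem inner_mulL (h : IsTest χ) (f g : L2 n) : ⟪h.mulL f, g⟫_ℝ = ∫ x, χ x * (f x * g x) := by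
  rw [inner_L2]
  refine integral_congr_ae ?_
  filter_upwards [h.coeFn_mulL f] with x hx
  rw [hx, mul_assoc]

theorem inner_mulV (h : IsTest χ) (f g : L2Vec n) :
    ⟪h.mulV f, g⟫_ℝ = ∫ x, χ x * ⟪f x, g x⟫_ℝ := by
  rw [inner_L2Vec]
  refine integral_congr_ae ?_
  filter_upwards [h.coeFn_mulV f] with x hx
  rw [hx, real_inner_smul_left]

theorem inner_mulL_comm (h : IsTest χ) (f g : L2 n) : ⟪h.mulL f, g⟫_ℝ = ⟪f, h.mulL g⟫_ℝ := by
  rw [real_inner_comm (h.mulL g), inner_mulL, inner_mulL]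
  simp only [mul_comm (f _)]

theorem inner_mulV_comm (h : IsTest χ) (f g : L2Vec n) :
    ⟪h.mulV f, g⟫_ℝ = ⟪f, h.mulV g⟫_ℝ := by
  rw [real_inner_comm (h.mulV g), inner_mulV, inner_mulV]
  simp only [real_inner_comm]

theorem isWeakGradient_mul (h : IsTest χ) {f : L2 n} {G : L2Vec n} (hf : IsWeakGradient f G) :
    IsWeakGradient (h.mulL f) (h.mulV G + h.mulGrad f) := by
  rw [isWeakGradient_iff] at hf ⊢
  intro ψ hψ i
  have e0 := hf _ (h.mul hψ) i
  rw [inner_toL2, inner_toL2Vec] at e0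
  rw [inner_mulL_comm, inner_add_left]
  have e1 : ⟪f, h.mulL (hψ.partialDeriv i).toL2⟫_ℝ
      = ∫ x, f x * (χ x * DampedWave.partialDeriv i ψ x) := by
    rw [inner_L2]
    refine integral_congr_ae ?_
    filter_upwards [h.coeFn_mulL (hψ.partialDeriv i).toL2, (hψ.partialDeriv i).coeFn_toL2]
      with x h1 h2
    rw [h1, h2]
  have e2 : ⟪h.mulV G, hψ.toL2Vec i⟫_ℝ = ∫ x, (G x) i * (χ x * ψ x) := by
    rw [inner_toL2Vec]
    refine integral_congr_ae ?_
    filter_upwards [h.coeFn_mulV G] with x h1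
    rw [h1, PiLp.smul_apply, smul_eq_mul]
    ring
  have e3 : ⟪h.mulGrad f, hψ.toL2Vec i⟫_ℝ = ∫ x, f x * (ψ x * DampedWave.partialDeriv i χ x) := by
    rw [inner_toL2Vec]
    refine integral_congr_ae ?_
    filter_upwards [h.coeFn_mulGrad f] with x h1
    rw [h1, PiLp.smul_apply, gradient_apply, smul_eq_mul]
    ring
  have e4 : ∫ x, f x * DampedWave.partialDeriv i (fun x => χ x * ψ x) x
      = (∫ x, f x * (χ x * DampedWave.partialDeriv i ψ x))
        + ∫ x, f x * (ψ x * DampedWave.partialDeriv i χ x) := by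
    rw [← integral_add (f := fun x => f x * (χ x * DampedWave.partialDeriv i ψ x))
      (g := fun x => f x * (ψ x * DampedWave.partialDeriv i χ x))
      ((Lp.memLp f).integrable_mul ((h.mul (hψ.partialDeriv i)).memLp 2))
      ((Lp.memLp f).integrable_mul ((hψ.mul (h.partialDeriv i)).memLp 2))]
    simp only [partialDeriv_mul h.differentiable hψ.differentiable, mul_add]
  rw [e1, e2, e3]
  linarith

/-- Multiplication of an element of `H¹` by a test function. -/
def mulH1 (h : IsTest χ) (f : H1 n) : H1 n := H1.mk _ _ (h.isWeakGradient_mul f.isWeakGradient)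

@[simp] theorem toL2_mulH1 (h : IsTest χ) (f : H1 n) : (h.mulH1 f).toL2 = h.mulL f.toL2 := rfl

@[simp] theorem grad_mulH1 (h : IsTest χ) (f : H1 n) :
    (h.mulH1 f).grad = h.mulV f.grad + h.mulGrad f.toL2 := rfl

end IsTest

/-- A smooth cutoff, equal to `1` on the ball of radius `1` and to `0` off the ball of radius `2`. -/
def cutoffBump (n : ℕ) : ContDiffBump (0 : Euc n) := ⟨1, 2, zero_lt_one, one_lt_two⟩

/-- Cutoff functions on balls of radius `N + 1`. -/
def cutoff (n N : ℕ) (x : Euc n) : ℝ := cutoffBump n (((N : ℝ) + 1)⁻¹ • x)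

theorem isTest_cutoff (n N : ℕ) : IsTest (cutoff n N) := by
  have h0 : ((N : ℝ) + 1)⁻¹ ≠ 0 := by positivity
  exact ⟨(cutoffBump n).contDiff.comp (contDiff_const_smul _),
    (cutoffBump n).hasCompactSupport.comp_homeomorph (Homeomorph.smulOfNeZero _ h0)⟩

theorem cutoff_nonneg (N : ℕ) (x : Euc n) : 0 ≤ cutoff n N x := (cutoffBump n).nonneg

theorem cutoff_le_one (N : ℕ) (x : Euc n) : cutoff n N x ≤ 1 := (cutoffBump n).le_one

theorem tendsto_cutoff (x : Euc n) : Tendsto (fun N => cutoff n N x) atTop (𝓝 1) := by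
  refine tendsto_const_nhds.congr' ?_
  obtain ⟨M, hM⟩ := exists_nat_ge ‖x‖
  filter_upwards [eventually_ge_atTop M] with N hN
  refine ((cutoffBump n).one_of_mem_closedBall ?_).symm
  have : ‖x‖ ≤ (N : ℝ) + 1 := by
    have : (M : ℝ) ≤ N := by exact_mod_cast hN
    linarith
  rw [mem_closedBall_zero_iff, norm_smul, norm_inv, Real.norm_eq_abs,
    abs_of_pos (by positivity : (0 : ℝ) < (N : ℝ) + 1), inv_mul_le_iff₀ (by positivity)]
  simpa [cutoffBump] using this

theorem exists_norm_gradient_cutoff_le (n : ℕ) :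
    ∃ C : ℝ, 0 ≤ C ∧ ∀ N x, ‖∇ (cutoff n N) x‖ ≤ C / ((N : ℝ) + 1) := by
  have hb : IsTest (cutoffBump n) := ⟨(cutoffBump n).contDiff, (cutoffBump n).hasCompactSupport⟩
  obtain ⟨C, hC⟩ := (hb.compact.fderiv (𝕜 := ℝ)).exists_bound_of_continuous
    (hb.smooth.continuous_fderiv (by simp))
  refine ⟨C, (norm_nonneg _).trans (hC 0), fun N x => ?_⟩
  rw [norm_gradient]
  have : fderiv ℝ (cutoff n N) x
      = ((N : ℝ) + 1)⁻¹ • fderiv ℝ (cutoffBump n) (((N : ℝ) + 1)⁻¹ • x) :=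
    fderiv_comp_smul ..
  rw [this, norm_smul, norm_inv, Real.norm_eq_abs,
    abs_of_pos (by positivity : (0 : ℝ) < (N : ℝ) + 1), inv_mul_eq_div]
  gcongr
  exact hC _

theorem tendsto_integral_cutoff_mul {f : Euc n → ℝ} (hf : Integrable f) :
    Tendsto (fun N => ∫ x, cutoff n N x * f x) atTop (𝓝 (∫ x, f x)) := by
  refine tendsto_integral_of_dominated_convergence (fun x => ‖f x‖)
    (fun N => (isTest_cutoff n N).continuous.aestronglyMeasurable.mul hf.1) hf.norm
    (fun N => Eventually.of_forall fun x => ?_) (Eventually.of_forall fun x => ?_)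
  · rw [norm_mul, Real.norm_eq_abs, abs_of_nonneg (cutoff_nonneg N x)]
    exact mul_le_of_le_one_left (norm_nonneg _) (cutoff_le_one N x)
  · simpa using (tendsto_cutoff x).mul_const (f x)

theorem norm_mulGrad_cutoff_le {C : ℝ} (hC : ∀ N x, ‖∇ (cutoff n N) x‖ ≤ C / ((N : ℝ) + 1)) (N : ℕ)
    (f : L2 n) : ‖(isTest_cutoff n N).mulGrad f‖ ≤ C / ((N : ℝ) + 1) * ‖f‖ := by
  refine Lp.norm_le_mul_norm_of_ae_le_mul ?_
  filter_upwards [(isTest_cutoff n N).coeFn_mulGrad f] with x hx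
  rw [hx, norm_smul, mul_comm]
  gcongr
  exact hC N x

theorem tendsto_inner_mulL_cutoff (f g : L2 n) :
    Tendsto (fun N => ⟪(isTest_cutoff n N).mulL f, g⟫_ℝ) atTop (𝓝 ⟪f, g⟫_ℝ) := by
  simp only [IsTest.inner_mulL, inner_L2 f g]
  exact tendsto_integral_cutoff_mul ((Lp.memLp f).integrable_mul (Lp.memLp g))

theorem tendsto_inner_mulV_cutoff (f g : L2Vec n) :
    Tendsto (fun N => ⟪(isTest_cutoff n N).mulV f, g⟫_ℝ) atTop (𝓝 ⟪f, g⟫_ℝ) := by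
  simp only [IsTest.inner_mulV, inner_L2Vec f g]
  exact tendsto_integral_cutoff_mul (L2.integrable_inner f g)

theorem tendsto_const_div_natCast_add_one (C : ℝ) :
    Tendsto (fun N : ℕ => C / ((N : ℝ) + 1)) atTop (𝓝 0) :=
  tendsto_const_nhds.div_atTop (tendsto_atTop_add_const_right _ _ tendsto_natCast_atTop_atTop)

/-- The term `f ∇χ_N` is of order `1/(N+1)`; the others converge by dominated convergence. -/
theorem tendsto_inner_mulH1_cutoff (f g : H1 n) :
    Tendsto (fun N => ⟪(isTest_cutoff n N).mulH1 f, g⟫_ℝ) atTop (𝓝 ⟪f, g⟫_ℝ) := by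
  obtain ⟨C, hC0, hC⟩ := exists_norm_gradient_cutoff_le n
  have h1 : Tendsto (fun N => ⟪(isTest_cutoff n N).mulGrad f.toL2, g.grad⟫_ℝ) atTop (𝓝 0) := by
    refine squeeze_zero_norm (a := fun N : ℕ => C / ((N : ℝ) + 1) * (‖f.toL2‖ * ‖g.grad‖))
      (fun N => ?_) ?_
    · refine (norm_inner_le_norm _ _).trans ?_
      rw [← mul_assoc]
      gcongr
      exact norm_mulGrad_cutoff_le hC N _
    · simpa using (tendsto_const_div_natCast_add_one C).mul_const (‖f.toL2‖ * ‖g.grad‖)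
  have h2 := ((tendsto_inner_mulL_cutoff f.toL2 g.toL2).add
    ((tendsto_inner_mulV_cutoff f.grad g.grad).add h1))
  rw [add_zero] at h2
  simpa only [inner_H1, IsTest.toL2_mulH1, IsTest.grad_mulH1, inner_add_left] using h2

/-! ### Mollification and density of test functions -/

/-- The convolution of a bump function with a function on `ℝⁿ`. -/
def mollify (ρ : ContDiffBump (0 : Euc n)) (F : Euc n → ℝ) : Euc n → ℝ :=
  ρ.normed volume ⋆[ContinuousLinearMap.lsmul ℝ ℝ, volume] F

theorem mollify_apply (ρ : ContDiffBump (0 : Euc n)) (F : Euc n → ℝ) (x : Euc n) :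
    mollify ρ F x = ∫ t, ρ.normed volume t * F (x - t) := rfl

theorem isTest_normed (ρ : ContDiffBump (0 : Euc n)) : IsTest (ρ.normed volume) :=
  ⟨ρ.contDiff_normed, ρ.hasCompactSupport_normed⟩

theorem isTest_mollify (ρ : ContDiffBump (0 : Euc n)) {F : Euc n → ℝ} (hF : LocallyIntegrable F)
    (hc : HasCompactSupport F) : IsTest (mollify ρ F) :=
  ⟨ρ.hasCompactSupport_normed.contDiff_convolution_left _ ρ.contDiff_normed hF,
    ρ.hasCompactSupport_normed.convolution _ hc⟩

theorem partialDeriv_comp_const_sub {φ : Euc n → ℝ} (h : IsTest φ) (i : Fin n) (x t : Euc n) :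
    partialDeriv i (fun t => φ (x - t)) t = -partialDeriv i φ (x - t) := by
  unfold partialDeriv
  have h1 : HasFDerivAt (fun t => φ (x - t))
      ((fderiv ℝ φ (x - t)).comp (-ContinuousLinearMap.id ℝ (Euc n))) t :=
    (h.differentiable (x - t)).hasFDerivAt.comp t ((hasFDerivAt_id t).const_sub x)
  rw [h1.fderiv]
  simp

theorem IsTest.comp_const_sub {φ : Euc n → ℝ} (h : IsTest φ) (x : Euc n) :
    IsTest (fun t => φ (x - t)) :=
  ⟨h.smooth.comp (contDiff_const.sub contDiff_id),
    h.compact.comp_homeomorph (Homeomorph.subLeft x)⟩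

/-- The derivative falls on the bump, and the reflected bump `t ↦ ρ (x - t)` is an admissible test
function for the weak gradient of `f`. -/
theorem partialDeriv_mollify (ρ : ContDiffBump (0 : Euc n)) (f : H1 n) {F : Euc n → ℝ}
    (hF : f.toL2 =ᵐ[volume] F) (i : Fin n) (x : Euc n) :
    partialDeriv i (mollify ρ F) x = mollify ρ (fun y => (f.grad y) i) x := by
  have hloc : LocallyIntegrable F :=
    (((memLp_congr_ae hF).1 (Lp.memLp f.toL2))).locallyIntegrable (by norm_num)
  have hρ := isTest_normed ρ
  have h1 := ρ.hasCompactSupport_normed.hasFDerivAt_convolution_left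
    (ContinuousLinearMap.lsmul ℝ ℝ) (hρ.smooth.of_le (by simp)) hloc x
  have hex := (hρ.compact.fderiv (𝕜 := ℝ)).convolutionExists_left
    ((ContinuousLinearMap.lsmul ℝ ℝ).precompL (Euc n)) (hρ.smooth.continuous_fderiv (by simp)) hloc x
  have h2 : partialDeriv i (mollify ρ F) x
      = ∫ t, partialDeriv i (ρ.normed volume) t * F (x - t) := by
    have e : partialDeriv i (mollify ρ F) x = (fderiv ℝ (ρ.normed volume)
        ⋆[(ContinuousLinearMap.lsmul ℝ ℝ).precompL (Euc n), volume] F) x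
          (EuclideanSpace.single i 1) := by
      unfold partialDeriv
      rw [← h1.fderiv]
      rfl
    rw [e, convolution_def, ContinuousLinearMap.integral_apply hex]
    rfl
  have h3 : ∫ t, partialDeriv i (ρ.normed volume) t * F (x - t)
      = ∫ t, partialDeriv i (ρ.normed volume) (x - t) * F t := by
    rw [← integral_sub_left_eq_self (μ := volume) _ x]
    simp
  have h4 := f.isWeakGradient _ (hρ.comp_const_sub x).smooth (hρ.comp_const_sub x).compact i
  simp only [partialDeriv_comp_const_sub hρ, mul_neg, integral_neg, neg_inj] at h4
  have h5 : ∫ t, f.toL2 t * partialDeriv i (ρ.normed volume) (x - t)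
      = ∫ t, partialDeriv i (ρ.normed volume) (x - t) * F t := by
    refine integral_congr_ae ?_
    filter_upwards [hF] with t ht
    rw [ht, mul_comm]
  rw [h2, h3, ← h5, h4, mollify_apply, ← integral_sub_left_eq_self (μ := volume) _ x]
  simp [mul_comm]

theorem integral_mul_comp_add_eq (g f : L2 n) (y : Euc n) :
    ⟪g, DomAddAct.mk y +ᵥ f⟫_ℝ = ∫ x, g x * f (y + x) := by
  rw [inner_L2]
  refine integral_congr_ae ?_
  filter_upwards [DomAddAct.vadd_Lp_ae_eq (DomAddAct.mk y) f] with x hx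
  rw [hx]
  rfl

/-- Fubini turns the pairing with a mollified function into a mollification of the translation
correlation, evaluated at the origin. Convergence then only needs continuity of that correlation. -/
theorem integral_mul_mollify (ρ : ContDiffBump (0 : Euc n)) (g f : L2 n) :
    ∫ x, g x * mollify ρ f x = ((ρ.normed volume)
      ⋆[ContinuousLinearMap.lsmul ℝ ℝ, volume] fun y => ⟪g, DomAddAct.mk y +ᵥ f⟫_ℝ) 0 := by
  have hρ := isTest_normed ρ
  have hρi : Integrable (ρ.normed volume) := ρ.integrable_normed
  have hmeas : AEStronglyMeasurable
      (fun p : Euc n × Euc n => g p.1 * (ρ.normed volume p.2 * f (p.1 - p.2)))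
      ((volume : Measure (Euc n)).prod volume) :=
    (Lp.aestronglyMeasurable g).comp_fst.mul
      (hρi.1.convolution_integrand (ContinuousLinearMap.mul ℝ ℝ) (Lp.aestronglyMeasurable f))
  have hg2 : Integrable (fun x => g x ^ 2) := (Lp.memLp g).integrable_sq
  have hf2 : Integrable (fun x => f x ^ 2) := (Lp.memLp f).integrable_sq
  have hint : Integrable
      (fun p : Euc n × Euc n => g p.1 * (ρ.normed volume p.2 * f (p.1 - p.2)))
      ((volume : Measure (Euc n)).prod volume) := by
    -- The dominating function is `ρ(t) (g(x)² + f(x - t)²)`.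
    refine Integrable.mono' ((hg2.mul_prod hρi).add
      (hρi.convolution_integrand (ContinuousLinearMap.mul ℝ ℝ) hf2)) hmeas
      (Eventually.of_forall fun p => ?_)
    simp only [Pi.add_apply, ContinuousLinearMap.mul_apply', norm_mul, Real.norm_eq_abs]
    have h0 : 0 ≤ ρ.normed volume p.2 := ρ.nonneg_normed _
    rw [abs_of_nonneg h0]
    have : |g p.1| * |f (p.1 - p.2)| ≤ g p.1 ^ 2 + f (p.1 - p.2) ^ 2 := by
      rw [← sq_abs (g p.1), ← sq_abs (f (p.1 - p.2))]
      nlinarith [sq_nonneg (|g p.1| - |f (p.1 - p.2)|), sq_nonneg (|g p.1|),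
        sq_nonneg (|f (p.1 - p.2)|)]
    nlinarith [mul_le_mul_of_nonneg_left this h0]
  have h1 : ∫ x, g x * mollify ρ f x
      = ∫ x, ∫ t, g x * (ρ.normed volume t * f (x - t)) := by
    refine integral_congr_ae (Eventually.of_forall fun x => ?_)
    simp only [mollify_apply]
    rw [integral_const_mul]
  rw [h1, integral_integral_swap hint, convolution_def]
  refine integral_congr_ae (Eventually.of_forall fun t => ?_)
  simp only [ContinuousLinearMap.lsmul_apply, smul_eq_mul]
  rw [integral_mul_comp_add_eq, ← integral_const_mul]
  refine integral_congr_ae (Eventually.of_forall fun x => ?_)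
  have : 0 - t + x = x - t := by abel
  simp only [this]
  ring

/-- A sequence of bump functions shrinking to the origin. -/
def shrinkingBump (n k : ℕ) : ContDiffBump (0 : Euc n) :=
  ⟨1 / ((k : ℝ) + 1), 2 / ((k : ℝ) + 1), by positivity, by gcongr; norm_num⟩

/-- Translations act continuously on `L²`, so the correlation `y ↦ ⟪g, f(y + ·)⟫` is continuous and
its averages over shrinking bumps tend to the value at zero. -/
theorem tendsto_integral_mul_mollify (g f : L2 n) :
    Tendsto (fun k => ∫ x, g x * mollify (shrinkingBump n k) f x) atTop (𝓝 ⟪g, f⟫_ℝ) := by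
  have hcont : Continuous fun y : Euc n => ⟪g, DomAddAct.mk y +ᵥ f⟫_ℝ := by
    have : Continuous fun y : Euc n => DomAddAct.mk y +ᵥ f :=
      DomAddAct.continuous_mk.vadd continuous_const
    exact continuous_const.inner this
  have h := ContDiffBump.convolution_tendsto_right_of_continuous (μ := volume)
    (φ := shrinkingBump n) (l := atTop) (tendsto_const_div_natCast_add_one 2) hcont 0
  have h0 : ⟪g, DomAddAct.mk (0 : Euc n) +ᵥ f⟫_ℝ = ⟪g, f⟫_ℝ := by
    rw [DomAddAct.mk_zero, zero_vadd]
  rw [← h0]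
  simpa only [integral_mul_mollify] using h

theorem mollify_congr (ρ : ContDiffBump (0 : Euc n)) {F F' : Euc n → ℝ} (h : F =ᵐ[volume] F') :
    mollify ρ F = mollify ρ F' := by
  funext x
  rw [mollify_apply, mollify_apply]
  refine integral_congr_ae ?_
  have := (quasiMeasurePreserving_sub_left_of_right_invariant (volume : Measure (Euc n)) x).ae_eq h
  filter_upwards [this] with t ht
  simp only [Function.comp_apply] at ht
  rw [ht]

theorem inner_grad_eq_sum (g : L2Vec n) {φ : Euc n → ℝ} (h : IsTest φ) :
    ⟪g, h.toH1.grad⟫_ℝ = ∑ i, ∫ x, (g x) i * partialDeriv i φ x := by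
  refine (inner_toLp_vec g (h.memLp_gradient 2)).trans ?_
  rw [← integral_finsetSum]
  · refine integral_congr_ae (Eventually.of_forall fun x => ?_)
    simp only [PiLp.inner_apply, gradient_apply]
    simp [mul_comm]
  · intro i _
    exact (memLp_component g i).integrable_mul ((h.partialDeriv i).memLp 2)

theorem inner_L2Vec_eq_sum (g f : L2Vec n) :
    ⟪g, f⟫_ℝ = ∑ i, ∫ x, (g x) i * (f x) i := by
  rw [inner_L2Vec, ← integral_finsetSum]
  · refine integral_congr_ae (Eventually.of_forall fun x => ?_)
    simp only [PiLp.inner_apply]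
    simp [mul_comm]
  · intro i _
    exact (memLp_component g i).integrable_mul (memLp_component f i)

/-- Test functions are dense in `H¹`. -/
theorem eq_zero_of_inner_test_eq_zero (g : H1 n)
    (hg : ∀ (φ : Euc n → ℝ) (h : IsTest φ), ⟪g, h.toH1⟫_ℝ = 0) : g = 0 := by
  -- A vector `g` orthogonal to all test functions is tested with the mollifications of `χ_N g`.
  -- Shrinking the bump gives `⟪χ_N g, g⟫ = 0`, and then `N → ∞` gives `‖g‖² = 0`; weak convergence
  -- suffices in both limits.
  have key : ∀ N, ⟪(isTest_cutoff n N).mulH1 g, g⟫_ℝ = 0 := by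
    intro N
    set f := (isTest_cutoff n N).mulH1 g with hf
    let F : Euc n → ℝ := fun x => cutoff n N x * g.toL2 x
    have hF : f.toL2 =ᵐ[volume] F := (isTest_cutoff n N).coeFn_mulL g.toL2
    have hFc : HasCompactSupport F := (isTest_cutoff n N).compact.mul_right
    have hloc : LocallyIntegrable F :=
      (((memLp_congr_ae hF).1 (Lp.memLp f.toL2))).locallyIntegrable (by norm_num)
    let G : Fin n → L2 n := fun i => (memLp_component f.grad i).toLp _
    have hG : ∀ i, G i =ᵐ[volume] fun x => (f.grad x) i := fun i =>
      (memLp_component f.grad i).coeFn_toLp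
    let g' : Fin n → L2 n := fun i => (memLp_component g.grad i).toLp _
    have hg' : ∀ i, g' i =ᵐ[volume] fun x => (g.grad x) i := fun i =>
      (memLp_component g.grad i).coeFn_toLp
    have h1 : ∀ k, (∫ x, g.toL2 x * mollify (shrinkingBump n k) f.toL2 x)
        + ∑ i, ∫ x, g' i x * mollify (shrinkingBump n k) (G i) x = 0 := by
      intro k
      have ht := isTest_mollify (shrinkingBump n k) hloc hFc
      have h2 := hg _ ht
      rw [inner_H1, IsTest.toL2_toH1, IsTest.inner_toL2, inner_grad_eq_sum] at h2
      rw [mollify_congr _ hF, ← h2]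
      congr 1
      refine Finset.sum_congr rfl fun i _ => integral_congr_ae ?_
      filter_upwards [hg' i] with x hx
      rw [hx, mollify_congr _ (hG i), partialDeriv_mollify _ f hF]
    have h3 := (tendsto_integral_mul_mollify g.toL2 f.toL2).add
      (tendsto_finsetSum Finset.univ fun i _ => tendsto_integral_mul_mollify (g' i) (G i))
    simp only [h1] at h3
    have h4 := tendsto_nhds_unique h3 tendsto_const_nhds
    rw [real_inner_comm, inner_H1, inner_L2Vec_eq_sum, ← h4]
    congr 1
    refine Finset.sum_congr rfl fun i _ => ?_
    rw [inner_L2]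
    refine integral_congr_ae ?_
    filter_upwards [hg' i, hG i] with x h5 h6
    rw [h5, h6]
  have h := tendsto_inner_mulH1_cutoff g g
  simp only [key] at h
  exact inner_self_eq_zero.1 (tendsto_nhds_unique h tendsto_const_nhds)

/-- The space of test functions in `H¹`. -/
def testSubmodule (n : ℕ) : Submodule ℝ (H1 n) :=
  Submodule.span ℝ {f | ∃ (φ : Euc n → ℝ) (h : IsTest φ), f = h.toH1}

theorem dense_testSubmodule : (testSubmodule n).topologicalClosure = ⊤ := by
  rw [Submodule.topologicalClosure_eq_top_iff, Submodule.eq_bot_iff]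
  intro g hg
  refine eq_zero_of_inner_test_eq_zero g fun φ h => ?_
  rw [real_inner_comm]
  exact (Submodule.mem_orthogonal _ _).1 hg _ (Submodule.subset_span ⟨φ, h, rfl⟩)

theorem IsTest.toL2_congr {φ : Euc n → ℝ} (h : IsTest φ) {f : L2 n} (hf : f =ᵐ[volume] φ) :
    f = h.toL2 := Lp.ext (hf.trans h.coeFn_toL2.symm)

theorem exists_isTest_of_mem {f : H1 n} (hf : f ∈ testSubmodule n) :
    ∃ (φ : Euc n → ℝ) (h : IsTest φ), f = h.toH1 := by
  induction hf using Submodule.span_induction with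
  | mem x hx => exact hx
  | zero =>
    refine ⟨_, IsTest.zero, toL2_injective ?_⟩
    exact IsTest.zero.toL2_congr (Lp.coeFn_zero _ _ _)
  | add x y _ _ hx hy =>
    obtain ⟨φ, h, rfl⟩ := hx
    obtain ⟨ψ, h', rfl⟩ := hy
    refine ⟨_, h.add h', toL2_injective ?_⟩
    refine (h.add h').toL2_congr ?_
    filter_upwards [Lp.coeFn_add h.toL2 h'.toL2, h.coeFn_toL2, h'.coeFn_toL2] with x h1 h2 h3
    refine h1.trans ?_
    rw [Pi.add_apply, h2, h3]
  | smul c x _ hx =>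
    obtain ⟨φ, h, rfl⟩ := hx
    refine ⟨_, h.const_mul c, toL2_injective ?_⟩
    refine (h.const_mul c).toL2_congr ?_
    filter_upwards [Lp.coeFn_smul c h.toL2, h.coeFn_toL2] with x h1 h2
    refine h1.trans ?_
    rw [Pi.smul_apply, h2, smul_eq_mul]

/-- A closed condition on `H¹` that holds for test functions holds everywhere. -/
theorem H1.induction_isTest {P : H1 n → Prop} (hP : IsClosed {f | P f})
    (h : ∀ (φ : Euc n → ℝ) (h : IsTest φ), P h.toH1) (f : H1 n) : P f := by
  have h1 : (testSubmodule n : Set (H1 n)) ⊆ {f | P f} := by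
    intro g hg
    obtain ⟨φ, hφ, rfl⟩ := exists_isTest_of_mem hg
    exact h φ hφ
  have h2 := hP.closure_subset_iff.2 h1
  have h3 : f ∈ (testSubmodule n).topologicalClosure := by
    rw [dense_testSubmodule]; trivial
  exact h2 h3

/-! ### The Sobolev inequality in dual form -/

/-- Pointwise `|h|^q ≤ |h| + |h|²` for `1 ≤ q ≤ 2`, which replaces interpolation; finally `2^{1/q} ≤
2`. -/
theorem eLpNorm_le_two_of_le_one {α : Type*} [MeasurableSpace α] {μ : Measure α} {h : α → ℝ}
    (hm : AEStronglyMeasurable h μ) (h1 : eLpNorm h 1 μ ≤ 1) (h2 : eLpNorm h 2 μ ≤ 1) {q : ℝ≥0}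
    (hq1 : 1 ≤ q) (hq2 : q ≤ 2) : eLpNorm h q μ ≤ 2 := by
  have hq0 : q ≠ 0 := by positivity
  have hqr1 : (1 : ℝ) ≤ q := by exact_mod_cast hq1
  have hqr2 : (q : ℝ) ≤ 2 := by exact_mod_cast hq2
  rw [eLpNorm_nnreal_eq_lintegral hq0]
  have hA : ∫⁻ x, ‖h x‖ₑ ^ (q : ℝ) ∂μ ≤ 2 := by
    have hpt : ∀ x, ‖h x‖ₑ ^ (q : ℝ) ≤ ‖h x‖ₑ + ‖h x‖ₑ ^ (2 : ℝ) := by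
      intro x
      rcases le_total ‖h x‖ₑ 1 with hx | hx
      · have := ENNReal.rpow_le_rpow_of_exponent_ge hx hqr1
        rw [ENNReal.rpow_one] at this
        exact this.trans le_self_add
      · exact (ENNReal.rpow_le_rpow_of_exponent_le hx hqr2).trans le_add_self
    have e1 : ∫⁻ x, ‖h x‖ₑ ∂μ ≤ 1 := by rwa [eLpNorm_one_eq_lintegral_enorm] at h1
    have e2 : ∫⁻ x, ‖h x‖ₑ ^ (2 : ℝ) ∂μ ≤ 1 := by
      have h3 : eLpNorm h ((2 : ℝ≥0) : ℝ≥0∞) μ ≤ 1 := h2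
      rw [eLpNorm_nnreal_eq_lintegral two_ne_zero] at h3
      have h4 := ENNReal.rpow_le_rpow h3 (zero_le_two : (0 : ℝ) ≤ 2)
      rw [← ENNReal.rpow_mul, ENNReal.one_rpow] at h4
      simpa using h4
    calc ∫⁻ x, ‖h x‖ₑ ^ (q : ℝ) ∂μ ≤ ∫⁻ x, (‖h x‖ₑ + ‖h x‖ₑ ^ (2 : ℝ)) ∂μ :=
          lintegral_mono hpt
      _ = (∫⁻ x, ‖h x‖ₑ ∂μ) + ∫⁻ x, ‖h x‖ₑ ^ (2 : ℝ) ∂μ :=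
          lintegral_add_left' hm.enorm _
      _ ≤ 1 + 1 := add_le_add e1 e2
      _ = 2 := one_add_one_eq_two
  calc (∫⁻ x, ‖h x‖ₑ ^ (q : ℝ) ∂μ) ^ (1 / (q : ℝ)) ≤ 2 ^ (1 / (q : ℝ)) :=
        ENNReal.rpow_le_rpow hA (by positivity)
    _ ≤ 2 ^ (1 : ℝ) := ENNReal.rpow_le_rpow_of_exponent_le one_le_two (by
        rw [div_le_one (by positivity)]; exact hqr1)
    _ = 2 := ENNReal.rpow_one _

/-- Sobolev: an `L¹ ∩ L²` function is a bounded functional for the homogeneous `H¹` norm. -/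
theorem exists_inner_le_norm_grad (hn : 3 ≤ n) : ∃ C : ℝ, 0 ≤ C ∧ ∀ (f : L2 n),
    MemLp f 1 volume → ∀ w : H1 n,
      |⟪f, w.toL2⟫_ℝ| ≤ C * (lpNorm f 1 volume + lpNorm f 2 volume) * ‖w.grad‖ := by
  let S : ℝ≥0 := SNormLESNormFDerivOfEqConst ℝ (volume : Measure (Euc n)) 2
  refine ⟨2 * S, by positivity, fun f hf1 w => ?_⟩
  set s := lpNorm f 1 volume + lpNorm f 2 volume with hs
  have hf2 : MemLp f 2 volume := Lp.memLp f
  have hn' : (3 : ℝ) ≤ n := by exact_mod_cast hn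
  refine H1.induction_isTest (P := fun w => |⟪f, w.toL2⟫_ℝ| ≤ 2 * S * s * ‖w.grad‖) ?_ ?_ w
  · exact isClosed_le (continuous_const.inner (toL2L n).continuous).abs
      (continuous_const.mul (gradL n).continuous.norm)
  · intro φ hφ
    have hs0 : 0 ≤ s := add_nonneg lpNorm_nonneg lpNorm_nonneg
    rcases hs0.eq_or_lt with h0 | hpos
    · have : lpNorm f 2 volume = 0 := by
        have h1 : 0 ≤ lpNorm f 1 volume := lpNorm_nonneg
        have h2 : 0 ≤ lpNorm f 2 volume := lpNorm_nonneg
        linarith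
      have hf0 : f = 0 := by
        rw [Lp.eq_zero_iff_ae_eq_zero]
        exact (lpNorm_eq_zero hf2 two_ne_zero).1 this
      rw [hf0, inner_zero_left, abs_zero]
      positivity
    -- Dividing by `s` makes both the `L¹` and the `L²` norm at most one, as the crude bound on the
    -- intermediate norm requires.
    · let h : Euc n → ℝ := fun x => s⁻¹ * f x
      have hm : AEStronglyMeasurable h volume := hf1.1.const_mul _
      have hnorm : ∀ p : ℝ≥0∞, MemLp f p volume → lpNorm f p volume ≤ s →
          eLpNorm h p volume ≤ 1 := by
        intro p hp hle
        have e : eLpNorm h p volume = ‖s⁻¹‖ₑ * eLpNorm f p volume :=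
          eLpNorm_const_smul s⁻¹ (f : Euc n → ℝ) p volume
        rw [e, ← ofReal_lpNorm hp, Real.enorm_eq_ofReal (by positivity),
          ← ENNReal.ofReal_mul (by positivity), ENNReal.ofReal_le_one, inv_mul_le_iff₀ hpos]
        linarith
      have hh1 := hnorm 1 hf1 (le_add_of_nonneg_right lpNorm_nonneg)
      have hh2 := hnorm 2 hf2 (le_add_of_nonneg_left lpNorm_nonneg)
      have hinv : (n : ℝ)⁻¹ ≤ 3⁻¹ := inv_anti₀ (by norm_num) hn'
      have hinv0 : 0 < (n : ℝ)⁻¹ := by positivity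
      -- `a` and `b` are the reciprocals of the Sobolev exponent `2n/(n-2)` and of its dual
      -- `2n/(n+2)`; `n ≥ 3` gives `a > 0` and `b ≤ 1`.
      let a : ℝ≥0 := ⟨2⁻¹ - (n : ℝ)⁻¹, by linarith⟩
      let b : ℝ≥0 := ⟨2⁻¹ + (n : ℝ)⁻¹, by positivity⟩
      have ha0 : a ≠ 0 := by
        intro h0
        have : (2⁻¹ - (n : ℝ)⁻¹ : ℝ) = 0 := congrArg NNReal.toReal h0
        linarith
      have hb0 : b ≠ 0 := by
        intro h0
        have : (2⁻¹ + (n : ℝ)⁻¹ : ℝ) = 0 := congrArg NNReal.toReal h0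
        linarith
      have hb1 : b ≤ 1 := by
        rw [← NNReal.coe_le_coe]
        change 2⁻¹ + (n : ℝ)⁻¹ ≤ 1
        linarith
      have hb2 : 2⁻¹ ≤ b := by
        rw [← NNReal.coe_le_coe, NNReal.coe_inv]
        change (2 : ℝ)⁻¹ ≤ 2⁻¹ + (n : ℝ)⁻¹
        linarith
      have hab : a + b = 1 := by
        refine NNReal.eq ?_
        change (2⁻¹ - (n : ℝ)⁻¹) + (2⁻¹ + (n : ℝ)⁻¹) = 1
        ring
      have hq : eLpNorm h ((b⁻¹ : ℝ≥0) : ℝ≥0∞) volume ≤ 2 := by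
        refine eLpNorm_le_two_of_le_one hm hh1 hh2 ((one_le_inv₀ (pos_of_ne_zero hb0)).2 hb1) ?_
        rw [inv_le_comm₀ (pos_of_ne_zero hb0) two_pos]
        exact hb2
      have hsob : eLpNorm φ ((a⁻¹ : ℝ≥0) : ℝ≥0∞) volume
          ≤ S * eLpNorm (fderiv ℝ φ) 2 volume := by
        refine eLpNorm_le_eLpNorm_fderiv_of_eq (volume : Measure (Euc n)) (p := 2)
          (hφ.smooth.of_le (by simp)) hφ.compact one_le_two (by simp; omega) ?_
        rw [NNReal.coe_inv, inv_inv, finrank_euclideanSpace, Fintype.card_fin]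
        rfl
      have hgrad : eLpNorm (fderiv ℝ φ) 2 volume = ENNReal.ofReal ‖hφ.toH1.grad‖ := by
        have e : eLpNorm (fderiv ℝ φ) 2 volume = eLpNorm (∇ φ) 2 volume :=
          eLpNorm_congr_norm_ae (Eventually.of_forall fun x => (norm_gradient φ x).symm)
        rw [e, ← Lp.enorm_toLp (hφ.memLp_gradient 2), ← ofReal_norm]
        rfl
      have hHT : ENNReal.HolderTriple ((b⁻¹ : ℝ≥0) : ℝ≥0∞) ((a⁻¹ : ℝ≥0) : ℝ≥0∞) 1 := by
        refine ⟨?_⟩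
        rw [ENNReal.coe_inv hb0, ENNReal.coe_inv ha0, inv_inv, inv_inv, inv_one, add_comm]
        exact_mod_cast hab
      have hH : eLpNorm (h • φ) 1 volume ≤ eLpNorm h ((b⁻¹ : ℝ≥0) : ℝ≥0∞) volume
          * eLpNorm φ ((a⁻¹ : ℝ≥0) : ℝ≥0∞) volume :=
        eLpNorm_smul_le_mul_eLpNorm hφ.continuous.aestronglyMeasurable hm
      have hfin : eLpNorm (h • φ) 1 volume ≤ ENNReal.ofReal (2 * S * ‖hφ.toH1.grad‖) := by
        refine hH.trans ((mul_le_mul' hq (hsob.trans_eq (by rw [hgrad]))).trans_eq ?_)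
        rw [mul_assoc, ENNReal.ofReal_mul zero_le_two, ENNReal.ofReal_mul NNReal.zero_le_coe,
          ENNReal.ofReal_coe_nnreal]
        simp
      have hint : |∫ x, h x * φ x| ≤ 2 * S * ‖hφ.toH1.grad‖ := by
        rw [← Real.norm_eq_abs]
        have h1 : ‖∫ x, h x * φ x‖ₑ ≤ eLpNorm (h • φ) 1 volume := by
          rw [eLpNorm_one_eq_lintegral_enorm]
          exact enorm_integral_le_lintegral_enorm _
        have h2 := h1.trans hfin
        rw [← ofReal_norm] at h2
        exact (ENNReal.ofReal_le_ofReal_iff (by positivity)).1 h2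
      have heq : ⟪f, hφ.toH1.toL2⟫_ℝ = s * ∫ x, h x * φ x := by
        rw [IsTest.toL2_toH1, IsTest.inner_toL2, ← integral_const_mul]
        refine integral_congr_ae (Eventually.of_forall fun x => ?_)
        simp only [h]
        field_simp
      rw [heq, abs_mul, abs_of_pos hpos]
      calc s * |∫ x, h x * φ x| ≤ s * (2 * S * ‖hφ.toH1.grad‖) := by gcongr
        _ = _ := by ring

/-! ### Space-time test functions as curves in `L²` -/

/-- A quadratic remainder is `o(|r - t|)`. This turns the Taylor bounds that survived the weak limit
back into derivatives. -/
theorem hasDerivWithinAt_of_norm_le_sq {F : Type*} [NormedAddCommGroup F] [NormedSpace ℝ F]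
    {f : ℝ → F} {f' : F} {C t : ℝ} {s : Set ℝ}
    (h : ∀ r ∈ s, ‖f r - f t - (r - t) • f'‖ ≤ C * |r - t| ^ 2) : HasDerivWithinAt f f' s t := by
  rw [hasDerivWithinAt_iff_isLittleO]
  have h1 : (fun r => f r - f t - (r - t) • f') =O[𝓝[s] t] fun r => ‖r - t‖ ^ 2 := by
    refine Asymptotics.IsBigO.of_bound C ?_
    filter_upwards [self_mem_nhdsWithin] with r hr
    simpa using h r hr
  exact h1.trans_isLittleO
    ((Asymptotics.isLittleO_pow_sub_sub t one_lt_two).mono nhdsWithin_le_nhds)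

/-- Smooth compactly supported functions on space-time. -/
structure IsSTTest (Ψ : ℝ × Euc n → ℝ) : Prop where
  smooth : ContDiff ℝ ∞ Ψ
  compact : HasCompactSupport Ψ

/-- Directional derivative in space-time. -/
def dirDeriv (w : ℝ × Euc n) (Ψ : ℝ × Euc n → ℝ) (p : ℝ × Euc n) : ℝ := fderiv ℝ Ψ p w

/-- Time derivative. -/
def timeDeriv (Ψ : ℝ × Euc n → ℝ) : ℝ × Euc n → ℝ := dirDeriv (1, 0) Ψ

/-- Laplacian in the space variables. -/
def spaceLaplacian (Ψ : ℝ × Euc n → ℝ) (p : ℝ × Euc n) : ℝ :=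
  ∑ i : Fin n, dirDeriv (0, EuclideanSpace.single i 1)
    (dirDeriv (0, EuclideanSpace.single i 1) Ψ) p

namespace IsSTTest

variable {Ψ Ψ' : ℝ × Euc n → ℝ}

theorem differentiable (h : IsSTTest Ψ) : Differentiable ℝ Ψ := h.smooth.differentiable (by simp)

theorem dirDeriv (h : IsSTTest Ψ) (w : ℝ × Euc n) : IsSTTest (dirDeriv w Ψ) :=
  ⟨(h.smooth.fderiv_right (m := ∞) (by simp)).clm_apply contDiff_const,
    h.compact.fderiv_apply (𝕜 := ℝ) _⟩

theorem timeDeriv (h : IsSTTest Ψ) : IsSTTest (timeDeriv Ψ) := h.dirDeriv _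

theorem zero : IsSTTest (fun _ : ℝ × Euc n => (0 : ℝ)) := ⟨contDiff_const, HasCompactSupport.zero⟩

theorem add (h : IsSTTest Ψ) (h' : IsSTTest Ψ') : IsSTTest (fun x => Ψ x + Ψ' x) :=
  ⟨h.smooth.add h'.smooth, h.compact.add h'.compact⟩

theorem sum {ι : Type*} (s : Finset ι) {Ψ : ι → ℝ × Euc n → ℝ} (h : ∀ i, IsSTTest (Ψ i)) :
    IsSTTest (fun x => ∑ i ∈ s, Ψ i x) := by
  classical
  induction s using Finset.induction_on with
  | empty => simpa using zero
  | insert i s hi ih =>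
    simp only [Finset.sum_insert hi]
    exact (h i).add ih

theorem spaceLaplacian (h : IsSTTest Ψ) : IsSTTest (spaceLaplacian Ψ) :=
  IsSTTest.sum _ fun _ => (h.dirDeriv _).dirDeriv _

theorem dirDeriv_comm (h : IsSTTest Ψ) (v w : ℝ × Euc n) :
    DampedWave.dirDeriv v (DampedWave.dirDeriv w Ψ)
      = DampedWave.dirDeriv w (DampedWave.dirDeriv v Ψ) := by
  have hd : Differentiable ℝ (fderiv ℝ Ψ) :=
    (h.smooth.fderiv_right (m := ∞) (by simp)).differentiable (by simp)
  have e : ∀ v w p, DampedWave.dirDeriv v (DampedWave.dirDeriv w Ψ) p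
      = fderiv ℝ (fderiv ℝ Ψ) p v w := by
    intro v w p
    unfold DampedWave.dirDeriv
    rw [fderiv_clm_apply (hd p) (differentiableAt_const _)]
    simp
  funext p
  rw [e, e]
  exact (h.smooth.contDiffAt.isSymmSndFDerivAt (by
    simp only [minSmoothness_of_isRCLikeNormedField]; exact WithTop.coe_le_coe.2 le_top)).eq v w

/-- Symmetry of second derivatives. It is needed because the integrated equation is tested with
`φ_t`, which produces `Δφ_t` where `(Δφ)_t` is wanted. -/
theorem timeDeriv_spaceLaplacian (h : IsSTTest Ψ) :
    DampedWave.timeDeriv (DampedWave.spaceLaplacian Ψ)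
      = DampedWave.spaceLaplacian (DampedWave.timeDeriv Ψ) := by
  funext p
  have h1 : DampedWave.timeDeriv (DampedWave.spaceLaplacian Ψ) p
      = ∑ i : Fin n, DampedWave.dirDeriv (1, 0) (DampedWave.dirDeriv (0, EuclideanSpace.single i 1)
        (DampedWave.dirDeriv (0, EuclideanSpace.single i 1) Ψ)) p := by
    have h2 : HasFDerivAt (DampedWave.spaceLaplacian Ψ) (∑ i : Fin n, fderiv ℝ
        (DampedWave.dirDeriv (0, EuclideanSpace.single i 1)
        (DampedWave.dirDeriv (0, EuclideanSpace.single i 1) Ψ)) p) p :=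
      HasFDerivAt.fun_sum fun i _ => (((h.dirDeriv _).dirDeriv _).differentiable p).hasFDerivAt
    change fderiv ℝ (DampedWave.spaceLaplacian Ψ) p (1, 0) = _
    rw [h2.fderiv, sum_apply]
    rfl
  rw [h1]
  unfold DampedWave.spaceLaplacian DampedWave.timeDeriv
  refine Finset.sum_congr rfl fun i _ => ?_
  rw [(h.dirDeriv _).dirDeriv_comm, h.dirDeriv_comm]

theorem slice (h : IsSTTest Ψ) (t : ℝ) : IsTest (fun x => Ψ (t, x)) :=
  ⟨h.smooth.comp (contDiff_prodMk_right t), by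
    refine HasCompactSupport.intro (h.compact.image continuous_snd) fun x hx => ?_
    by_contra hne
    exact hx ⟨(t, x), subset_tsupport _ hne, rfl⟩⟩

theorem hasDerivAt_time (h : IsSTTest Ψ) (t : ℝ) (x : Euc n) :
    HasDerivAt (fun s => Ψ (s, x)) (DampedWave.timeDeriv Ψ (t, x)) t := by
  have h1 : HasDerivAt (fun s : ℝ => (s, x)) ((1 : ℝ), (0 : Euc n)) t :=
    (hasDerivAt_id t).prodMk (hasDerivAt_const t x)
  exact (h.differentiable (t, x)).hasFDerivAt.comp_hasDerivAt t h1

theorem partialDeriv_slice (h : IsSTTest Ψ) (t : ℝ) (x : Euc n) (i : Fin n) :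
    partialDeriv i (fun x => Ψ (t, x)) x
      = DampedWave.dirDeriv (0, EuclideanSpace.single i 1) Ψ (t, x) := by
  have h1 : HasFDerivAt (fun x => Ψ (t, x)) _ x :=
    (h.differentiable (t, x)).hasFDerivAt.comp x (hasFDerivAt_prodMk_right t x)
  unfold partialDeriv
  rw [h1.fderiv]
  simp [DampedWave.dirDeriv]

theorem laplacian_slice (h : IsSTTest Ψ) (t : ℝ) (x : Euc n) :
    Laplacian.laplacian (fun x => Ψ (t, x)) x = DampedWave.spaceLaplacian Ψ (t, x) := by
  rw [laplacian_eq_sum (h.slice t)]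
  refine Finset.sum_congr rfl fun i _ => ?_
  rw [← (h.dirDeriv _).partialDeriv_slice]
  congr 1
  funext x
  exact h.partialDeriv_slice t x i

/-- A space-time test function as a curve in `L²`. -/
def curve (h : IsSTTest Ψ) (t : ℝ) : L2 n := (h.slice t).toL2

/-- The radius `N + 1` matches the ball on which `cutoff n N` equals one, so a single cutoff serves
all times. -/
theorem exists_radius (h : IsSTTest Ψ) : ∃ N : ℕ, ∀ t x, (N : ℝ) + 1 < |t| ∨ (N : ℝ) + 1 < ‖x‖ →
    Ψ (t, x) = 0 := by
  obtain ⟨R, hR⟩ := h.compact.isCompact.isBounded.subset_closedBall 0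
  obtain ⟨N, hN⟩ := exists_nat_ge R
  refine ⟨N, fun t x htx => ?_⟩
  by_contra hne
  have h1 : ‖((t, x) : ℝ × Euc n)‖ ≤ R := by simpa using hR (subset_tsupport _ hne)
  rw [Prod.norm_mk, max_le_iff, Real.norm_eq_abs] at h1
  rcases htx with h2 | h2 <;> linarith [h1.1, h1.2]

theorem cutoff_eq_one {N : ℕ} {x : Euc n} (hx : ‖x‖ ≤ (N : ℝ) + 1) : cutoff n N x = 1 := by
  refine (cutoffBump n).one_of_mem_closedBall ?_
  rw [mem_closedBall_zero_iff, norm_smul, norm_inv, Real.norm_eq_abs,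
    abs_of_pos (by positivity : (0 : ℝ) < (N : ℝ) + 1), inv_mul_le_iff₀ (by positivity)]
  simpa [cutoffBump] using hx

theorem exists_bound (h : IsSTTest Ψ) : ∃ C, 0 ≤ C ∧ ∀ p, ‖Ψ p‖ ≤ C := by
  obtain ⟨C, hC⟩ := h.compact.exists_bound_of_continuous h.smooth.continuous
  exact ⟨C, (norm_nonneg _).trans (hC 0), hC⟩

theorem exists_lipschitz_time (h : IsSTTest Ψ) : ∃ C, ∀ x s t,
    |Ψ (s, x) - Ψ (t, x)| ≤ C * |s - t| := by
  obtain ⟨C, -, hC⟩ := h.timeDeriv.exists_bound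
  refine ⟨C, fun x s t => ?_⟩
  exact Convex.norm_image_sub_le_of_norm_hasDerivWithin_le
    (fun r _ => (h.hasDerivAt_time r x).hasDerivWithinAt) (fun r _ => hC (r, x)) convex_univ
    (mem_univ t) (mem_univ s)

theorem exists_taylor_time (h : IsSTTest Ψ) : ∃ C, ∀ x s t,
    |Ψ (s, x) - Ψ (t, x) - (s - t) * DampedWave.timeDeriv Ψ (t, x)| ≤ C * |s - t| ^ 2 := by
  obtain ⟨C, hC⟩ := h.timeDeriv.exists_lipschitz_time
  refine ⟨C, fun x s t => ?_⟩
  -- The Taylor bound assumes nonnegative times, hence the shift by `min s t`.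
  have h1 := norm_image_sub_sub_smul_le (f := fun r => Ψ (r + min s t, x))
    (g := fun r => DampedWave.timeDeriv Ψ (r + min s t, x)) (C := C)
    (fun r => (h.hasDerivAt_time (r + min s t) x).comp_add_const r (min s t))
    (fun r _ r' _ => by simpa using hC x (r + min s t) (r' + min s t))
    (s := s - min s t) (t := t - min s t) (by simp) (by simp)
  simpa using h1

/-- Pointwise bounds uniform in `x` become `L²` bounds through a cutoff equal to one on all spatial
supports of `Ψ` and `Ψ_t`; its `L²` norm enters the constant. -/
theorem norm_curve_le (h : IsSTTest Ψ) : ∃ C, ∀ (s t : ℝ),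
    ‖h.curve s - h.curve t‖ ≤ C * |s - t| ∧
    ‖h.curve s - h.curve t - (s - t) • h.timeDeriv.curve t‖ ≤ C * |s - t| ^ 2 := by
  obtain ⟨N, hN⟩ := h.exists_radius
  obtain ⟨N', hN'⟩ := h.timeDeriv.exists_radius
  obtain ⟨C₁, hC₁⟩ := h.exists_lipschitz_time
  obtain ⟨C₂, hC₂⟩ := h.exists_taylor_time
  set M := max N N' with hM
  set c := ‖(isTest_cutoff n M).toL2‖ with hc
  have hC₁0 : 0 ≤ C₁ := by
    have := hC₁ 0 1 0
    simp at this
    exact (abs_nonneg _).trans this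
  have hC₂0 : 0 ≤ C₂ := by
    have := hC₂ 0 1 0
    simp at this
    exact (abs_nonneg _).trans this
  have hbig : ∀ x : Euc n, ¬ ‖x‖ ≤ (M : ℝ) + 1 → ∀ t, Ψ (t, x) = 0 ∧
      DampedWave.timeDeriv Ψ (t, x) = 0 := by
    intro x hx t
    have h1 : (N : ℝ) ≤ M := by exact_mod_cast le_max_left N N'
    have h2 : (N' : ℝ) ≤ M := by exact_mod_cast le_max_right N N'
    push Not at hx
    exact ⟨hN t x (Or.inr (by linarith)), hN' t x (Or.inr (by linarith))⟩
  refine ⟨C₁ * c + C₂ * c, fun s t => ⟨?_, ?_⟩⟩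
  · have h1 : ‖h.curve s - h.curve t‖ ≤ C₁ * |s - t| * c := by
      refine Lp.norm_le_mul_norm_of_ae_le_mul ?_
      filter_upwards [Lp.coeFn_sub (h.curve s) (h.curve t), (h.slice s).coeFn_toL2,
        (h.slice t).coeFn_toL2, (isTest_cutoff n M).coeFn_toL2] with x h1 h2 h3 h4
      rw [h1, Pi.sub_apply, h4]
      unfold curve
      rw [h2, h3]
      by_cases hx : ‖x‖ ≤ (M : ℝ) + 1
      · rw [cutoff_eq_one hx, norm_one, mul_one]
        exact hC₁ x s t
      · rw [(hbig x hx s).1, (hbig x hx t).1, sub_zero, norm_zero]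
        positivity
    refine h1.trans ?_
    have : 0 ≤ C₂ * c * |s - t| := by positivity
    linarith
  · have h1 : ‖h.curve s - h.curve t - (s - t) • h.timeDeriv.curve t‖ ≤ C₂ * |s - t| ^ 2 * c := by
      refine Lp.norm_le_mul_norm_of_ae_le_mul ?_
      filter_upwards [Lp.coeFn_sub (h.curve s - h.curve t) ((s - t) • h.timeDeriv.curve t),
        Lp.coeFn_smul (s - t) (h.timeDeriv.curve t),
        Lp.coeFn_sub (h.curve s) (h.curve t), (h.slice s).coeFn_toL2,
        (h.slice t).coeFn_toL2, (h.timeDeriv.slice t).coeFn_toL2,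
        (isTest_cutoff n M).coeFn_toL2] with x h5 h6 h1 h2 h3 h7 h4
      rw [h5, Pi.sub_apply, h1, Pi.sub_apply, h6, Pi.smul_apply, h4]
      unfold curve
      rw [h2, h3, h7, smul_eq_mul]
      by_cases hx : ‖x‖ ≤ (M : ℝ) + 1
      · rw [cutoff_eq_one hx, norm_one, mul_one]
        exact hC₂ x s t
      · rw [(hbig x hx s).1, (hbig x hx t).1, (hbig x hx t).2, sub_zero, mul_zero, sub_zero,
          norm_zero]
        positivity
    refine h1.trans ?_
    have : 0 ≤ C₁ * c * |s - t| ^ 2 := by positivity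
    linarith

theorem hasDerivAt_curve (h : IsSTTest Ψ) (t : ℝ) :
    HasDerivAt h.curve (h.timeDeriv.curve t) t := by
  obtain ⟨C, hC⟩ := h.norm_curve_le
  rw [← hasDerivWithinAt_univ]
  exact hasDerivWithinAt_of_norm_le_sq (C := C) fun r _ => (hC r t).2

theorem continuous_curve (h : IsSTTest Ψ) : Continuous h.curve :=
  continuous_iff_continuousAt.2 fun t => (h.hasDerivAt_curve t).continuousAt

theorem curve_eq_zero (h : IsSTTest Ψ) : ∃ T : ℝ, 0 < T ∧ ∀ t, T < |t| → h.curve t = 0 := by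
  obtain ⟨N, hN⟩ := h.exists_radius
  refine ⟨N + 1, by positivity, fun t ht => ?_⟩
  rw [Lp.eq_zero_iff_ae_eq_zero]
  filter_upwards [(h.slice t).coeFn_toL2] with x hx
  exact hx.trans (hN t x (Or.inl ht))

/-- A continuous coefficient acts on the curve of a space-time test function as a bounded
operator. -/
theorem exists_mul_curve {a : Euc n → ℝ} (ha : Continuous a) (h : IsSTTest Ψ) :
    ∃ B : L2 n →L[ℝ] L2 n, ∀ t, B (h.curve t) =ᵐ[volume] fun x => a x * Ψ (t, x) := by
  obtain ⟨N, hN⟩ := h.exists_radius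
  -- On the spatial supports `a` and `a χ_N` agree, and the latter is bounded even if `a` is not.
  refine ⟨mulOp (χ := fun x => a x * cutoff n N x) (ContinuousLinearMap.mul ℝ ℝ)
    (ha.mul (isTest_cutoff n N).continuous) (isTest_cutoff n N).compact.mul_left, fun t => ?_⟩
  filter_upwards [coeFn_mulOp (χ := fun x => a x * cutoff n N x) (ContinuousLinearMap.mul ℝ ℝ)
    (ha.mul (isTest_cutoff n N).continuous) (isTest_cutoff n N).compact.mul_left (h.curve t),
    (h.slice t).coeFn_toL2] with x h1 h2
  rw [h1]
  unfold curve
  rw [h2, ContinuousLinearMap.mul_apply']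
  by_cases hx : ‖x‖ ≤ (N : ℝ) + 1
  · rw [cutoff_eq_one hx, mul_one]
  · push Not at hx
    rw [hN t x (Or.inr hx), mul_zero, mul_zero]

theorem memLp_mul_slice {a : Euc n → ℝ} (ha : Continuous a) (h : IsSTTest Ψ) (t : ℝ) :
    MemLp (fun x => a x * Ψ (t, x)) 2 volume :=
  (ha.mul (h.slice t).continuous).memLp_of_hasCompactSupport (h.slice t).compact.mul_left

/-- The curve `φ_tt - Δφ - a φ_t` in `L²`. -/
def waveCurve {a : Euc n → ℝ} (ha : Continuous a) (h : IsSTTest Ψ) (t : ℝ) : L2 n :=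
  h.timeDeriv.timeDeriv.curve t - h.spaceLaplacian.curve t
    - (memLp_mul_slice ha h.timeDeriv t).toLp _

theorem continuous_waveCurve {a : Euc n → ℝ} (ha : Continuous a) (h : IsSTTest Ψ) :
    Continuous (h.waveCurve ha) := by
  obtain ⟨B, hB⟩ := h.timeDeriv.exists_mul_curve ha
  have e : h.waveCurve ha = fun t => h.timeDeriv.timeDeriv.curve t - h.spaceLaplacian.curve t
      - B (h.timeDeriv.curve t) := by
    funext t
    unfold waveCurve
    congr 1
    exact Lp.ext ((memLp_mul_slice ha h.timeDeriv t).coeFn_toLp.trans (hB t).symm)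
  rw [e]
  exact (h.timeDeriv.timeDeriv.continuous_curve.sub h.spaceLaplacian.continuous_curve).sub
    (B.continuous.comp h.timeDeriv.continuous_curve)

theorem waveCurve_eq_zero {a : Euc n → ℝ} (ha : Continuous a) (h : IsSTTest Ψ) :
    ∃ T : ℝ, 0 < T ∧ ∀ t, T < |t| → h.waveCurve ha t = 0 := by
  obtain ⟨N₁, h1⟩ := h.timeDeriv.timeDeriv.curve_eq_zero
  obtain ⟨N₂, h2⟩ := h.spaceLaplacian.curve_eq_zero
  obtain ⟨N₃, h3⟩ := h.timeDeriv.exists_radius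
  refine ⟨max (max N₁ N₂) (N₃ + 1), by positivity, fun t ht => ?_⟩
  rw [max_lt_iff, max_lt_iff] at ht
  unfold waveCurve
  rw [h1.2 t ht.1.1, h2.2 t ht.1.2, sub_zero, zero_sub, neg_eq_zero, Lp.eq_zero_iff_ae_eq_zero]
  filter_upwards [(memLp_mul_slice ha h.timeDeriv t).coeFn_toLp] with x hx
  rw [hx, h3 t x (Or.inl ht.2), mul_zero]
  rfl

theorem inner_waveCurve {a : Euc n → ℝ} (ha : Continuous a) {φ : ℝ → Euc n → ℝ}
    (h : IsSTTest (Function.uncurry φ)) (f : L2 n) (t : ℝ) :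
    ∫ x, f x * (iteratedDeriv 2 (fun s => φ s x) t - Laplacian.laplacian (φ t) x
          - a x * deriv (fun s => φ s x) t) = ⟪f, h.waveCurve ha t⟫_ℝ := by
  rw [inner_L2]
  refine integral_congr_ae ?_
  filter_upwards [Lp.coeFn_sub (h.timeDeriv.timeDeriv.curve t - h.spaceLaplacian.curve t)
    ((memLp_mul_slice ha h.timeDeriv t).toLp _),
    Lp.coeFn_sub (h.timeDeriv.timeDeriv.curve t) (h.spaceLaplacian.curve t),
    (memLp_mul_slice ha h.timeDeriv t).coeFn_toLp,
    (h.timeDeriv.timeDeriv.slice t).coeFn_toL2,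
    (h.spaceLaplacian.slice t).coeFn_toL2] with x h1 h2 h3 h4 h5
  have e1 : deriv (fun s => φ s x) = fun t => DampedWave.timeDeriv (Function.uncurry φ) (t, x) :=
    funext fun t => (h.hasDerivAt_time t x).deriv
  have e2 : iteratedDeriv 2 (fun s => φ s x) t
      = DampedWave.timeDeriv (DampedWave.timeDeriv (Function.uncurry φ)) (t, x) := by
    rw [iteratedDeriv_succ, iteratedDeriv_one, e1]
    exact (h.timeDeriv.hasDerivAt_time t x).deriv
  have e3 : Laplacian.laplacian (φ t) x = DampedWave.spaceLaplacian (Function.uncurry φ) (t, x) :=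
    h.laplacian_slice t x
  unfold waveCurve
  rw [h1, Pi.sub_apply, h2, Pi.sub_apply, h3]
  unfold curve
  rw [h4, h5, e1, e2, e3]

end IsSTTest

/-! ### The damping operator and the limit solution on `ℝⁿ` -/

/-- The functions `f ∈ H¹` with `a f ∈ L²`. -/
def dampingDomain (a : Euc n → ℝ) : Submodule ℝ (H1 n) where
  carrier := {f | MemLp (fun x => a x * f.toL2 x) 2 volume}
  zero_mem' := by
    refine (memLp_congr_ae ?_).2 (MemLp.zero (α := Euc n) (ε := ℝ))
    filter_upwards [Lp.coeFn_zero ℝ 2 (volume : Measure (Euc n))] with x hx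
    change a x * (0 : L2 n) x = 0
    rw [hx, Pi.zero_apply, mul_zero]
  add_mem' := by
    intro f g hf hg
    refine (memLp_congr_ae ?_).2 (MemLp.add hf hg)
    filter_upwards [Lp.coeFn_add f.toL2 g.toL2] with x hx
    change a x * (f.toL2 + g.toL2 : L2 n) x = _
    rw [hx, Pi.add_apply, Pi.add_apply, mul_add]
  smul_mem' := by
    intro c f hf
    refine (memLp_congr_ae ?_).2 (MemLp.const_smul hf c)
    filter_upwards [Lp.coeFn_smul c f.toL2] with x hx
    change a x * (c • f.toL2 : L2 n) x = _
    rw [hx, Pi.smul_apply, Pi.smul_apply, smul_eq_mul, smul_eq_mul]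
    ring

/-- Multiplication by `a` on its domain. -/
def dampingMap (a : Euc n → ℝ) : dampingDomain a →ₗ[ℝ] L2 n where
  toFun f := MemLp.toLp (fun x => a x * f.1.toL2 x) f.2
  map_add' f g := by
    refine Lp.ext ?_
    filter_upwards [MemLp.coeFn_toLp (f + g).2, MemLp.coeFn_toLp f.2, MemLp.coeFn_toLp g.2,
      Lp.coeFn_add (MemLp.toLp _ f.2) (MemLp.toLp _ g.2), Lp.coeFn_add f.1.toL2 g.1.toL2]
      with x h1 h2 h3 h4 h5
    rw [h1, h4, Pi.add_apply, h2, h3]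
    change a x * (f.1.toL2 + g.1.toL2 : L2 n) x = _
    rw [h5, Pi.add_apply, mul_add]
  map_smul' c f := by
    refine Lp.ext ?_
    filter_upwards [MemLp.coeFn_toLp (c • f).2, MemLp.coeFn_toLp f.2,
      Lp.coeFn_smul c (MemLp.toLp _ f.2), Lp.coeFn_smul c f.1.toL2] with x h1 h2 h3 h4
    rw [RingHom.id_apply, h1, h3, Pi.smul_apply, h2]
    change a x * (c • f.1.toL2 : L2 n) x = _
    rw [h4, Pi.smul_apply, smul_eq_mul, smul_eq_mul]
    ring

theorem coeFn_dampingMap (a : Euc n → ℝ) (f : dampingDomain a) :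
    dampingMap a f =ᵐ[volume] fun x => a x * f.1.toL2 x := MemLp.coeFn_toLp f.2

theorem inner_dampingMap (a : Euc n → ℝ) (f : dampingDomain a) (g : L2 n) :
    ⟪dampingMap a f, g⟫_ℝ = ∫ x, a x * (f.1.toL2 x * g x) := by
  rw [inner_L2]
  refine integral_congr_ae ?_
  filter_upwards [coeFn_dampingMap a f] with x hx
  rw [hx, mul_assoc]

theorem integrable_damping (a : Euc n → ℝ) (f : dampingDomain a) (g : L2 n) :
    Integrable fun x => a x * (f.1.toL2 x * g x) := by
  have := MemLp.integrable_mul f.2 (Lp.memLp g)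
  refine this.congr (Eventually.of_forall fun x => ?_)
  simp only [Pi.mul_apply]
  ring

theorem IsTest.memLp_mul {ψ : Euc n → ℝ} (h : IsTest ψ) {a : Euc n → ℝ} (ha : Continuous a) :
    MemLp (fun x => a x * ψ x) 2 volume :=
  (ha.mul h.continuous).memLp_of_hasCompactSupport h.compact.mul_left

theorem IsTest.toH1_mem_dampingDomain {ψ : Euc n → ℝ} (h : IsTest ψ) {a : Euc n → ℝ}
    (ha : Continuous a) : h.toH1 ∈ dampingDomain a := by
  refine (memLp_congr_ae ?_).2 (h.memLp_mul ha)
  filter_upwards [h.coeFn_toL2] with x hx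
  change a x * h.toL2 x = _
  rw [hx]

/-- The pointwise in time weak limit of the Galerkin approximations: `v` is the time primitive of
`u`, `p` its time derivative and `g` its gradient. -/
theorem exists_weak_limit_solution {V₀ : ℝ} (hV₀ : 0 < V₀) {a : Euc n → ℝ} (ha : Continuous a)
    (haV : ∀ x, V₀ ≤ a x) (u₀ : H1 n) (u₁ au₀ : L2 n) (hu₀ : MemLp (fun x => a x * u₀.toL2 x) 2 volume)
    (hau₀ : au₀ = hu₀.toLp _) {K : ℝ}
    (hK : ∀ w : H1 n, ⟪u₁ + au₀, w.toL2⟫_ℝ ≤ K * ‖w.grad‖) {R : ℝ}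
    (hR : decayConst V₀ * (‖u₀.toL2‖ ^ 2 + ‖u₀.grad‖ ^ 2 + ⟪au₀, u₀.toL2⟫_ℝ + ‖u₁‖ ^ 2 + K ^ 2) ≤ R) :
    ∃ (v u p : ℝ → L2 n) (g : ℝ → L2Vec n) (C : ℝ), v 0 = 0 ∧ u 0 = u₀.toL2 ∧
      (∀ t, 0 ≤ t → ‖u t‖ ^ 2 ≤ 2 / V₀ * R * (1 + t)⁻¹ ∧
        ‖p t‖ ^ 2 ≤ 2 * R * ((1 + t) ^ 2)⁻¹ ∧ ‖g t‖ ^ 2 ≤ 2 * R * ((1 + t) ^ 2)⁻¹) ∧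
      (∀ s, 0 ≤ s → ∀ t, 0 ≤ t → ‖u s - u t‖ ≤ C * |s - t|) ∧
      (∀ s, 0 ≤ s → ∀ t, 0 ≤ t → ‖v s - v t - (s - t) • u t‖ ≤ C * |s - t| ^ 2) ∧
      (∀ (ψ : Euc n → ℝ) (h : IsTest ψ), ∃ C' : ℝ, ∀ s, 0 ≤ s → ∀ t, 0 ≤ t →
        ‖⟪u s - u t - (s - t) • p t, h.toL2⟫_ℝ‖ ≤ C' * |s - t| ^ 2) ∧
      (∀ t, 0 ≤ t → IsWeakGradient (u t) (g t)) ∧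
      (∀ (ψ : Euc n → ℝ) (h : IsTest ψ), ∀ t, 0 ≤ t →
        ⟪p t, h.toL2⟫_ℝ - ⟪v t, h.laplacian.toL2⟫_ℝ + ⟪u t, (h.memLp_mul ha).toLp _⟫_ℝ
          = ⟪u₁ + au₀, h.toL2⟫_ℝ) := by
  -- The abstract result asks for operators on a subspace of `L²`. Injectivity of `H¹ → L²`
  -- transports the gradient and the damping there.
  let W : Submodule ℝ (L2 n) := (dampingDomain a).map (toL2L n).toLinearMap
  let e : dampingDomain a ≃ₗ[ℝ] W :=
    Submodule.equivMapOfInjective (toL2L n).toLinearMap toL2_injective (dampingDomain a)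
  have he : ∀ f : dampingDomain a, (e f : L2 n) = f.1.toL2 := fun f => rfl
  have he' : ∀ w : W, (e.symm w).1.toL2 = (w : L2 n) := fun w => by
    rw [← he, LinearEquiv.apply_symm_apply]
  let D : W →ₗ[ℝ] L2Vec n :=
    ((gradL n).toLinearMap.comp (dampingDomain a).subtype).comp e.symm.toLinearMap
  let M : W →ₗ[ℝ] L2 n := (dampingMap a).comp e.symm.toLinearMap
  have hD : ∀ w : W, D w = (e.symm w).1.grad := fun w => rfl
  have hMi : ∀ (x : W) (y : L2 n), ⟪M x, y⟫_ℝ = ∫ z, a z * ((x : L2 n) z * y z) := by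
    intro x y
    have := inner_dampingMap a (e.symm x) y
    rwa [he'] at this
  have hsymm : ∀ x y : W, ⟪M x, (y : L2 n)⟫_ℝ = ⟪(x : L2 n), M y⟫_ℝ := by
    intro x y
    rw [real_inner_comm (M y), hMi, hMi]
    simp only [mul_comm ((x : L2 n) _)]
  have hpos : ∀ x : W, V₀ * ‖x‖ ^ 2 ≤ ⟪M x, (x : L2 n)⟫_ℝ := by
    intro x
    have h1 : ‖x‖ ^ 2 = ∫ z, (x : L2 n) z * (x : L2 n) z := by
      rw [← inner_L2, real_inner_self_eq_norm_sq]
      rfl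
    rw [h1, hMi, ← integral_const_mul]
    refine integral_mono (((Lp.memLp (x : L2 n)).integrable_mul (Lp.memLp (x : L2 n))).const_mul _)
      ?_ fun z => ?_
    · have := integrable_damping a (e.symm x) (x : L2 n)
      rwa [he'] at this
    · exact mul_le_mul_of_nonneg_right (haV z) (mul_self_nonneg _)
  let x₀ : W := e ⟨u₀, hu₀⟩
  have hx₀ : e.symm x₀ = ⟨u₀, hu₀⟩ := e.symm_apply_apply _
  have hMx₀ : M x₀ = au₀ := by
    rw [hau₀]
    change dampingMap a (e.symm x₀) = _
    rw [hx₀]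
    rfl
  have hDx₀ : D x₀ = u₀.grad := by rw [hD, hx₀]
  have hx₀' : (x₀ : L2 n) = u₀.toL2 := rfl
  obtain ⟨v, u, p, g, C, hv0, hu0, hb, hL, hT, hw, hcl, heq⟩ :=
    exists_abstract_solution D M hV₀ hsymm hpos x₀ u₁ (K := K) (R := R)
      (fun w => by
        rw [hMx₀, hD, ← he' w]
        exact hK _)
      (by
        rw [hMx₀, hDx₀, hx₀']
        exact hR)
  have hmem : ∀ {ψ : Euc n → ℝ} (h : IsTest ψ), ∃ w : W, (w : L2 n) = h.toL2 ∧
      D w = h.toH1.grad ∧ M w = (h.memLp_mul ha).toLp _ := by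
    intro ψ h
    refine ⟨e ⟨h.toH1, h.toH1_mem_dampingDomain ha⟩, rfl, ?_, ?_⟩
    · rw [hD, LinearEquiv.symm_apply_apply]
    · change dampingMap a (e.symm _) = _
      rw [LinearEquiv.symm_apply_apply]
      refine Lp.ext ?_
      filter_upwards [coeFn_dampingMap a ⟨h.toH1, h.toH1_mem_dampingDomain ha⟩,
        (h.memLp_mul ha).coeFn_toLp, h.coeFn_toL2] with x h1 h2 h3
      rw [h1, h2]
      change a x * h.toL2 x = _
      rw [h3]
  refine ⟨v, u, p, g, C, hv0, hu0, hb, hL, hT, ?_, ?_, ?_⟩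
  · intro ψ h
    obtain ⟨w, hw1, -, -⟩ := hmem h
    obtain ⟨C', hC'⟩ := hw w
    rw [← hw1]
    exact ⟨C', hC'⟩
  · intro t ht
    rw [isWeakGradient_iff]
    intro ψ h i
    -- The limit `u t` need not lie in `W`. Testing with `ψ eᵢ`, on which the adjoint of `D` acts as
    -- `-∂ᵢψ`, identifies `g t` as its weak gradient.
    have := hcl (h.toL2Vec i) (-(h.partialDeriv i).toL2) (fun w => by
      rw [inner_neg_right, hD, ← he' w,
        (isWeakGradient_iff.1 (e.symm w).1.isWeakGradient) ψ h i, neg_neg]) t ht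
    rw [this, inner_neg_right, neg_neg]
  · intro ψ h t ht
    obtain ⟨w, hw1, hw2, hw3⟩ := hmem h
    have := heq w (-h.laplacian.toL2) (fun x => by
      rw [hw2, inner_neg_right, hD, ← he' x, h.inner_grad (e.symm x).1.isWeakGradient]) t ht
    rw [hw3, hw1, hMx₀, inner_neg_right] at this
    rw [← this]
    ring

/-! ### From the integrated equation to the weak formulation -/

theorem integrableOn_Ioi_of_eq_zero {F : Type*} [NormedAddCommGroup F] {f : ℝ → F} {T : ℝ}
    (hf : ContinuousOn f (Ici 0)) (h0 : ∀ t, T < t → f t = 0) : IntegrableOn f (Ioi 0) := by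
  have h1 : IntegrableOn f (Icc 0 (max T 0)) :=
    (hf.mono Icc_subset_Ici_self).integrableOn_compact isCompact_Icc
  have h2 : IntegrableOn f (Ioi (max T 0)) := by
    have h3 : EqOn (fun _ : ℝ => (0 : F)) f (Ioi (max T 0)) := fun t ht =>
      (h0 t ((le_max_left _ _).trans_lt ht)).symm
    exact integrableOn_zero.congr_fun h3 measurableSet_Ioi
  refine (h1.union h2).mono_set fun t ht => ?_
  rcases le_or_gt t (max T 0) with h | h
  · exact Or.inl ⟨le_of_lt ht, h⟩
  · exact Or.inr h

theorem integral_Ioi_deriv_of_eq_zero {f f' : ℝ → ℝ} {T : ℝ}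
    (hf : ∀ t, 0 ≤ t → HasDerivWithinAt f (f' t) (Ici 0) t)
    (hint : IntegrableOn f' (Ioi 0)) (h0 : ∀ t, T < t → f t = 0) :
    ∫ t in Ioi (0 : ℝ), f' t = -f 0 := by
  rw [integral_Ioi_of_hasDerivAt_of_tendsto (m := 0) (hf 0 le_rfl).continuousWithinAt
    (fun t ht => (hf t (le_of_lt ht)).hasDerivAt (Ici_mem_nhds ht)) hint
    (tendsto_const_nhds.congr' ?_), zero_sub]
  filter_upwards [eventually_gt_atTop T] with t ht
  exact (h0 t ht).symm

theorem IsSTTest.curve_congr {Ψ Ψ' : ℝ × Euc n → ℝ} (h : IsSTTest Ψ) (h' : IsSTTest Ψ')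
    (e : Ψ = Ψ') : h.curve = h'.curve := by
  subst e
  rfl

section Pointwise

variable {u p v : ℝ → L2 n} {C : ℝ}

theorem continuousOn_of_lipschitz
    (hL : ∀ s, 0 ≤ s → ∀ t, 0 ≤ t → ‖u s - u t‖ ≤ C * |s - t|) : ContinuousOn u (Ici 0) := by
  intro t ht
  rw [ContinuousWithinAt, tendsto_iff_norm_sub_tendsto_zero]
  refine squeeze_zero' (g := fun s => C * |s - t|) (Eventually.of_forall fun s => norm_nonneg _) ?_ ?_
  · filter_upwards [self_mem_nhdsWithin] with s hs
    exact hL s hs t ht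
  · have : Tendsto (fun s => C * |s - t|) (𝓝 t) (𝓝 (C * |t - t|)) := by
      apply Continuous.tendsto
      fun_prop
    simpa using this.mono_left nhdsWithin_le_nhds

theorem hasDerivWithinAt_inner_of_weak
    (hw : ∀ (ψ : Euc n → ℝ) (h : IsTest ψ), ∃ C' : ℝ, ∀ s, 0 ≤ s → ∀ t, 0 ≤ t →
        ‖⟪u s - u t - (s - t) • p t, h.toL2⟫_ℝ‖ ≤ C' * |s - t| ^ 2)
    {ψ : Euc n → ℝ} (h : IsTest ψ) {t : ℝ} (ht : 0 ≤ t) :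
    HasDerivWithinAt (fun s => ⟪u s, h.toL2⟫_ℝ) ⟪p t, h.toL2⟫_ℝ (Ici 0) t := by
  obtain ⟨C', hC'⟩ := hw ψ h
  refine hasDerivWithinAt_of_norm_le_sq (C := C') fun s hs => ?_
  simpa only [inner_sub_left, real_inner_smul_left, smul_eq_mul] using hC' s hs t ht

/-- A product rule in which `u` is only Lipschitz in norm and differentiable against test functions.
The split `⟪u s, φ t⟫ + ⟪u s, φ s - φ t⟫` uses the weak derivative in the first term and makes the
mixed error of the second quadratic. -/
theorem hasDerivWithinAt_inner_curve
    (hL : ∀ s, 0 ≤ s → ∀ t, 0 ≤ t → ‖u s - u t‖ ≤ C * |s - t|)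
    (hw : ∀ (ψ : Euc n → ℝ) (h : IsTest ψ), ∃ C' : ℝ, ∀ s, 0 ≤ s → ∀ t, 0 ≤ t →
        ‖⟪u s - u t - (s - t) • p t, h.toL2⟫_ℝ‖ ≤ C' * |s - t| ^ 2)
    {Ψ : ℝ × Euc n → ℝ} (h : IsSTTest Ψ) {t : ℝ} (ht : 0 ≤ t) :
    HasDerivWithinAt (fun s => ⟪u s, h.curve s⟫_ℝ)
      (⟪p t, h.curve t⟫_ℝ + ⟪u t, h.timeDeriv.curve t⟫_ℝ) (Ici 0) t := by
  have h1 := hasDerivWithinAt_inner_of_weak hw (h.slice t) ht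
  obtain ⟨C₁, hC₁⟩ := h.norm_curve_le
  have h2 : HasDerivWithinAt (fun s => ⟪u s, h.curve s - h.curve t⟫_ℝ)
      ⟪u t, h.timeDeriv.curve t⟫_ℝ (Ici 0) t := by
    refine hasDerivWithinAt_of_norm_le_sq (C := C * C₁ + ‖u t‖ * C₁) fun s hs => ?_
    have e : ⟪u s, h.curve s - h.curve t⟫_ℝ - ⟪u t, h.curve t - h.curve t⟫_ℝ
        - (s - t) • ⟪u t, h.timeDeriv.curve t⟫_ℝ = ⟪u s - u t, h.curve s - h.curve t⟫_ℝ
        + ⟪u t, h.curve s - h.curve t - (s - t) • h.timeDeriv.curve t⟫_ℝ := by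
      simp only [inner_sub_left, inner_sub_right, real_inner_smul_right, smul_eq_mul]
      ring
    rw [e]
    calc _ ≤ ‖u s - u t‖ * ‖h.curve s - h.curve t‖
          + ‖u t‖ * ‖h.curve s - h.curve t - (s - t) • h.timeDeriv.curve t‖ :=
          (norm_add_le _ _).trans (add_le_add (norm_inner_le_norm _ _) (norm_inner_le_norm _ _))
      _ ≤ (C * |s - t|) * (C₁ * |s - t|) + ‖u t‖ * (C₁ * |s - t| ^ 2) := by
          gcongr
          · exact (norm_nonneg _).trans (hL s hs t ht)
          · exact hL s hs t ht
          · exact (hC₁ s t).1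
          · exact (hC₁ s t).2
      _ = _ := by ring
  refine (h1.add h2).congr_of_eventuallyEq (Eventually.of_forall fun s => ?_) ?_
  · simp only [Pi.add_apply, inner_sub_right]
    unfold IsSTTest.curve
    ring
  · simp only [Pi.add_apply, inner_sub_right]
    unfold IsSTTest.curve
    ring

/-- The integrated equation implies the weak formulation. -/
theorem integral_inner_waveCurve {a : Euc n → ℝ} (ha : Continuous a) {f : L2 n} (hv0 : v 0 = 0)
    (hL : ∀ s, 0 ≤ s → ∀ t, 0 ≤ t → ‖u s - u t‖ ≤ C * |s - t|)
    (hT : ∀ s, 0 ≤ s → ∀ t, 0 ≤ t → ‖v s - v t - (s - t) • u t‖ ≤ C * |s - t| ^ 2)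
    (hw : ∀ (ψ : Euc n → ℝ) (h : IsTest ψ), ∃ C' : ℝ, ∀ s, 0 ≤ s → ∀ t, 0 ≤ t →
        ‖⟪u s - u t - (s - t) • p t, h.toL2⟫_ℝ‖ ≤ C' * |s - t| ^ 2)
    (heq : ∀ (ψ : Euc n → ℝ) (h : IsTest ψ), ∀ t, 0 ≤ t →
        ⟪p t, h.toL2⟫_ℝ - ⟪v t, h.laplacian.toL2⟫_ℝ + ⟪u t, (h.memLp_mul ha).toLp _⟫_ℝ
          = ⟪f, h.toL2⟫_ℝ)
    {Ψ : ℝ × Euc n → ℝ} (h : IsSTTest Ψ) :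
    ∫ t in Ioi (0 : ℝ), ⟪u t, h.waveCurve ha t⟫_ℝ
      = ⟪f, h.curve 0⟫_ℝ - ⟪u 0, h.timeDeriv.curve 0⟫_ℝ := by
  -- By the integrated equation tested with `φ_t`, the derivative of `S` is exactly `⟪u, φ_tt - Δφ -
  -- a φ_t⟫`. Since `v 0 = 0`, `-S 0` is the right side of the claim.
  let S : ℝ → ℝ := fun t => -⟪v t, h.spaceLaplacian.curve t⟫_ℝ - ⟪f, h.curve t⟫_ℝ
    + ⟪u t, h.timeDeriv.curve t⟫_ℝ
  have hS : ∀ t, 0 ≤ t → HasDerivWithinAt S ⟪u t, h.waveCurve ha t⟫_ℝ (Ici 0) t := by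
    intro t ht
    have hvd : HasDerivWithinAt v (u t) (Ici 0) t :=
      hasDerivWithinAt_of_norm_le_sq (C := C) fun s hs => hT s hs t ht
    have h1 := hvd.inner ℝ (h.spaceLaplacian.hasDerivAt_curve t).hasDerivWithinAt
    have h2 := (hasDerivWithinAt_const t (Ici 0) f).inner ℝ
      (h.hasDerivAt_curve t).hasDerivWithinAt
    have h3 := hasDerivWithinAt_inner_curve hL hw h.timeDeriv ht
    refine HasDerivWithinAt.congr_deriv ((h1.neg.sub h2).add h3) ?_
    have e := heq _ (h.timeDeriv.slice t) t ht
    have e1 : (h.timeDeriv.slice t).laplacian.toL2 = h.spaceLaplacian.timeDeriv.curve t := by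
      rw [h.spaceLaplacian.timeDeriv.curve_congr h.timeDeriv.spaceLaplacian
        h.timeDeriv_spaceLaplacian]
      refine IsTest.toL2_congr _ ?_
      filter_upwards [(h.timeDeriv.slice t).laplacian.coeFn_toL2] with x hx
      rw [hx]
      exact h.timeDeriv.laplacian_slice t x
    rw [e1] at e
    have e2 : ⟪u t, h.waveCurve ha t⟫_ℝ = ⟪u t, h.timeDeriv.timeDeriv.curve t⟫_ℝ
        - ⟪u t, h.spaceLaplacian.curve t⟫_ℝ
        - ⟪u t, ((h.timeDeriv.slice t).memLp_mul ha).toLp _⟫_ℝ := by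
      unfold IsSTTest.waveCurve
      rw [inner_sub_right, inner_sub_right]
    rw [e2, inner_zero_left]
    have e3 : h.timeDeriv.curve t = (h.timeDeriv.slice t).toL2 := rfl
    rw [e3]
    linarith
  obtain ⟨T, hT0, hTz⟩ := h.waveCurve_eq_zero ha
  obtain ⟨T₁, hT₁, h1⟩ := h.curve_eq_zero
  obtain ⟨T₂, hT₂, h2⟩ := h.timeDeriv.curve_eq_zero
  obtain ⟨T₃, hT₃, h3⟩ := h.spaceLaplacian.curve_eq_zero
  rw [integral_Ioi_deriv_of_eq_zero (T := max (max T₁ T₂) T₃) hS]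
  · simp only [S, hv0, inner_zero_left]
    ring
  · refine integrableOn_Ioi_of_eq_zero (T := T)
      ((continuousOn_of_lipschitz hL).inner (h.continuous_waveCurve ha).continuousOn) fun t ht => ?_
    rw [hTz t (ht.trans_le (le_abs_self t)), inner_zero_right]
  · intro t ht
    have ht' := ht.trans_le (le_abs_self t)
    rw [max_lt_iff, max_lt_iff] at ht'
    simp only [S]
    rw [h1 t ht'.1.1, h2 t ht'.1.2, h3 t ht'.2]
    simp

end Pointwise

/-! ### Measurability and weak time derivatives -/

/-- Weak measurability, against a separating family, implies strong measurability in separable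
Hilbert spaces. -/
theorem stronglyMeasurable_of_weak {H : Type*} [NormedAddCommGroup H] [InnerProductSpace ℝ H]
    [CompleteSpace H] [SecondCountableTopology H] {S : Set H}
    (hS : ∀ x, (∀ s ∈ S, ⟪x, s⟫_ℝ = 0) → x = 0) {p : ℝ → H}
    (hp : ∀ s ∈ S, Measurable fun t => ⟪p t, s⟫_ℝ) : StronglyMeasurable p := by
  let : MeasurableSpace H := borel H
  have : BorelSpace H := ⟨rfl⟩
  obtain ⟨T, hTS, hTc, hST⟩ :=
    (TopologicalSpace.IsSeparable.of_separableSpace S).exists_countable_dense_subset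
  have : Countable T := hTc.to_subtype
  -- A countable dense part of `S` still separates points, so `ι` is a continuous injection of a
  -- Polish space into a countable product of lines. By Lusin–Souslin it is a measurable embedding.
  let ι : H → T → ℝ := fun x s => ⟪x, (s : H)⟫_ℝ
  have hcont : Continuous ι := continuous_pi fun s => continuous_id.inner continuous_const
  have hinj : Function.Injective ι := by
    intro x y hxy
    rw [← sub_eq_zero]
    refine hS _ fun s hs => ?_
    have hcl : IsClosed {s : H | ⟪x - y, s⟫_ℝ = 0} :=
      isClosed_eq (continuous_const.inner continuous_id) continuous_const
    refine hcl.closure_subset_iff.2 (fun t ht => ?_) (hST hs)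
    have := congrFun hxy ⟨t, ht⟩
    change ⟪x - y, t⟫_ℝ = 0
    rw [inner_sub_left, sub_eq_zero]
    exact this
  have hemb : MeasurableEmbedding ι := hcont.measurableEmbedding hinj
  refine Measurable.stronglyMeasurable ?_
  rw [← hemb.measurable_comp_iff]
  exact measurable_pi_iff.2 fun s => hp s (hTS s.2)

/-- A continuous injection between Polish spaces is a measurable embedding, so measurability can be
checked in `L²`, without any continuity of the gradient in time. -/
theorem stronglyMeasurable_H1 {u : ℝ → H1 n} (hu : Continuous fun t => (u t).toL2) :
    StronglyMeasurable u := by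
  let : MeasurableSpace (H1 n) := borel _
  have : BorelSpace (H1 n) := ⟨rfl⟩
  let : MeasurableSpace (L2 n) := borel _
  have : BorelSpace (L2 n) := ⟨rfl⟩
  have hemb : MeasurableEmbedding (toL2L n) :=
    (toL2L n).continuous.measurableEmbedding toL2_injective
  refine Measurable.stronglyMeasurable ?_
  rw [← hemb.measurable_comp_iff]
  exact hu.measurable

theorem eq_zero_of_inner_toL2_eq_zero (f : L2 n)
    (hf : ∀ (ψ : Euc n → ℝ) (h : IsTest ψ), ⟪f, h.toL2⟫_ℝ = 0) : f = 0 := by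
  rw [Lp.eq_zero_iff_ae_eq_zero]
  refine ae_eq_zero_of_integral_contDiff_smul_eq_zero
    ((Lp.memLp f).locallyIntegrable (by norm_num)) fun φ h1 h2 => ?_
  have := hf φ ⟨h1, h2⟩
  rw [IsTest.inner_toL2] at this
  simpa only [smul_eq_mul, mul_comm (φ _)] using this

theorem integrable_smul_of_bounded {F : Type*} [NormedAddCommGroup F] [NormedSpace ℝ F]
    {μ : Measure ℝ} [IsFiniteMeasureOnCompacts μ] {η : ℝ → ℝ} {f : ℝ → F} (hη : Continuous η)
    (hc : HasCompactSupport η) (hf : AEStronglyMeasurable f μ) {C : ℝ}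
    (hC : ∀ᵐ t ∂μ, ‖f t‖ ≤ C) : Integrable (fun t => η t • f t) μ := by
  refine Integrable.mono' ((hη.integrable_of_hasCompactSupport hc).norm.mul_const C)
    (hη.aestronglyMeasurable.smul hf) ?_
  filter_upwards [hC] with t ht
  rw [norm_smul]
  gcongr

/-- Paired with a spatial test function `ψ`, the claim is that the derivative of `η ⟪u, ψ⟫`
integrates to zero; test functions separate points of `L²`. -/
theorem isWeakTimeDeriv_of_hasDerivWithinAt {u p : ℝ → L2 n} (hu : Continuous u)
    (hp : StronglyMeasurable p) {Cu Cp : ℝ} (hCu : ∀ t, ‖u t‖ ≤ Cu) (hCp : ∀ t, ‖p t‖ ≤ Cp)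
    (hd : ∀ (ψ : Euc n → ℝ) (h : IsTest ψ) (t : ℝ), 0 ≤ t →
      HasDerivWithinAt (fun s => ⟪u s, h.toL2⟫_ℝ) ⟪p t, h.toL2⟫_ℝ (Ici 0) t) :
    IsWeakTimeDeriv u p := by
  intro η h1 h2 h3
  have hη' : Continuous (deriv η) := h1.continuous_deriv (by simp)
  have i1 : IntegrableOn (fun t => deriv η t • u t) (Ioi 0) :=
    integrable_smul_of_bounded hη' h2.deriv hu.aestronglyMeasurable (Eventually.of_forall hCu)
  have i2 : IntegrableOn (fun t => η t • p t) (Ioi 0) :=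
    integrable_smul_of_bounded h1.continuous h2 hp.aestronglyMeasurable (Eventually.of_forall hCp)
  rw [← add_eq_zero_iff_eq_neg, ← integral_add i1 i2]
  refine eq_zero_of_inner_toL2_eq_zero _ fun ψ h => ?_
  have i12 : IntegrableOn (fun t => deriv η t • u t + η t • p t) (Ioi 0) := i1.add i2
  rw [real_inner_comm, ← integral_inner i12]
  obtain ⟨T, hT⟩ := h2.isCompact.isBounded.bddAbove
  have h0 : ∀ t, T < t → η t = 0 := fun t ht => by
    by_contra hne
    exact absurd (hT (subset_tsupport _ hne)) (not_le.2 ht)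
  have hη0 : η 0 = 0 := by
    by_contra hne
    exact lt_irrefl (0 : ℝ) (mem_Ioi.1 (h3 (subset_tsupport _ hne)))
  have := integral_Ioi_deriv_of_eq_zero (f := fun t => η t * ⟪u t, h.toL2⟫_ℝ)
    (f' := fun t => ⟪h.toL2, deriv η t • u t + η t • p t⟫_ℝ) (T := T) (fun t ht => ?_)
    (i12.const_inner _) (fun t ht => by simp [h0 t ht])
  · simpa [hη0] using this
  · refine HasDerivWithinAt.congr_deriv
      (((h1.differentiable (by simp)) t).hasDerivAt.hasDerivWithinAt.mul (hd ψ h t ht)) ?_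
    rw [inner_add_right, real_inner_smul_right, real_inner_smul_right, real_inner_comm (u t),
      real_inner_comm (p t)]

/-! ### Existence with decay -/

theorem lpNorm_two_coe (f : L2 n) : lpNorm f 2 volume = ‖f‖ := by
  rw [← toReal_eLpNorm (Lp.aestronglyMeasurable f), Lp.norm_def]

theorem dataNorm_sq (a : Euc n → ℝ) (u₀ u₁ : H1 n) : dataNorm a u₀ u₁ ^ 2 =
    ‖u₀.toL2‖ ^ 2 + ‖u₀.grad‖ ^ 2
    + lpNorm (fun x => a x * u₀.toL2 x) 1 volume ^ 2
    + lpNorm (fun x => a x * u₀.toL2 x) 2 volume ^ 2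
    + ‖u₁.toL2‖ ^ 2 + lpNorm u₁.toL2 1 volume ^ 2 :=
  Real.sq_sqrt (by positivity)

/-- Existence of a weak solution with the decay estimates. -/
theorem exists_weak_solution (hn : 3 ≤ n) {V₀ : ℝ} (hV₀ : 0 < V₀) :
    ∃ C : ℝ, 0 < C ∧ ∀ (a : Euc n → ℝ), Continuous a → (∀ x, V₀ ≤ a x) → ∀ (u₀ u₁ : H1 n),
        MemLp u₁.toL2 1 volume →
        MemLp (fun x => a x * u₀.toL2 x) 1 volume →
        MemLp (fun x => a x * u₀.toL2 x) 2 volume →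
      ∃ (u : ℝ → H1 n) (ut : ℝ → L2 n), InSolutionClass u ut ∧
        ContinuousOn (fun t => (u t).toL2) (Ici 0) ∧
        IsWeakSolution a u₀.toL2 u₁.toL2 (fun t => (u t).toL2) ∧
        (∀ t : ℝ, 0 ≤ t → ‖(u t).toL2‖ ^ 2 ≤ C * dataNorm a u₀ u₁ ^ 2 * (1 + t)⁻¹) ∧
        (∀ᵐ t ∂timeMeasure,
          energy (u t) (ut t) ≤ C * dataNorm a u₀ u₁ ^ 2 * ((1 + t) ^ 2)⁻¹) := by
  obtain ⟨Cs, hCs0, hCs⟩ := exists_inner_le_norm_grad hn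
  have hdec : 0 < decayConst V₀ := by unfold decayConst; positivity
  -- The `2` covers the initial energy terms including `⟪a u₀, u₀⟫`. The `4 Cs²` covers `K²`, as the
  -- square of a sum of four norms is at most four times the sum of their squares.
  set C₀ : ℝ := decayConst V₀ * (2 + 4 * Cs ^ 2) with hC₀
  have hC₀0 : 0 < C₀ := by positivity
  refine ⟨(2 / V₀ + 2) * C₀, by positivity, fun a ha haV u₀ u₁ hu₁ hau1 hau2 => ?_⟩
  set I := dataNorm a u₀ u₁ ^ 2 with hI
  have hI0 : 0 ≤ I := sq_nonneg _
  set au₀ : L2 n := hau2.toLp _ with hau₀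
  have hau₀c : au₀ =ᵐ[volume] fun x => a x * u₀.toL2 x := hau2.coeFn_toLp
  have hA2 : lpNorm (fun x => a x * u₀.toL2 x) 2 volume = ‖au₀‖ := by
    rw [← toReal_eLpNorm hau2.1, hau₀, Lp.norm_toLp]
  have hIeq := dataNorm_sq a u₀ u₁
  rw [← hI, hA2] at hIeq
  set A1 := lpNorm (fun x => a x * u₀.toL2 x) 1 volume with hA1
  set U1 := lpNorm u₁.toL2 1 volume with hU1
  have hA10 : 0 ≤ A1 := lpNorm_nonneg
  have hU10 : 0 ≤ U1 := lpNorm_nonneg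
  have hf : (u₁.toL2 + au₀ : L2 n) =ᵐ[volume]
      (u₁.toL2 : Euc n → ℝ) + fun x => a x * u₀.toL2 x := by
    filter_upwards [Lp.coeFn_add u₁.toL2 au₀, hau₀c] with x h1 h2
    rw [h1, Pi.add_apply, Pi.add_apply, h2]
  have hf1 : MemLp (u₁.toL2 + au₀ : L2 n) 1 volume := (memLp_congr_ae hf).2 (hu₁.add hau1)
  have hN1 : lpNorm (u₁.toL2 + au₀ : L2 n) 1 volume ≤ U1 + A1 := by
    rw [← toReal_eLpNorm hf1.1, eLpNorm_congr_ae hf, toReal_eLpNorm (hu₁.add hau1).1]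
    exact lpNorm_add_le hu₁ le_rfl
  have hN2 : lpNorm (u₁.toL2 + au₀ : L2 n) 2 volume ≤ ‖u₁.toL2‖ + ‖au₀‖ := by
    rw [lpNorm_two_coe]
    exact norm_add_le _ _
  set K : ℝ := Cs * (U1 + A1 + (‖u₁.toL2‖ + ‖au₀‖)) with hKdef
  have hK : ∀ w : H1 n, ⟪u₁.toL2 + au₀, w.toL2⟫_ℝ ≤ K * ‖w.grad‖ := by
    intro w
    refine (le_abs_self _).trans ((hCs _ hf1 w).trans ?_)
    rw [hKdef]
    gcongr
  have hR : decayConst V₀ * (‖u₀.toL2‖ ^ 2 + ‖u₀.grad‖ ^ 2 + ⟪au₀, u₀.toL2⟫_ℝ + ‖u₁.toL2‖ ^ 2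
      + K ^ 2) ≤ C₀ * I := by
    rw [hC₀, mul_assoc]
    refine mul_le_mul_of_nonneg_left ?_ hdec.le
    have h1 : ⟪au₀, u₀.toL2⟫_ℝ ≤ ‖au₀‖ ^ 2 + ‖u₀.toL2‖ ^ 2 := by
      have := real_inner_le_norm au₀ u₀.toL2
      nlinarith [two_mul_le_add_sq ‖au₀‖ ‖u₀.toL2‖, sq_nonneg ‖au₀‖, sq_nonneg ‖u₀.toL2‖]
    have h2 : (U1 + A1 + (‖u₁.toL2‖ + ‖au₀‖)) ^ 2 ≤ 4 * I := by
      rw [hIeq]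
      nlinarith [two_mul_le_add_sq (U1 + A1) (‖u₁.toL2‖ + ‖au₀‖), two_mul_le_add_sq U1 A1,
        two_mul_le_add_sq ‖u₁.toL2‖ ‖au₀‖, sq_nonneg ‖u₀.toL2‖, sq_nonneg ‖u₀.grad‖]
    have h3 : K ^ 2 ≤ Cs ^ 2 * (4 * I) := by
      rw [hKdef, mul_pow]
      gcongr
    have h4 : ‖u₀.toL2‖ ^ 2 + ‖u₀.grad‖ ^ 2 + (‖au₀‖ ^ 2 + ‖u₀.toL2‖ ^ 2) + ‖u₁.toL2‖ ^ 2
        ≤ 2 * I := by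
      rw [hIeq]
      nlinarith [sq_nonneg ‖u₀.toL2‖, sq_nonneg ‖u₀.grad‖, sq_nonneg A1, sq_nonneg U1,
        sq_nonneg ‖au₀‖, sq_nonneg ‖u₁.toL2‖]
    linarith
  obtain ⟨v, u, p, g, C, hv0, hu0, hb, hL, hT, hw, hgr, heq⟩ :=
    exists_weak_limit_solution hV₀ ha haV u₀ u₁.toL2 au₀ hau2 hau₀ hK hR
  have hm : ∀ t : ℝ, (0 : ℝ) ≤ max t 0 := fun t => le_max_right _ _
  -- Frozen at the initial value for negative times, so that the curve is defined and bounded on all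
  -- of `ℝ` with continuous `L²` part.
  let U : ℝ → H1 n := fun t => H1.mk (u (max t 0)) (g (max t 0)) (hgr _ (hm t))
  let P : ℝ → L2 n := fun t => p (max t 0)
  have hUt : ∀ t, 0 ≤ t → (U t).toL2 = u t := fun t ht => by
    change u (max t 0) = u t
    rw [max_eq_left ht]
  have hPt : ∀ t, 0 ≤ t → P t = p t := fun t ht => by
    change p (max t 0) = p t
    rw [max_eq_left ht]
  have hGt : ∀ t, 0 ≤ t → (U t).grad = g t := fun t ht => by
    change g (max t 0) = g t
    rw [max_eq_left ht]
  have huc : ContinuousOn u (Ici 0) := continuousOn_of_lipschitz hL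
  have hmaxc : Continuous fun t : ℝ => max t 0 := continuous_id.max continuous_const
  have hUc : Continuous fun t => (U t).toL2 := huc.comp_continuous hmaxc hm
  have hinv1 : ∀ t : ℝ, 0 ≤ t → (1 + t)⁻¹ ≤ 1 := fun t ht => inv_le_one_of_one_le₀ (by linarith)
  have hinv2 : ∀ t : ℝ, 0 ≤ t → ((1 + t) ^ 2)⁻¹ ≤ 1 := fun t ht =>
    inv_le_one_of_one_le₀ (one_le_pow₀ (by linarith))
  have hUb : ∀ t, ‖(U t).toL2‖ ^ 2 ≤ 2 / V₀ * (C₀ * I) := fun t =>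
    (hb _ (hm t)).1.trans (mul_le_of_le_one_right (by positivity) (hinv1 _ (hm t)))
  have hPb : ∀ t, ‖P t‖ ^ 2 ≤ 2 * (C₀ * I) := fun t =>
    (hb _ (hm t)).2.1.trans (mul_le_of_le_one_right (by positivity) (hinv2 _ (hm t)))
  have hGb : ∀ t, ‖(U t).grad‖ ^ 2 ≤ 2 * (C₀ * I) := fun t =>
    (hb _ (hm t)).2.2.trans (mul_le_of_le_one_right (by positivity) (hinv2 _ (hm t)))
  have hUH : ∀ t, ‖U t‖ ≤ √(2 / V₀ * (C₀ * I) + 2 * (C₀ * I)) := fun t =>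
    Real.le_sqrt_of_sq_le (by rw [norm_sq_H1]; exact add_le_add (hUb t) (hGb t))
  have hvc : ContinuousOn v (Ici 0) := fun t ht =>
    (hasDerivWithinAt_of_norm_le_sq (C := C) (f' := u t) fun s hs =>
      hT s hs t ht).continuousWithinAt
  -- The integrated equation expresses `⟪P t, ψ⟫` through the continuous curves `v` and `u`, so `P`
  -- is weakly continuous against test functions.
  have hPm : StronglyMeasurable P := by
    refine stronglyMeasurable_of_weak (S := {f | ∃ (ψ : Euc n → ℝ) (h : IsTest ψ), f = h.toL2})
      (fun x hx => eq_zero_of_inner_toL2_eq_zero x fun ψ h => hx _ ⟨ψ, h, rfl⟩) ?_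
    rintro _ ⟨ψ, h, rfl⟩
    have e : (fun t => ⟪P t, h.toL2⟫_ℝ) = fun t => ⟪u₁.toL2 + au₀, h.toL2⟫_ℝ
        + ⟪v (max t 0), h.laplacian.toL2⟫_ℝ - ⟪u (max t 0), (h.memLp_mul ha).toLp _⟫_ℝ := by
      funext t
      rw [← heq ψ h _ (hm t)]
      ring
    rw [e]
    exact ((continuous_const.add ((hvc.comp_continuous hmaxc hm).inner continuous_const)).sub
      (hUc.inner continuous_const)).measurable
  have hUm := stronglyMeasurable_H1 hUc
  refine ⟨U, P, ⟨?_, ?_, ?_, ?_⟩, hUc.continuousOn, ?_, ?_, ?_⟩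
  · exact memLp_top_of_bound hUm.aestronglyMeasurable _ (Eventually.of_forall hUH)
  · exact memLp_top_of_bound hUc.aestronglyMeasurable _
      (Eventually.of_forall fun t => Real.le_sqrt_of_sq_le (hUb t))
  · exact memLp_top_of_bound hPm.aestronglyMeasurable _
      (Eventually.of_forall fun t => Real.le_sqrt_of_sq_le (hPb t))
  · refine isWeakTimeDeriv_of_hasDerivWithinAt hUc hPm
      (fun t => Real.le_sqrt_of_sq_le (hUb t)) (fun t => Real.le_sqrt_of_sq_le (hPb t)) ?_
    intro ψ h t ht
    rw [hPt t ht]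
    refine (hasDerivWithinAt_inner_of_weak hw h ht).congr (fun s hs => ?_) ?_
    · rw [hUt s hs]
    · rw [hUt t ht]
  · intro φ h1 h2
    have h : IsSTTest (Function.uncurry φ) := ⟨h1, h2⟩
    simp only [h.inner_waveCurve ha]
    have e0 : ∫ t in Ioi (0 : ℝ), ⟪(U t).toL2, h.waveCurve ha t⟫_ℝ
        = ∫ t in Ioi (0 : ℝ), ⟪u t, h.waveCurve ha t⟫_ℝ :=
      setIntegral_congr_fun measurableSet_Ioi fun t ht => by
        simp only [hUt t (le_of_lt ht)]
    rw [e0, integral_inner_waveCurve ha hv0 hL hT hw heq h, inner_add_left, hu0]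
    have e1 : ⟪u₁.toL2, h.curve 0⟫_ℝ = ∫ x, u₁.toL2 x * φ 0 x := (h.slice 0).inner_toL2 _
    have e2 : ⟪u₀.toL2, h.timeDeriv.curve 0⟫_ℝ
        = ∫ x, u₀.toL2 x * deriv (fun s => φ s x) 0 := by
      refine ((h.timeDeriv.slice 0).inner_toL2 _).trans ?_
      refine integral_congr_ae (Eventually.of_forall fun x => ?_)
      simp only
      rw [← (h.hasDerivAt_time 0 x).deriv]
      rfl
    have e3 : ⟪au₀, h.curve 0⟫_ℝ = ∫ x, a x * u₀.toL2 x * φ 0 x := by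
      refine ((h.slice 0).inner_toL2 _).trans ?_
      refine integral_congr_ae ?_
      filter_upwards [hau₀c] with x hx
      rw [hx]
      rfl
    rw [e1, e2, e3]
    ring
  · intro t ht
    rw [hUt t ht]
    refine (hb t ht).1.trans ?_
    have h0 : 0 ≤ 1 + t := by linarith
    have h1 : 0 ≤ 2 * C₀ * I * (1 + t)⁻¹ := by positivity
    linarith
  · filter_upwards [ae_restrict_mem measurableSet_Ioi] with t ht
    have ht' : (0 : ℝ) ≤ t := le_of_lt ht
    unfold energy
    rw [hPt t ht', hGt t ht']
    have h1 := (hb t ht').2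
    have h2 : 0 ≤ 2 / V₀ * C₀ * I * ((1 + t) ^ 2)⁻¹ := by positivity
    linarith [h1.1, h1.2]

/-! ### Integrating weak equations in time -/

section Time

variable {E : Type*} [NormedAddCommGroup E] [NormedSpace ℝ E]

theorem setIntegral_Ioi_eq_intervalIntegral {f : ℝ → ℝ} {T : ℝ} (hT : 0 ≤ T)
    (h0 : ∀ t, T < t → f t = 0) : ∫ t in Ioi (0 : ℝ), f t = ∫ t in (0 : ℝ)..T, f t := by
  rw [intervalIntegral.integral_of_le hT]
  exact setIntegral_eq_of_subset_of_forall_sdiff_eq_zero measurableSet_Ioi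
    Ioc_subset_Ioi_self fun t ht => h0 t (not_le.1 fun h => ht.2 ⟨ht.1, h⟩)

/-- A smooth function vanishing on the right has a primitive vanishing on the right. -/
theorem exists_primitive_of_eq_zero {θ : ℝ → ℝ} (hθ : ContDiff ℝ ∞ θ) {T : ℝ}
    (h0 : ∀ t, T ≤ t → θ t = 0) :
    ∃ Θ : ℝ → ℝ, ContDiff ℝ ∞ Θ ∧ deriv Θ = θ ∧ ∀ t, T ≤ t → Θ t = 0 := by
  have hd : ∀ t, HasDerivAt (fun s => ∫ r in T..s, θ r) (θ t) t := fun t =>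
    intervalIntegral.integral_hasDerivAt_right (hθ.continuous.intervalIntegrable _ _)
      (hθ.continuous.stronglyMeasurableAtFilter _ _) hθ.continuous.continuousAt
  have he : deriv (fun s => ∫ r in T..s, θ r) = θ := funext fun t => (hd t).deriv
  refine ⟨_, contDiff_infty_iff_deriv.2 ⟨fun t => (hd t).differentiableAt, ?_⟩, he, fun t ht => ?_⟩
  · rwa [he]
  · rw [intervalIntegral.integral_congr (g := fun _ => (0 : ℝ)) fun r hr => ?_]
    · simp
    · rw [uIcc_of_le ht] at hr
      exact h0 r hr.1

/-- Since `f` is only locally integrable, its primitive is merely absolutely continuous. The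
boundary terms vanish because `θ` is zero at `T` and the primitive is zero at `0`. -/
theorem integral_Ioi_mul_eq_neg_deriv {f θ : ℝ → ℝ} (hf : LocallyIntegrable f)
    (hθ : ContDiff ℝ ∞ θ) {T : ℝ} (hT : 0 ≤ T) (h0 : ∀ t, T ≤ t → θ t = 0) :
    ∫ t in Ioi (0 : ℝ), θ t * f t
      = -∫ t in Ioi (0 : ℝ), deriv θ t * ∫ s in (0 : ℝ)..t, f s := by
  have hd0 : ∀ t, T < t → deriv θ t = 0 := fun t ht => by
    have : θ =ᶠ[𝓝 t] fun _ => 0 := by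
      filter_upwards [Ioi_mem_nhds ht] with s hs
      exact h0 s (le_of_lt hs)
    rw [this.deriv_eq, deriv_const]
  rw [setIntegral_Ioi_eq_intervalIntegral hT fun t ht => by rw [h0 t ht.le, zero_mul],
    setIntegral_Ioi_eq_intervalIntegral hT fun t ht => by rw [hd0 t ht, zero_mul]]
  have hfi : IntervalIntegrable f volume 0 T :=
    (hf.integrableOn_isCompact isCompact_uIcc).intervalIntegrable
  have h1 := AbsolutelyContinuousOnInterval.integral_mul_deriv_eq_deriv_mul (a := 0) (b := T)
    (f := θ) ((hθ.of_le (by simp)).contDiffOn.absolutelyContinuousOnInterval)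
    (hfi.absolutelyContinuousOnInterval_intervalIntegral left_mem_uIcc)
  rw [h0 T le_rfl, intervalIntegral.integral_same] at h1
  have h2 : ∫ t in (0 : ℝ)..T, θ t * f t
      = ∫ t in (0 : ℝ)..T, θ t * deriv (fun x => ∫ s in (0 : ℝ)..x, f s) t := by
    refine intervalIntegral.integral_congr_ae ?_
    filter_upwards [_root_.LocallyIntegrable.ae_hasDerivAt_integral hf] with t ht _
    rw [(ht 0).deriv]
  rw [h2, h1]
  ring

theorem integral_Ioi_mul_clm_eq_neg_deriv [CompleteSpace E] {z : ℝ → E} (hz : LocallyIntegrable z)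
    (ℓ : E →L[ℝ] ℝ) {θ : ℝ → ℝ} (hθ : ContDiff ℝ ∞ θ) {T : ℝ} (hT : 0 ≤ T)
    (h0 : ∀ t, T ≤ t → θ t = 0) :
    ∫ t in Ioi (0 : ℝ), θ t * ℓ (z t)
      = -∫ t in Ioi (0 : ℝ), deriv θ t * ℓ (∫ s in (0 : ℝ)..t, z s) := by
  rw [integral_Ioi_mul_eq_neg_deriv (f := fun t => ℓ (z t)) ?_ hθ hT h0]
  · have e : ∀ t, ∫ s in (0 : ℝ)..t, ℓ (z s) = ℓ (∫ s in (0 : ℝ)..t, z s) := fun t =>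
      ℓ.intervalIntegral_comp_comm (hz.integrableOn_isCompact isCompact_uIcc).intervalIntegrable
    simp only [e]
  · intro t
    obtain ⟨s, hs, hi⟩ := hz t
    exact ⟨s, hs, ℓ.integrable_comp hi⟩

/-- A weak second order equation in time, with zero initial data, integrated three times. -/
theorem eq_zero_of_weak_second_order [CompleteSpace E] {z Z Y X : ℝ → E}
    (hz : LocallyIntegrable z)
    (hZ : ∀ t, Z t = ∫ s in (0 : ℝ)..t, z s) (hY : ∀ t, Y t = ∫ s in (0 : ℝ)..t, Z s)
    (hX : ∀ t, X t = ∫ s in (0 : ℝ)..t, Y s)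
    (hZc : Continuous Z) (hYc : Continuous Y) (hXc : Continuous X) (ℓ₁ ℓ₂ ℓ₃ : E →L[ℝ] ℝ)
    (heq : ∀ θ : ℝ → ℝ, ContDiff ℝ ∞ θ → HasCompactSupport θ →
      (∫ t in Ioi (0 : ℝ), deriv (deriv θ) t * ℓ₁ (z t)) - (∫ t in Ioi (0 : ℝ), θ t * ℓ₂ (z t))
        - (∫ t in Ioi (0 : ℝ), deriv θ t * ℓ₃ (z t)) = 0) {t : ℝ} (ht : 0 ≤ t) :
    ℓ₁ (Z t) - ℓ₂ (X t) + ℓ₃ (Y t) = 0 := by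
  set G : ℝ → ℝ := fun t => ℓ₁ (Z t) - ℓ₂ (X t) + ℓ₃ (Y t) with hG
  have hGc : Continuous G := ((ℓ₁.continuous.comp hZc).sub (ℓ₂.continuous.comp hXc)).add
    (ℓ₃.continuous.comp hYc)
  have key : ∀ κ : ℝ → ℝ, ContDiff ℝ ∞ κ → HasCompactSupport κ →
      ∫ t in Ioi (0 : ℝ), κ t * G t = 0 := by
    intro κ hκ hκc
    obtain ⟨T₀, hT₀⟩ := hκc.isCompact.isBounded.bddAbove
    set T : ℝ := max (T₀ + 1) 0 with hTdef
    have hT : 0 ≤ T := le_max_right _ _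
    have hκ0 : ∀ t, T ≤ t → κ t = 0 := fun t ht => by
      by_contra hne
      have h1 := hT₀ (subset_tsupport _ hne)
      have h2 := le_max_left (T₀ + 1) 0
      linarith
    -- To reach an arbitrary `κ` after three integrations by parts, the weak equation is tested with
    -- a third primitive `θ₀` of `κ`, each primitive vanishing to the right.
    obtain ⟨θ₂, h2s, h2d, h20⟩ := exists_primitive_of_eq_zero hκ hκ0
    obtain ⟨θ₁, h1s, h1d, h10⟩ := exists_primitive_of_eq_zero h2s h20
    obtain ⟨θ₀, h0s, h0d, h00⟩ := exists_primitive_of_eq_zero h1s h10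
    -- `θ₀` need not vanish to the left; the transition on `[-1, 0]` gives compact support and
    -- changes nothing for `t > 0`.
    set θ : ℝ → ℝ := fun t => Real.smoothTransition (t + 1) * θ₀ t with hθ
    have hθs : ContDiff ℝ ∞ θ :=
      (Real.smoothTransition.contDiff.comp (contDiff_id.add contDiff_const)).mul h0s
    have hθc : HasCompactSupport θ := by
      refine HasCompactSupport.intro (isCompact_Icc (a := -1) (b := T)) fun t ht => ?_
      simp only [hθ]
      rcases le_or_gt (-1) t with h | h
      · rw [h00 t (le_of_lt (not_le.1 fun h' => ht ⟨h, h'⟩)), mul_zero]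
      · rw [Real.smoothTransition.zero_of_nonpos (by linarith), zero_mul]
    have hev : ∀ t, 0 < t → θ =ᶠ[𝓝 t] θ₀ := fun t ht => by
      filter_upwards [Ioi_mem_nhds ht] with s hs
      simp only [hθ]
      rw [Real.smoothTransition.one_of_one_le (by linarith [mem_Ioi.1 hs]), one_mul]
    have e1 : ∀ t, 0 < t → deriv θ t = θ₁ t := fun t ht => by
      rw [(hev t ht).deriv_eq, h0d]
    have e2 : ∀ t, 0 < t → deriv (deriv θ) t = θ₂ t := fun t ht => by
      rw [(hev t ht).deriv.deriv_eq, h0d, h1d]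
    have h := heq θ hθs hθc
    have c1 : ∫ t in Ioi (0 : ℝ), deriv (deriv θ) t * ℓ₁ (z t)
        = ∫ t in Ioi (0 : ℝ), θ₂ t * ℓ₁ (z t) :=
      setIntegral_congr_fun measurableSet_Ioi fun t ht => by simp only [e2 t ht]
    have c2 : ∫ t in Ioi (0 : ℝ), θ t * ℓ₂ (z t) = ∫ t in Ioi (0 : ℝ), θ₀ t * ℓ₂ (z t) :=
      setIntegral_congr_fun measurableSet_Ioi fun t ht => by simp only [(hev t ht).eq_of_nhds]
    have c3 : ∫ t in Ioi (0 : ℝ), deriv θ t * ℓ₃ (z t) = ∫ t in Ioi (0 : ℝ), θ₁ t * ℓ₃ (z t) :=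
      setIntegral_congr_fun measurableSet_Ioi fun t ht => by simp only [e1 t ht]
    rw [c1, c2, c3,
      integral_Ioi_mul_clm_eq_neg_deriv hz ℓ₁ h2s hT h20,
      integral_Ioi_mul_clm_eq_neg_deriv hz ℓ₂ h0s hT h00,
      integral_Ioi_mul_clm_eq_neg_deriv hz ℓ₃ h1s hT h10] at h
    simp only [h0d, h1d, h2d, ← hZ] at h
    rw [integral_Ioi_mul_clm_eq_neg_deriv hZc.locallyIntegrable ℓ₂ h1s hT h10,
      integral_Ioi_mul_clm_eq_neg_deriv hZc.locallyIntegrable ℓ₃ h2s hT h20] at h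
    simp only [h1d, h2d, ← hY] at h
    rw [integral_Ioi_mul_clm_eq_neg_deriv hYc.locallyIntegrable ℓ₂ h2s hT h20] at h
    simp only [h2d, ← hX] at h
    have hi : ∀ {F : ℝ → E} (ℓ : E →L[ℝ] ℝ), Continuous F →
        IntegrableOn (fun t => κ t * ℓ (F t)) (Ioi 0) := fun {F} ℓ hF =>
      ((hκ.continuous.mul (ℓ.continuous.comp hF)).integrable_of_hasCompactSupport
        hκc.mul_right).integrableOn
    have hsplit : ∫ t in Ioi (0 : ℝ), κ t * G t = (∫ t in Ioi (0 : ℝ), κ t * ℓ₁ (Z t))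
        - (∫ t in Ioi (0 : ℝ), κ t * ℓ₂ (X t)) + ∫ t in Ioi (0 : ℝ), κ t * ℓ₃ (Y t) := by
      rw [← integral_sub (hi ℓ₁ hZc) (hi ℓ₂ hXc),
        ← integral_add (f := fun t => κ t * ℓ₁ (Z t) - κ t * ℓ₂ (X t))
          ((hi ℓ₁ hZc).sub (hi ℓ₂ hXc)) (hi ℓ₃ hYc)]
      refine integral_congr_ae (Eventually.of_forall fun t => ?_)
      simp only [hG]
      ring
    rw [hsplit]
    linarith
  have hae : ∀ᵐ t, t ∈ Ioi (0 : ℝ) → G t = 0 := by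
    refine isOpen_Ioi.ae_eq_zero_of_integral_contDiff_smul_eq_zero
      (hGc.locallyIntegrable.locallyIntegrableOn _) fun κ h1 h2 h3 => ?_
    rw [← key κ h1 h2]
    refine (setIntegral_eq_integral_of_forall_compl_eq_zero fun t ht => ?_).symm
    have : κ t = 0 := by
      by_contra hne
      exact ht (h3 (subset_tsupport _ hne))
    rw [this, zero_smul]
  have hset : EqOn G 0 (Ici 0) := by
    refine Measure.eqOn_of_ae_eq (μ := volume) ?_ hGc.continuousOn continuousOn_const
      (by rw [interior_Ici, closure_Ioi])
    rw [← restrict_Ioi_eq_restrict_Ici]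
    exact (ae_restrict_iff' measurableSet_Ioi).2 hae
  exact hset ht

end Time

/-! ### Uniqueness -/

/-- The functional `w ↦ ⟪f, w⟫_{L²}` on `H¹`. -/
def pairing (f : L2 n) : H1 n →L[ℝ] ℝ := (innerSL ℝ f).comp (toL2L n)

/-- The weak formulation tested with a product `θ(t) ψ(x)`. -/
theorem integral_mul_tensor {a : Euc n → ℝ} (ha : Continuous a) {θ : ℝ → ℝ} (hθ : ContDiff ℝ ∞ θ)
    {ψ : Euc n → ℝ} (h : IsTest ψ) (f : L2 n) (t : ℝ) :
    ∫ x, f x * (iteratedDeriv 2 (fun s => θ s * ψ x) t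
        - Laplacian.laplacian (fun y => θ t * ψ y) x - a x * deriv (fun s => θ s * ψ x) t)
      = deriv (deriv θ) t * ⟪h.toL2, f⟫_ℝ - θ t * ⟪h.laplacian.toL2, f⟫_ℝ
        - deriv θ t * ⟪(h.memLp_mul ha).toLp _, f⟫_ℝ := by
  have hd1 : ∀ x, deriv (fun s => θ s * ψ x) = fun t => deriv θ t * ψ x := fun x =>
    funext fun t => deriv_mul_const ((hθ.differentiable (by simp)) t) _
  have hd2 : ∀ x, iteratedDeriv 2 (fun s => θ s * ψ x) t = deriv (deriv θ) t * ψ x := fun x => by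
    rw [iteratedDeriv_succ, iteratedDeriv_one, hd1]
    exact deriv_mul_const (((contDiff_infty_iff_deriv.1 hθ).2.differentiable (by simp)) t) _
  have hl : ∀ x, Laplacian.laplacian (fun y => θ t * ψ y) x
      = θ t * Laplacian.laplacian ψ x := fun x =>
    InnerProductSpace.laplacian_smul (θ t)
      (contDiff_infty.1 h.smooth 2).contDiffAt
  rw [real_inner_comm, real_inner_comm f, real_inner_comm f, h.inner_toL2, h.laplacian.inner_toL2,
    inner_toLp, ← integral_const_mul, ← integral_const_mul, ← integral_const_mul]
  have i1 := ((Lp.memLp f).integrable_mul (h.memLp 2)).const_mul (deriv (deriv θ) t)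
  have i2 := ((Lp.memLp f).integrable_mul (h.laplacian.memLp 2)).const_mul (θ t)
  have i3 := ((Lp.memLp f).integrable_mul (h.memLp_mul ha)).const_mul (deriv θ t)
  have e12 := integral_sub i1 i2
  have e := integral_sub (i1.sub i2) i3
  simp only [Pi.sub_apply, Pi.mul_apply] at e e12
  rw [← e12, ← e]
  refine integral_congr_ae (Eventually.of_forall fun x => ?_)
  simp only [hd2, hl, hd1]
  ring

theorem InSolutionClass.integrableOn_mul {w : ℝ → H1 n} {wt : ℝ → L2 n} (hw : InSolutionClass w wt)
    (ℓ : H1 n →L[ℝ] ℝ) {η : ℝ → ℝ} (hη : Continuous η) (hc : HasCompactSupport η) :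
    IntegrableOn (fun t => η t * ℓ (w t)) (Ioi 0) := by
  have h : MemLp (fun t => ℓ (w t)) ∞ timeMeasure := ℓ.comp_memLp' hw.memLp_H1
  refine integrable_smul_of_bounded hη hc h.1
    (C := (eLpNormEssSup (fun t => ℓ (w t)) timeMeasure).toReal) ?_
  filter_upwards [ae_le_eLpNormEssSup (f := fun t => ℓ (w t)) (μ := timeMeasure)] with t ht
  rw [← toReal_enorm]
  exact ENNReal.toReal_mono (by simpa [eLpNorm_exponent_top] using h.2.ne) ht

theorem isSTTest_mul {θ : ℝ → ℝ} (hθ : ContDiff ℝ ∞ θ) (hc : HasCompactSupport θ)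
    {ψ : Euc n → ℝ} (h : IsTest ψ) : IsSTTest (Function.uncurry fun t x => θ t * ψ x) := by
  refine ⟨(hθ.comp contDiff_fst).mul (h.smooth.comp contDiff_snd), ?_⟩
  refine HasCompactSupport.intro (hc.isCompact.prod h.compact.isCompact) fun p hp => ?_
  simp only [Function.uncurry]
  by_cases h1 : p.1 ∈ tsupport θ
  · rw [image_eq_zero_of_notMem_tsupport fun h2 => hp ⟨h1, h2⟩, mul_zero]
  · rw [image_eq_zero_of_notMem_tsupport h1, zero_mul]

theorem InSolutionClass.integral_tensor {w : ℝ → H1 n} {wt : ℝ → L2 n} (hw : InSolutionClass w wt)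
    {a : Euc n → ℝ} (ha : Continuous a) {u₀ u₁ : Euc n → ℝ}
    (hs : IsWeakSolution a u₀ u₁ fun t => (w t).toL2) {θ : ℝ → ℝ} (hθ : ContDiff ℝ ∞ θ)
    (hc : HasCompactSupport θ) {ψ : Euc n → ℝ} (h : IsTest ψ) :
    (∫ t in Ioi (0 : ℝ), deriv (deriv θ) t * pairing h.toL2 (w t))
        - (∫ t in Ioi (0 : ℝ), θ t * pairing h.laplacian.toL2 (w t))
        - (∫ t in Ioi (0 : ℝ), deriv θ t * pairing ((h.memLp_mul ha).toLp _) (w t))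
      = (∫ x, u₁ x * (θ 0 * ψ x)) - (∫ x, u₀ x * deriv (fun s => θ s * ψ x) 0)
          + ∫ x, a x * u₀ x * (θ 0 * ψ x) := by
  have hS := isSTTest_mul hθ hc h
  rw [← hs (fun t x => θ t * ψ x) hS.smooth hS.compact]
  simp only [integral_mul_tensor ha hθ h]
  have hθ1 := (contDiff_infty_iff_deriv.1 hθ).2
  have hθ2 := (contDiff_infty_iff_deriv.1 hθ1).2
  have i1 := hw.integrableOn_mul (pairing h.toL2) hθ2.continuous hc.deriv.deriv
  have i2 := hw.integrableOn_mul (pairing h.laplacian.toL2) hθ.continuous hc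
  have i3 := hw.integrableOn_mul (pairing ((h.memLp_mul ha).toLp _)) hθ1.continuous hc.deriv
  have e12 := integral_sub i1 i2
  have e := integral_sub (i1.sub i2) i3
  simp only [Pi.sub_apply] at e e12
  rw [← e12, ← e]
  rfl

/-- The integrated equation tested with a cut off element of `H¹`. -/
theorem inner_cutoff_eq_zero {a : Euc n → ℝ} (ha : Continuous a) {X Y Z : H1 n}
    (heq : ∀ (ψ : Euc n → ℝ) (h : IsTest ψ), ⟪h.toL2, Z.toL2⟫_ℝ - ⟪h.laplacian.toL2, X.toL2⟫_ℝ
      + ⟪(h.memLp_mul ha).toLp _, Y.toL2⟫_ℝ = 0)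
    {χ : Euc n → ℝ} (hχ : IsTest χ) (y : H1 n) :
    ⟪hχ.mulL y.toL2, Z.toL2⟫_ℝ + ⟪hχ.mulV y.grad + hχ.mulGrad y.toL2, X.grad⟫_ℝ
      + ⟪mulOp (ContinuousLinearMap.mul ℝ ℝ) (ha.mul hχ.continuous) hχ.compact.mul_left y.toL2,
          Y.toL2⟫_ℝ = 0 := by
  -- For a test function `φ`, the product `χ φ` is admissible in the equation. Since `a χ` is
  -- bounded, every term is continuous in the `H¹` norm, and density gives all `y`.
  refine H1.induction_isTest (P := fun y : H1 n => ⟪hχ.mulL y.toL2, Z.toL2⟫_ℝ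
    + ⟪hχ.mulV y.grad + hχ.mulGrad y.toL2, X.grad⟫_ℝ
    + ⟪mulOp (ContinuousLinearMap.mul ℝ ℝ) (ha.mul hχ.continuous) hχ.compact.mul_left y.toL2,
        Y.toL2⟫_ℝ = 0) ?_ (fun φ h => ?_) y
  · have h1 : Continuous fun y : H1 n => y.toL2 := (toL2L n).continuous
    have h2 : Continuous fun y : H1 n => y.grad := (gradL n).continuous
    refine isClosed_eq ?_ continuous_const
    exact ((((hχ.mulL).continuous.comp h1).inner continuous_const).add
      ((((hχ.mulV).continuous.comp h2).add ((hχ.mulGrad).continuous.comp h1)).inner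
        continuous_const)).add
      (((ContinuousLinearMap.continuous _).comp h1).inner continuous_const)
  · have hm := hχ.mul h
    have e1 : hχ.mulL h.toL2 = hm.toL2 := by
      refine IsTest.toL2_congr _ ?_
      filter_upwards [hχ.coeFn_mulL h.toL2, h.coeFn_toL2] with x h1 h2
      rw [h1, h2]
    have e2 : hm.toH1 = hχ.mulH1 h.toH1 := toL2_injective (by
      rw [IsTest.toL2_mulH1, IsTest.toL2_toH1, IsTest.toL2_toH1, e1])
    have e3 : (hm.memLp_mul ha).toLp _ = mulOp (ContinuousLinearMap.mul ℝ ℝ)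
        (ha.mul hχ.continuous) hχ.compact.mul_left h.toL2 := by
      refine Lp.ext ?_
      filter_upwards [(hm.memLp_mul ha).coeFn_toLp, coeFn_mulOp (ContinuousLinearMap.mul ℝ ℝ)
        (ha.mul hχ.continuous) hχ.compact.mul_left h.toL2, h.coeFn_toL2] with x h1 h2 h3
      rw [h1, h2, h3, ContinuousLinearMap.mul_apply', Pi.mul_apply, mul_assoc]
    have e4 := hm.inner_grad X.isWeakGradient
    rw [e2, IsTest.grad_mulH1, real_inner_comm, real_inner_comm hm.laplacian.toL2] at e4
    have e5 := heq _ hm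
    rw [IsTest.toL2_toH1] at e4 ⊢
    rw [e1, e4, ← e3]
    linarith

/-- The energy method for the integrated equation. -/
theorem eq_zero_of_integrated_equation {a : Euc n → ℝ} (ha : Continuous a) (ha0 : ∀ x, 0 ≤ a x)
    {X Y Z : ℝ → H1 n} (hX : ∀ t, HasDerivAt X (Y t) t) (hY : ∀ t, HasDerivAt Y (Z t) t)
    (hX0 : X 0 = 0) (hY0 : Y 0 = 0)
    (heq : ∀ (ψ : Euc n → ℝ) (h : IsTest ψ) (t : ℝ), 0 ≤ t →
      ⟪h.toL2, (Z t).toL2⟫_ℝ - ⟪h.laplacian.toL2, (X t).toL2⟫_ℝ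
        + ⟪(h.memLp_mul ha).toLp _, (Y t).toL2⟫_ℝ = 0) {T : ℝ} (hT : 0 ≤ T) : Y T = 0 := by
  have hYl : ∀ t, HasDerivAt (fun s => (Y s).toL2) (Z t).toL2 t := fun t =>
    (toL2L n).hasFDerivAt.comp_hasDerivAt t (hY t)
  have hXg : ∀ t, HasDerivAt (fun s => (X s).grad) (Y t).grad t := fun t =>
    (gradL n).hasFDerivAt.comp_hasDerivAt t (hX t)
  have hYc : Continuous fun s => (Y s).toL2 :=
    continuous_iff_continuousAt.2 fun t => (hYl t).continuousAt
  have hXc : Continuous fun s => (X s).grad :=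
    continuous_iff_continuousAt.2 fun t => (hXg t).continuousAt
  obtain ⟨K, hK⟩ := (isCompact_Icc (a := (0 : ℝ)) (b := T)).exists_bound_of_continuousOn
    (hYc.norm.mul hXc.norm).continuousOn
  obtain ⟨C, hC0, hC⟩ := exists_norm_gradient_cutoff_le n
  have key : ∀ N : ℕ, ⟪(isTest_cutoff n N).mulL (Y T).toL2, (Y T).toL2⟫_ℝ
      + ⟪(isTest_cutoff n N).mulV (X T).grad, (X T).grad⟫_ℝ
      ≤ C / ((N : ℝ) + 1) * (2 * K * T) := by
    intro N
    set hχ := isTest_cutoff n N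
    -- The localized energy of `X`, with `Y = X'`. Testing with `χ Y` leaves a damping term of good
    -- sign and the error `⟪Y ∇χ, ∇X⟫` of order `1/(N+1)`.
    let e : ℝ → ℝ := fun t => ⟪hχ.mulL (Y t).toL2, (Y t).toL2⟫_ℝ
      + ⟪hχ.mulV (X t).grad, (X t).grad⟫_ℝ
    have he : ∀ t, HasDerivAt e (2 * (⟪hχ.mulL (Y t).toL2, (Z t).toL2⟫_ℝ
        + ⟪hχ.mulV (Y t).grad, (X t).grad⟫_ℝ)) t := by
      intro t
      refine HasDerivAt.congr_deriv
        (((hχ.mulL.hasFDerivAt.comp_hasDerivAt t (hYl t)).inner ℝ (hYl t)).add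
        ((hχ.mulV.hasFDerivAt.comp_hasDerivAt t (hXg t)).inner ℝ (hXg t))) ?_
      simp only [Function.comp_apply]
      rw [hχ.inner_mulL_comm (Z t).toL2, real_inner_comm _ (Z t).toL2,
        hχ.inner_mulV_comm (X t).grad, real_inner_comm _ (X t).grad]
      ring
    have hle : ∀ t ∈ Icc 0 T, deriv e t ≤ 2 * (C / ((N : ℝ) + 1) * K) := by
      intro t ht
      have h1 := inner_cutoff_eq_zero ha (fun ψ h => heq ψ h t ht.1) hχ (Y t)
      have h2 : 0 ≤ ⟪mulOp (ContinuousLinearMap.mul ℝ ℝ) (ha.mul hχ.continuous)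
          hχ.compact.mul_left (Y t).toL2, (Y t).toL2⟫_ℝ := by
        rw [inner_L2]
        refine integral_nonneg_of_ae ?_
        filter_upwards [coeFn_mulOp (ContinuousLinearMap.mul ℝ ℝ) (ha.mul hχ.continuous)
          hχ.compact.mul_left (Y t).toL2] with x hx
        rw [hx, ContinuousLinearMap.mul_apply', mul_assoc]
        exact mul_nonneg (mul_nonneg (ha0 x) (cutoff_nonneg N x)) (mul_self_nonneg _)
      have h3 : -⟪hχ.mulGrad (Y t).toL2, (X t).grad⟫_ℝ ≤ C / ((N : ℝ) + 1) * K := by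
        refine (neg_le_abs _).trans ((abs_real_inner_le_norm _ _).trans ?_)
        refine (mul_le_mul_of_nonneg_right (norm_mulGrad_cutoff_le hC N _)
          (norm_nonneg _)).trans ?_
        rw [mul_assoc]
        gcongr
        exact (le_abs_self _).trans (hK t ht)
      rw [(he t).deriv]
      rw [inner_add_left] at h1
      linarith
    have hmv := Convex.image_sub_le_mul_sub_of_deriv_le (f := e) (convex_Icc 0 T)
      (fun t _ => (he t).continuousAt.continuousWithinAt)
      (fun t _ => (he t).differentiableAt.differentiableWithinAt)
      (fun t ht => hle t (interior_subset ht)) 0 (left_mem_Icc.2 hT) T (right_mem_Icc.2 hT) hT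
    have he0 : e 0 = 0 := by
      have h1 : (Y 0).toL2 = 0 := by rw [hY0, ← toL2L_apply, map_zero]
      have h2 : (X 0).grad = 0 := by rw [hX0, ← gradL_apply, map_zero]
      simp only [e]
      rw [h1, h2, inner_zero_right, inner_zero_right, add_zero]
    rw [he0] at hmv
    change e T ≤ _
    linarith
  have hlim := le_of_tendsto_of_tendsto' ((tendsto_inner_mulL_cutoff (Y T).toL2 (Y T).toL2).add
    (tendsto_inner_mulV_cutoff (X T).grad (X T).grad))
    ((tendsto_const_div_natCast_add_one C).mul_const (2 * K * T)) key
  rw [zero_mul, real_inner_self_eq_norm_sq, real_inner_self_eq_norm_sq] at hlim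
  have h0 : ‖(Y T).toL2‖ = 0 :=
    pow_eq_zero_iff two_ne_zero |>.1 (le_antisymm (by nlinarith [sq_nonneg ‖(X T).grad‖])
      (sq_nonneg _))
  exact toL2_injective (by rw [norm_eq_zero.1 h0, ← toL2L_apply, map_zero])

/-- Uniqueness of weak solutions. -/
theorem InSolutionClass.ae_eq {u w : ℝ → H1 n} {ut wt : ℝ → L2 n} (hw : InSolutionClass w wt)
    (hu : InSolutionClass u ut) {a : Euc n → ℝ} (ha : Continuous a) (ha0 : ∀ x, 0 ≤ a x)
    {u₀ u₁ : Euc n → ℝ} (hws : IsWeakSolution a u₀ u₁ fun t => (w t).toL2)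
    (hus : IsWeakSolution a u₀ u₁ fun t => (u t).toL2) : w =ᵐ[timeMeasure] u := by
  -- Extended by zero to negative times, the difference is locally integrable on the whole line.
  set z : ℝ → H1 n := (Ioi 0).indicator fun t => w t - u t with hz
  have hzl : LocallyIntegrable z := by
    have h : MemLp z ∞ volume :=
      (memLp_indicator_iff_restrict measurableSet_Ioi).2 (hw.memLp_H1.sub hu.memLp_H1)
    exact h.locallyIntegrable le_top
  set Z : ℝ → H1 n := fun t => ∫ s in (0 : ℝ)..t, z s with hZ
  set Y : ℝ → H1 n := fun t => ∫ s in (0 : ℝ)..t, Z s with hY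
  set X : ℝ → H1 n := fun t => ∫ s in (0 : ℝ)..t, Y s with hX
  have hZc : Continuous Z := intervalIntegral.continuous_primitive
    (fun a b => (hzl.integrableOn_isCompact isCompact_uIcc).intervalIntegrable) 0
  have hd : ∀ {F : ℝ → H1 n}, Continuous F → ∀ t,
      HasDerivAt (fun t => ∫ s in (0 : ℝ)..t, F s) (F t) t := fun {F} hF t =>
    intervalIntegral.integral_hasDerivAt_right (hF.intervalIntegrable _ _)
      (hF.stronglyMeasurableAtFilter _ _) hF.continuousAt
  have hYd : ∀ t, HasDerivAt Y (Z t) t := hd hZc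
  have hYc : Continuous Y := continuous_iff_continuousAt.2 fun t => (hYd t).continuousAt
  have hXd : ∀ t, HasDerivAt X (Y t) t := hd hYc
  have hXc : Continuous X := continuous_iff_continuousAt.2 fun t => (hXd t).continuousAt
  -- After three integrations `X` and `Y` are differentiable in `H¹`, as the energy method requires.
  -- Both solutions have the same data, so the boundary terms cancel in the difference.
  have hY0 : ∀ t, 0 ≤ t → Y t = 0 := fun t ht => by
    refine eq_zero_of_integrated_equation ha ha0 hXd hYd (by simp [hX]) (by simp [hY])
      (fun ψ h t ht => ?_) ht
    refine eq_zero_of_weak_second_order hzl (fun t => rfl) (fun t => rfl) (fun t => rfl) hZc hYc hXc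
      (pairing h.toL2) (pairing h.laplacian.toL2) (pairing ((h.memLp_mul ha).toLp _))
      (fun θ hθ hc => ?_) ht
    have hθ1 := (contDiff_infty_iff_deriv.1 hθ).2
    have hθ2 := (contDiff_infty_iff_deriv.1 hθ1).2
    have hsub : ∀ {η : ℝ → ℝ} (ℓ : H1 n →L[ℝ] ℝ), Continuous η → HasCompactSupport η →
        ∫ t in Ioi (0 : ℝ), η t * ℓ (z t) = (∫ t in Ioi (0 : ℝ), η t * ℓ (w t))
          - ∫ t in Ioi (0 : ℝ), η t * ℓ (u t) := fun {η} ℓ h1 h2 => by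
      rw [← integral_sub (hw.integrableOn_mul ℓ h1 h2) (hu.integrableOn_mul ℓ h1 h2)]
      refine setIntegral_congr_fun measurableSet_Ioi fun t ht => ?_
      simp only [hz, indicator_of_mem ht, map_sub, mul_sub]
    rw [hsub _ hθ2.continuous hc.deriv.deriv, hsub _ hθ.continuous hc,
      hsub _ hθ1.continuous hc.deriv]
    have e1 := hw.integral_tensor ha hws hθ hc h
    have e2 := hu.integral_tensor ha hus hθ hc h
    linarith
  have hZ0 : ∀ t, 0 < t → Z t = 0 := fun t ht => by
    refine (hYd t).unique ((hasDerivAt_const t (0 : H1 n)).congr_of_eventuallyEq ?_)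
    filter_upwards [Ioi_mem_nhds ht] with s hs using hY0 s (le_of_lt hs)
  -- The last derivative, from `Z = 0` to `z = 0`, exists only almost everywhere, by Lebesgue
  -- differentiation.
  have hLD := _root_.LocallyIntegrable.ae_hasDerivAt_integral hzl
  refine (ae_restrict_iff' measurableSet_Ioi).2 ?_
  filter_upwards [hLD] with t ht ht0
  have h1 : z t = 0 := by
    refine (ht 0).unique ((hasDerivAt_const t (0 : H1 n)).congr_of_eventuallyEq ?_)
    filter_upwards [Ioi_mem_nhds ht0] with s hs using hZ0 s hs
  rw [hz, indicator_of_mem ht0] at h1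
  exact sub_eq_zero.1 h1

end DampedWave

end

theorem theorem1p1 (n : ℕ) (hn : 3 ≤ n) (V₀ : ℝ) (hV₀ : 0 < V₀) :
    ∃ C : ℝ, 0 < C ∧
      ∀ (a : DampedWave.Euc n → ℝ), Continuous a → (∀ x, V₀ ≤ a x) →
      ∀ (u₀ u₁ : DampedWave.H1 n), DampedWave.IsH2 u₀ →
        MemLp u₀.toL2 1 volume → MemLp u₁.toL2 1 volume →
        MemLp (fun x => a x * u₀.toL2 x) 1 volume →
        MemLp (fun x => a x * u₀.toL2 x) 2 volume →
      ∃ (u : ℝ → DampedWave.H1 n) (ut : ℝ → DampedWave.L2 n),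
        -- existence of a weak solution in the class, with `u` continuous from `[0,∞)` to `L²`
        DampedWave.InSolutionClass u ut ∧
        ContinuousOn (fun t => (u t).toL2) (Ici 0) ∧
        DampedWave.IsWeakSolution a u₀.toL2 u₁.toL2 (fun t => (u t).toL2) ∧
        -- uniqueness in the whole class
        (∀ (w : ℝ → DampedWave.H1 n) (wt : ℝ → DampedWave.L2 n),
          DampedWave.InSolutionClass w wt →
          DampedWave.IsWeakSolution a u₀.toL2 u₁.toL2 (fun t => (w t).toL2) →
          w =ᵐ[DampedWave.timeMeasure] u) ∧
        -- decay estimates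
        (∀ t : ℝ, 0 ≤ t →
          ‖(u t).toL2‖ ^ 2 ≤ C * DampedWave.dataNorm a u₀ u₁ ^ 2 * (1 + t)⁻¹) ∧
        (∀ᵐ t ∂DampedWave.timeMeasure,
          DampedWave.energy (u t) (ut t)
            ≤ C * DampedWave.dataNorm a u₀ u₁ ^ 2 * ((1 + t) ^ 2)⁻¹) := by
  obtain ⟨C, hC, h⟩ := DampedWave.exists_weak_solution hn hV₀
  refine ⟨C, hC, fun a ha haV u₀ u₁ _ _ hu₁ hau1 hau2 => ?_⟩
  obtain ⟨u, ut, hcl, hc, hs, hd1, hd2⟩ := h a ha haV u₀ u₁ hu₁ hau1 hau2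
  exact ⟨u, ut, hcl, hc, hs, fun w wt hw hws =>
    hw.ae_eq hcl ha (fun x => hV₀.le.trans (haV x)) hws hs, hd1, hd2⟩
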